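/- **Setting.** There are $K\ge 1$ arms and $T\ge 1$ rounds. At round $t$ the environment has a preference matrix $P_t\in[0,1]^{K\times K}$ with $P_t(a,b)+P_t(b,a)=1$; the sequence $P_1,\dots,P_T$ is fixed in advance. The learner plays a pair $(i_t,j_t)$ and observes $O_t\sim\mathrm{Ber}(P_t(i_t,j_t))$. Assume the General Identifiability Condition (GIC): at each round $t$ there is an arm $a_t^*$ with $P_t(a_t^*,b)=\max_a P_t(a,b)$ for all arms $b$. Let $a_t^{\mathrm C}$ be a Condorcet winner at round $t$, i.e. $P_t(a_t^{\mathrm C},a)\ge \tfrac12$ for all $a$ (under GIC one exists, e.g. $a_t^*$). The Condorcet dynamic regret is $$\mathrm{Regret}^{\mathrm C}=\sum_{t=1}^T\tfrac12\big(P_t(a_t^{\mathrm C},i_t)+P_t(a_t^{\mathrm C},j_t)-1\big).$$ **Non-stationarity.** Let $V_T=\sum_{t=2}^T\max_{a,b}|P_t(a,b)-P_{t-1}(a,b)|$. Let $\zeta_0=1$ and let $\zeta_{i+1}$ be the smallest $t>\zeta_i$ for which there is no arm $a$ such that, for all $s$ with $\zeta_i<s\le t$ and all arms $b$, $|P_s(a_s^*,b)-P_s(a,b)|\le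 (K^2/(s-\zeta_i))^{1/3}$. Let $\tilde S$ be the number of approximate winner phases, i.e. the number of $i\ge0$ with $\zeta_i\le T$ (one plus the number of approximate winner changes). **Algorithm** (inputs $K$, $T$ and a constant $C$ only). Put $\gamma_0=1$ and $\gamma_n=\min\{K^{2/3}n^{-1/3},1\}$ for $n\ge 1$. Time is divided into episodes; the first starts at round $1$. An episode starting at round $t_0$ has a global candidate set, initially $[K]$, and runs the base instance $\mathrm{Base}(t_0,T+1-t_0)$. For each round $s>t_0$ of the episode and each $m\in\{2,4,\dots,2^{\lceil\log_2T\rceil}\}$ there is an independent variable $B_{s,m}\sim\mathrm{Ber}(m^{-1/3}(s-t_0)^{-2/3})$. An instance $\mathrm{Base}(s,m)$ starts at round $s$ with candidate set $[K]$ and may run in the rounds $s,\dots,s+m$; at a round $t$ at which it is running with candidate set $A_t$, put $\eta_t=\gamma_{t-s}$ and draw $i_t,j_t$ independently from $q_t=\eta_t\,\mathrm{Unif}([K])+(1-\eta_t)\,\mathrm{Unif}(A_t)$. At the beginning of a round $t>t_0$: if $B_{t,m}=1$ for some $m$, the running instance is suspended and $\mathrm{Base}(t,m)$, with the largest such $m$,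 starts running. Otherwise, instances whose scheduled rounds are over return, the most recently suspended instance that remains (or the running one, if it is not over) runs, and, if it started at round $s$, it removes from its candidate set the arms evicted over $[s,t)$; the arms evicted over $[t_0,t)$ are removed from the global candidate set, and if the latter becomes empty, a new episode starts at round $t$. Here an arm $a$ is evicted over $[s,t)$ if there are rounds $s\le s_1\le s_2<t$ and arms $a',c$ such that $a,a'\in A_r$ for all $r\in[s_1,s_2]$ and $\sum_{r=s_1}^{s_2}\big(\hat b_r(a',c)-\hat b_r(a,c)\big)>C\log(T)\,F([s_1,s_2])$, where $$\hat b_r(a,c)=\frac{\mathbf 1\{i_r=a,\,j_r=c\}\,(O_r-\frac12)}{q_r(a)\,q_r(c)},$$ $$F([s_1,s_2])=\max\Big\{K^{2/3}(s_2-s_1)^{2/3},\ \Big(K^2\sum_{r=s_1}^{s_2}\eta_r^{-1}\Big)^{1/2}+K^2\max_{s_1\le r\le s_2}\eta_r^{-1}\Big\}.$$ **Theorem.** There is an absolute constant $C_0>0$ such that for every $C\ge C_0$ there are constants $c>0$ and $p\in\mathbb N$, depending only on $C$, such that for all $K,T\ge1$, all environments satisfying GIC, and all choices of $a_t^*$ and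 $a_t^{\mathrm C}$, the algorithm with constant $C$ satisfies $$\mathbb E[\mathrm{Regret}^{\mathrm C}]\le c\,(1+\log(KT))^p\,\min\big\{K^{2/3}T^{2/3}\tilde S^{1/3},\ K^{1/2}V_T^{1/4}T^{3/4}+K^{2/3}T^{2/3}\big\}.$$ -/

import Mathlib

open Finset

noncomputable section

namespace DuelingBandit

/-! ### Preference environments

Rounds are numbered `1, …, T` and `P t a b` is the probability that arm `a` beats arm `b` in a duel
at round `t`. -/

/-- `M` is a preference matrix: entries are probabilities, and `M a b + M b a = 1`
(so `M a a = 1/2`). -/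
def IsPreferenceMatrix {K : ℕ} (M : Fin K → Fin K → ℝ) : Prop :=
  ∀ a b, 0 ≤ M a b ∧ M a b ≤ 1 ∧ M a b + M b a = 1

/-- `w` maximises every column of `M`, i.e. `w` has the largest weighted Borda score for every
weight. The General Identifiability Condition asks for such an arm at each round. -/
def IsDominantArm {K : ℕ} (M : Fin K → Fin K → ℝ) (w : Fin K) : Prop :=
  ∀ a b, M a b ≤ M w b

/-- `w` is a Condorcet winner of `M`. -/
def IsCondorcetWinner {K : ℕ} (M : Fin K → Fin K → ℝ) (w : Fin K) : Prop :=
  ∀ a, 1 / 2 ≤ M w a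

/-- Total variation `V_T = ∑_{t=2}^T max_{a,b} |P_t(a,b) - P_{t-1}(a,b)|`. -/
def totalVariation {K : ℕ} (P : ℕ → Fin K → Fin K → ℝ) (T : ℕ) : ℝ :=
  ∑ t ∈ Icc 2 T, ⨆ x : Fin K × Fin K, |P t x.1 x.2 - P (t - 1) x.1 x.2|

/-- Arm `a` is an approximate winner on the rounds `[z, t]`: at each round `s` of it,
`|P_s(a_s^*, b) - P_s(a, b)| ≤ (K^2 / (s - z))^{1/3}` for all arms `b`
(no constraint at `s = z`, where the right-hand side is infinite). -/
def IsApproxWinner {K : ℕ} (P : ℕ → Fin K → Fin K → ℝ) (astar : ℕ → Fin K)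
    (z t : ℕ) (a : Fin K) : Prop :=
  ∀ s, z < s → s ≤ t → ∀ b : Fin K,
    |P s (astar s) b - P s a b| ≤ ((K : ℝ) ^ 2 / ((s : ℝ) - (z : ℝ))) ^ (1 / 3 : ℝ)

/-- The approximate winner changes: `ζ_0 = 1`, and `ζ_{i+1}` is the smallest `t > ζ_i` such that
no arm is an approximate winner on `[ζ_i, t]` (`⊤` if there is none). -/
def approxChange {K : ℕ} (P : ℕ → Fin K → Fin K → ℝ) (astar : ℕ → Fin K) : ℕ → ℕ∞
  | 0 => 1
  | i + 1 => sInf {x : ℕ∞ | ∃ z t : ℕ, approxChange P astar i = (z : ℕ∞) ∧ x = (t : ℕ∞) ∧ z < t ∧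
      ¬ ∃ a, IsApproxWinner P astar z t a}

/-- The number of approximate winner phases `[ζ_i, ζ_{i+1})` begun within the first `T` rounds. -/
def approxPhases {K : ℕ} (P : ℕ → Fin K → Fin K → ℝ) (astar : ℕ → Fin K) (T : ℕ) : ℕ :=
  Set.ncard {i : ℕ | approxChange P astar i ≤ (T : ℕ∞)}

/-! ### Dueling bandit algorithms and their regret -/

/-- A coin showing `true` with probability `p` (truncated to `[0, 1]`). -/
def coin (p : ℝ) : PMF Bool :=
  PMF.ofFintype (fun b => if b then min (ENNReal.ofReal p) 1 else 1 - min (ENNReal.ofReal p) 1)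
    (by simp [add_tsub_cancel_of_le])

/-- A (randomised) dueling bandit algorithm on `K` arms. At round `t` it first updates its state
with internal randomness (`plan`), then draws the pair `(i_t, j_t)` to be played (`draw`), and
then receives the outcome of the duel (`observe`). -/
structure DuelingAlgorithm (K : ℕ) where
  State : Type
  start : State
  plan : ℕ → State → PMF State
  draw : ℕ → State → PMF (Fin K × Fin K)
  observe : ℕ → State → Fin K × Fin K → Bool → State

/-- Joint law of the state after `n` rounds and of the pairs played in the rounds `1, …, n`
(the entry with index `t : Fin n` is the pair of round `t + 1`) when duels follow `P`. -/
def DuelingAlgorithm.law {K : ℕ} (alg : DuelingAlgorithm K) (P : ℕ → Fin K → Fin K → ℝ) :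
    (n : ℕ) → PMF (alg.State × (Fin n → Fin K × Fin K))
  | 0 => PMF.pure (alg.start, Fin.elim0)
  | n + 1 =>
    (alg.law P n).bind fun y =>
    (alg.plan (n + 1) y.1).bind fun σ =>
    (alg.draw (n + 1) σ).bind fun ij =>
    (coin (P (n + 1) ij.1 ij.2)).map fun o =>
      (alg.observe (n + 1) σ ij o, Fin.snoc y.2 ij)

/-- Condorcet dynamic regret `∑_{t=1}^T (P_t(a_t^C, i_t) + P_t(a_t^C, j_t) - 1) / 2` of a
sequence of plays. -/
def condorcetRegret {K T : ℕ} (P : ℕ → Fin K → Fin K → ℝ) (aC : ℕ → Fin K)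
    (plays : Fin T → Fin K × Fin K) : ℝ :=
  ∑ t : Fin T, (P (t + 1) (aC (t + 1)) (plays t).1 + P (t + 1) (aC (t + 1)) (plays t).2 - 1) / 2

/-- Expected Condorcet dynamic regret of an algorithm over `T` rounds. -/
def expectedCondorcetRegret {K : ℕ} (alg : DuelingAlgorithm K) (P : ℕ → Fin K → Fin K → ℝ)
    (aC : ℕ → Fin K) (T : ℕ) : ℝ :=
  ∑ plays : Fin T → Fin K × Fin K,
    (((alg.law P T).map Prod.snd) plays).toReal * condorcetRegret P aC plays

/-! ### The algorithm: successive elimination with randomly scheduled replays -/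

section Algorithm

variable {K : ℕ}

/-- Learning rate `γ_n = min (K^{2/3} n^{-1/3}, 1)`, with `γ_0 = 1`. -/
def learningRate (K n : ℕ) : ℝ :=
  if n = 0 then 1 else min ((K : ℝ) ^ (2 / 3 : ℝ) * (n : ℝ) ^ (-(1 / 3) : ℝ)) 1

open Classical in
/-- Play distribution `q`: with probability `η` uniform over all arms, otherwise uniform over the
candidate set `A`. (The algorithm never calls it with `A` empty.) -/
def playDist [NeZero K] (A : Finset (Fin K)) (η : ℝ) : PMF (Fin K) :=
  (coin η).bind fun explore =>
    if h : explore = false ∧ A.Nonempty then PMF.uniformOfFinset A h.2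
    else PMF.uniformOfFintype (Fin K)

/-- What is recorded about one round: candidate set, learning rate, played pair `(i, j)`, and
whether `i` won the duel. -/
structure RoundLog (K : ℕ) where
  cand : Finset (Fin K)
  rate : ℝ
  fst : Fin K
  snd : Fin K
  win : Bool

/-- Importance weighted estimate of the weighted Borda score of `a` (in terms of preference gaps):
`∑_b 1{i_t = a, j_t = b} (O_t - 1/2) w^b / (q_t(a) q_t(b))`. -/
def bordaEstimate [NeZero K] (r : RoundLog K) (a : Fin K) (w : Fin K → ℝ) : ℝ :=
  ∑ b, if r.fst = a ∧ r.snd = b then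
    ((if r.win then (1 : ℝ) else 0) - 1 / 2) * w b /
      ((playDist r.cand r.rate a).toReal * (playDist r.cand r.rate b).toReal)
  else 0

/-- Eviction threshold `F([s₁, s₂])`, for unknown weights. -/
def evictionThreshold (log : ℕ → RoundLog K) (s₁ s₂ : ℕ) : ℝ :=
  max ((K : ℝ) ^ (2 / 3 : ℝ) * ((s₂ : ℝ) - (s₁ : ℝ)) ^ (2 / 3 : ℝ))
    (√((K : ℝ) ^ 2 * ∑ s ∈ Icc s₁ s₂, ((log s).rate)⁻¹)
      + (K : ℝ) ^ 2 * ⨆ s : Set.Icc s₁ s₂, ((log s).rate)⁻¹)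

/-- Arm `a` is to be evicted on the basis of the rounds in `[lo, t)`: over some interval
`[s₁, s₂]` of these rounds on which `a` was always a candidate, its estimated score with respect
to some point-mass weight falls behind that of another permanent candidate `a'` by more than
`C log T · F([s₁, s₂])`. -/
def Evicted [NeZero K] (T : ℕ) (C : ℝ) (log : ℕ → RoundLog K) (lo t : ℕ) (a : Fin K) : Prop :=
  ∃ s₁ s₂ : ℕ, lo ≤ s₁ ∧ s₁ ≤ s₂ ∧ s₂ < t ∧ ∃ a' c : Fin K,
    (∀ s ∈ Icc s₁ s₂, a ∈ (log s).cand ∧ a' ∈ (log s).cand) ∧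
    C * Real.log T * evictionThreshold log s₁ s₂ <
      ∑ s ∈ Icc s₁ s₂, (bordaEstimate (log s) a' (Pi.single c 1)
        - bordaEstimate (log s) a (Pi.single c 1))

/-- An instance of the base algorithm: its first round, its scheduled duration (it may run in the
rounds `[first, first + dur]`), and its current candidate set. -/
structure BaseRun (K : ℕ) where
  first : ℕ
  dur : ℕ
  cand : Finset (Fin K)

/-- State of the meta algorithm: first round of the current episode, the global candidate set,
the running base instance, the suspended ones (innermost first), and the log of past rounds. -/
structure MetaState (K : ℕ) where
  episode : ℕ
  glob : Finset (Fin K)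
  cur : BaseRun K
  suspended : List (BaseRun K)
  log : ℕ → RoundLog K

/-- A new episode starts at round `t`. -/
def newEpisode (T t : ℕ) (log : ℕ → RoundLog K) : MetaState K where
  episode := t
  glob := univ
  cur := ⟨t, T + 1 - t, univ⟩
  suspended := []
  log := log

/-- Replay to be started `n` rounds after the first round of the episode. There are independent
`B_m ∼ Ber(m^{-1/3} n^{-2/3})`, `m = 2, 4, …, 2^k`; the result is the largest `m` with `B_m = 1`,
if any. -/
def drawReplay (n : ℕ) : ℕ → PMF (Option ℕ)
  | 0 => PMF.pure none
  | k + 1 => (coin (((2 : ℝ) ^ (k + 1)) ^ (-(1 / 3) : ℝ) * (n : ℝ) ^ (-(2 / 3) : ℝ))).bind fun B =>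
      (drawReplay n k).map fun r => if B then some (2 ^ (k + 1)) else r

open Classical in
/-- No replay starts at round `t`: base instances whose scheduled rounds are over return, the
innermost remaining one evicts arms from its candidate set (looking at the rounds since its start)
and from the global candidate set (looking at the rounds since the start of the episode); a new
episode begins if the global candidate set has become empty. -/
def resume [NeZero K] (T : ℕ) (C : ℝ) (t : ℕ) (σ : MetaState K) : MetaState K :=
  match (σ.cur :: σ.suspended).dropWhile (fun b => decide (b.first + b.dur < t)) with
  | [] => newEpisode T t σ.log
  | b :: rest =>
    let glob' := σ.glob.filter fun a => ¬ Evicted T C σ.log σ.episode t a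
    if glob' = ∅ then newEpisode T t σ.log
    else
      { episode := σ.episode
        glob := glob'
        cur := { b with cand := b.cand.filter fun a => ¬ Evicted T C σ.log b.first t a }
        suspended := rest
        log := σ.log }

/-- The meta algorithm with the unknown weight specification, for horizon `T` and eviction
constant `C`. It knows nothing about the environment. -/
def metaAlgorithm (K T : ℕ) [NeZero K] (C : ℝ) : DuelingAlgorithm K where
  State := MetaState K
  start := newEpisode T 1 fun _ => ⟨univ, 1, 0, 0, false⟩
  plan t σ :=
    if t ≤ σ.episode then PMF.pure σ
    else (drawReplay (t - σ.episode) (Nat.clog 2 T)).map fun r =>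
      match r with
      | some m => { σ with cur := ⟨t, m, univ⟩, suspended := σ.cur :: σ.suspended }
      | none => resume T C t σ
  draw t σ :=
    let q := playDist σ.cur.cand (learningRate K (t - σ.cur.first))
    q.bind fun i => q.map fun j => (i, j)
  observe t σ ij o :=
    let r : RoundLog K := ⟨σ.cur.cand, learningRate K (t - σ.cur.first), ij.1, ij.2, o⟩
    { σ with log := Function.update σ.log t r }

end Algorithm

end DuelingBandit

end

/-!
# Dynamic regret of successive elimination with randomly scheduled replays

**Reduction to gaps.** Weights are always point masses. In each approximate winner phase the weight
at the approximate winner `α` of the phase is decisive: with `a*` the dominant arm, the regret of an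
arm `a` against the Condorcet winner is at most `P a* α - P a α` (its `gap`) plus the amount by which
`α` falls short of `a*`, and the latter is summable over the phase by the definition of the phases
(`IsTypical.meanRegret_le`, `sum_winnerGap_le`). What remains is the exploration rate and the average
gap of the current candidates (`roundCost`).

**Random events.** Three families of products of one-round weights, each weight of conditional mean at
most one, are supermartingales (`ex_prod_le_one`). They yield a Bernstein inequality for the
importance weighted estimates, an upper bound on the number of replays in a window, and the fact that
scheduled replays occur unless the sum of their probabilities is logarithmic. As the sum of all
these products has polynomial mean, all events hold together, up to a small probability, on what is
called a typical run (`isGood_of_totalWeight_le`, `expectedRegret_le_of_typical`).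

**Typical runs.** The approximate winner of a phase is not evicted within the phase
(`not_evicted_winner`), so that episodes start in distinct phases. Conversely, consider an arm and cut
the rounds into segments, each ending when the phase does or when the arm has accumulated regret
`K ^ (2/3) * length ^ (2/3)` up to a logarithmic factor. In the second case a replay that covers the
segment from somewhere in its first half evicts the arm (`evicted_of_isEarly`). An arm that has not
been evicted has therefore missed all of these replays, which bounds the sum of `length ^ (2/3)` over
its segments in terms of the replay probabilities (`sum_gap_le_of_not_evicted`).

**One episode.** Let `l` and `s` be the cube roots of the number of rounds and of phases in an
episode. Ordering the candidates of an instance by their time of eviction, the average gap of its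
candidates costs only a logarithmic factor more than the regret of a single candidate
(`sum_avg_gap_le`). The main instance and the long replays are handled by the bound just described,
as long replays are rare. Short replays are compared with an arm that survives until the end of the
episode (`sum_gap_le_survivor`); since each round is covered by few replays of a given size, the
regret of the survivor is counted only logarithmically often. Altogether an episode costs
`K ^ (2/3) * l ^ 2 * s` up to logarithms (`sum_roundCost_span_le`).

**Conclusion.** Young's inequality sums this over the episodes (`sum_roundCost_le`). The bound in
terms of the total variation follows, since in each completed phase the variation is at least the
order of `(K ^ 2 / length) ^ (1/3)` (`approxPhases_sub_one_pow_le`).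
-/

open scoped ENNReal

noncomputable section

namespace DuelingBandit

open scoped ENNReal

/-! ### Expectations under probability mass functions -/

/-- Expectation of an `ℝ≥0∞`-valued function under a probability mass function. -/
def ex {α : Type*} (p : PMF α) (f : α → ℝ≥0∞) : ℝ≥0∞ := ∑' x, p x * f x

lemma ex_mono {α : Type*} (p : PMF α) {f g : α → ℝ≥0∞} (h : ∀ x ∈ p.support, f x ≤ g x) :
    ex p f ≤ ex p g := by
  refine ENNReal.tsum_le_tsum fun x => ?_
  by_cases hx : p x = 0
  · simp [hx]
  · exact mul_le_mul_right (h x ((PMF.mem_support_iff p x).2 hx)) _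

lemma ex_congr {α : Type*} (p : PMF α) {f g : α → ℝ≥0∞} (h : ∀ x ∈ p.support, f x = g x) :
    ex p f = ex p g :=
  le_antisymm (ex_mono p fun x hx => (h x hx).le) (ex_mono p fun x hx => (h x hx).ge)

lemma ex_const {α : Type*} (p : PMF α) (c : ℝ≥0∞) : ex p (fun _ => c) = c := by
  simp [ex, ENNReal.tsum_mul_right]

lemma ex_le_const {α : Type*} (p : PMF α) {f : α → ℝ≥0∞} {c : ℝ≥0∞}
    (h : ∀ x ∈ p.support, f x ≤ c) : ex p f ≤ c :=
  (ex_mono p h).trans (ex_const p c).le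

lemma ex_add {α : Type*} (p : PMF α) (f g : α → ℝ≥0∞) :
    ex p (fun x => f x + g x) = ex p f + ex p g := by
  simp [ex, mul_add, ENNReal.tsum_add]

lemma ex_mul_left {α : Type*} (p : PMF α) (c : ℝ≥0∞) (f : α → ℝ≥0∞) :
    ex p (fun x => c * f x) = c * ex p f := by
  simp only [ex, ← ENNReal.tsum_mul_left]
  exact tsum_congr fun x => by ring

lemma ex_sum {α ι : Type*} (p : PMF α) (s : Finset ι) (f : ι → α → ℝ≥0∞) :
    ex p (fun x => ∑ i ∈ s, f i x) = ∑ i ∈ s, ex p (f i) := by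
  classical
  induction s using Finset.induction_on with
  | empty => simp [ex]
  | insert i s hi ih => simp only [sum_insert hi, ex_add, ih]

lemma ex_pure {α : Type*} (a : α) (f : α → ℝ≥0∞) : ex (PMF.pure a) f = f a := by
  classical
  rw [ex, tsum_eq_single a]
  · simp
  · intro b hb
    simp [PMF.pure_apply, hb]

lemma ex_bind {α β : Type*} (p : PMF α) (k : α → PMF β) (f : β → ℝ≥0∞) :
    ex (p.bind k) f = ex p (fun x => ex (k x) f) := by
  simp only [ex, PMF.bind_apply, ← ENNReal.tsum_mul_right, ← ENNReal.tsum_mul_left]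
  rw [ENNReal.tsum_comm]
  exact tsum_congr fun x => tsum_congr fun y => by ring

lemma ex_map {α β : Type*} (p : PMF α) (k : α → β) (f : β → ℝ≥0∞) :
    ex (p.map k) f = ex p (fun x => f (k x)) := by
  rw [PMF.map, ex_bind]
  simp [ex_pure]

lemma ex_fintype {α : Type*} [Fintype α] (p : PMF α) (f : α → ℝ≥0∞) :
    ex p f = ∑ x, p x * f x := by
  rw [ex, tsum_fintype]

lemma ex_coin (p : ℝ) (f : Bool → ℝ≥0∞) :
    ex (coin p) f = min (ENNReal.ofReal p) 1 * f true
      + (1 - min (ENNReal.ofReal p) 1) * f false := by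
  simp [ex_fintype, coin]

lemma ex_coin_of_mem {p : ℝ} (h0 : 0 ≤ p) (h1 : p ≤ 1) (f : Bool → ℝ≥0∞) :
    ex (coin p) f = ENNReal.ofReal p * f true + ENNReal.ofReal (1 - p) * f false := by
  have h : ENNReal.ofReal p ≤ 1 := by simpa using h1
  rw [ex_coin, min_eq_left h, ENNReal.ofReal_sub _ h0, ENNReal.ofReal_one]

/-- A finite expectation of reals is the corresponding `ℝ≥0∞`-valued expectation. -/
lemma ex_ofReal_fintype {α : Type*} [Fintype α] (p : PMF α) {f : α → ℝ} (hf : ∀ x, 0 ≤ f x) :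
    ex p (fun x => ENNReal.ofReal (f x)) = ENNReal.ofReal (∑ x, (p x).toReal * f x) := by
  rw [ex_fintype, ENNReal.ofReal_sum_of_nonneg fun x _ => mul_nonneg ENNReal.toReal_nonneg (hf x)]
  refine sum_congr rfl fun x _ => ?_
  rw [ENNReal.ofReal_mul ENNReal.toReal_nonneg, ENNReal.ofReal_toReal (p.apply_ne_top x)]

lemma sum_toReal_pmf {α : Type*} [Fintype α] (p : PMF α) : ∑ x, (p x).toReal = 1 := by
  rw [← ENNReal.toReal_sum fun x _ => p.apply_ne_top x, ← tsum_fintype (L := .unconditional _), p.tsum_coe]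
  simp

/-! ### The law of the complete history -/

section Trace

variable {K : ℕ} (alg : DuelingAlgorithm K)

/-- What happens in one round: the state after planning, the pair played, the outcome. -/
abbrev Turn (alg : DuelingAlgorithm K) := alg.State × (Fin K × Fin K) × Bool

/-- The state at the end of round `n` of a history. -/
def endState (ω : ℕ → Turn alg) : ℕ → alg.State
  | 0 => alg.start
  | n + 1 => alg.observe (n + 1) (ω (n + 1)).1 (ω (n + 1)).2.1 (ω (n + 1)).2.2

/-- Law of what happens in round `t`, given the state at the end of the round before. -/
def turnLaw (P : ℕ → Fin K → Fin K → ℝ) (t : ℕ) (s : alg.State) : PMF (Turn alg) :=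
  (alg.plan t s).bind fun σ => (alg.draw t σ).bind fun ij =>
    (coin (P t ij.1 ij.2)).map fun o => (σ, ij, o)

/-- Law of the history of the first `n` rounds; the entries with another index are those of `ω₀`. -/
def historyLaw (P : ℕ → Fin K → Fin K → ℝ) (ω₀ : ℕ → Turn alg) : ℕ → PMF (ℕ → Turn alg)
  | 0 => PMF.pure ω₀
  | n + 1 => (historyLaw P ω₀ n).bind fun ω =>
      (turnLaw alg P (n + 1) (endState alg ω n)).map fun x => Function.update ω (n + 1) x

variable {alg}

lemma endState_update (ω : ℕ → Turn alg) {n k : ℕ} (x : Turn alg) (hk : k ≤ n) :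
    endState alg (Function.update ω (n + 1) x) k = endState alg ω k := by
  cases k with
  | zero => rfl
  | succ k =>
    have : k + 1 ≠ n + 1 := by omega
    simp [endState, Function.update_of_ne this]

lemma law_eq_map_historyLaw (P : ℕ → Fin K → Fin K → ℝ) (ω₀ : ℕ → Turn alg) (n : ℕ) :
    alg.law P n = (historyLaw alg P ω₀ n).map
      (fun ω => (endState alg ω n, fun t : Fin n => (ω (t + 1)).2.1)) := by
  induction n with
  | zero =>
    simp only [DuelingAlgorithm.law, historyLaw, PMF.pure_map, endState]
    congr 2
    exact Subsingleton.elim _ _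
  | succ n ih =>
    rw [DuelingAlgorithm.law, ih, PMF.bind_map, historyLaw, PMF.map_bind]
    congr 1
    funext ω
    simp only [Function.comp, turnLaw, PMF.map_bind, PMF.map_comp]
    congr 1; funext σ; congr 1; funext ij; congr 1; funext o
    simp only [endState, Function.comp, Function.update_self, Prod.mk.injEq, true_and]
    funext t
    refine Fin.lastCases ?_ (fun i => ?_) t
    · simp
    · have h : ((i.castSucc : Fin (n + 1)) : ℕ) + 1 ≠ n + 1 := by
        have := i.2
        simp; omega
      rw [Fin.snoc_castSucc, Function.update_of_ne h]
      rfl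

/-- Histories of positive probability arise round by round from outcomes of positive probability. -/
lemma mem_support_turnLaw {P : ℕ → Fin K → Fin K → ℝ} {ω₀ ω : ℕ → Turn alg} {n : ℕ}
    (h : ω ∈ (historyLaw alg P ω₀ n).support) {k : ℕ} (hk : k < n) :
    ω (k + 1) ∈ (turnLaw alg P (k + 1) (endState alg ω k)).support := by
  induction n generalizing ω with
  | zero => omega
  | succ n ih =>
    simp only [historyLaw, PMF.mem_support_bind_iff, PMF.mem_support_map_iff] at h
    obtain ⟨ω', hω', x, hx, rfl⟩ := h
    rw [endState_update _ _ (by omega)]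
    rcases Nat.lt_succ_iff_lt_or_eq.1 hk with hk | rfl
    · rw [Function.update_of_ne (by omega)]
      exact ih hω' hk
    · simpa using hx

lemma historyLaw_zero_eq {P : ℕ → Fin K → Fin K → ℝ} {ω₀ ω : ℕ → Turn alg} {n : ℕ}
    (h : ω ∈ (historyLaw alg P ω₀ n).support) : ω 0 = ω₀ 0 := by
  induction n generalizing ω with
  | zero => simp only [historyLaw, PMF.support_pure, Set.mem_singleton_iff] at h; rw [h]
  | succ n ih =>
    simp only [historyLaw, PMF.mem_support_bind_iff, PMF.mem_support_map_iff] at h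
    obtain ⟨ω', hω', x, hx, rfl⟩ := h
    rw [Function.update_of_ne (by omega)]
    exact ih hω'

/-- A product of round-wise weights of conditional mean at most `1` is a supermartingale. -/
lemma ex_prod_le_one (P : ℕ → Fin K → Fin K → ℝ) (ω₀ : ℕ → Turn alg)
    (W : ℕ → alg.State → Turn alg → ℝ≥0∞) (n : ℕ)
    (hW : ∀ k < n, ∀ s, ex (turnLaw alg P (k + 1) s) (W (k + 1) s) ≤ 1) :
    ex (historyLaw alg P ω₀ n)
      (fun ω => ∏ k ∈ range n, W (k + 1) (endState alg ω k) (ω (k + 1))) ≤ 1 := by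
  induction n with
  | zero => simp [ex_const]
  | succ n ih =>
    rw [historyLaw, ex_bind]
    refine le_trans (ex_mono _ fun ω _ => ?_) (ih fun k hk => hW k (by omega))
    rw [ex_map]
    have : ∀ x, ∏ k ∈ range (n + 1), W (k + 1) (endState alg (Function.update ω (n + 1) x) k)
        (Function.update ω (n + 1) x (k + 1)) =
        (∏ k ∈ range n, W (k + 1) (endState alg ω k) (ω (k + 1))) *
          W (n + 1) (endState alg ω n) x := by
      intro x
      rw [prod_range_succ, endState_update _ _ le_rfl, Function.update_self]
      congr 1
      refine prod_congr rfl fun k hk => ?_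
      have hk' := mem_range.1 hk
      rw [endState_update _ _ hk'.le, Function.update_of_ne (by omega)]
    simp only [this, ex_mul_left]
    exact mul_le_of_le_one_right' (hW n (by omega) _)

/-- Round-wise costs may be replaced by their conditional means. -/
lemma ex_sum_eq (P : ℕ → Fin K → Fin K → ℝ) (ω₀ : ℕ → Turn alg)
    (f g : ℕ → Turn alg → ℝ≥0∞) (n : ℕ)
    (hfg : ∀ k < n, ∀ s, ex (turnLaw alg P (k + 1) s) (f (k + 1)) =
      ex (turnLaw alg P (k + 1) s) (g (k + 1))) :
    ex (historyLaw alg P ω₀ n) (fun ω => ∑ k ∈ range n, f (k + 1) (ω (k + 1))) =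
      ex (historyLaw alg P ω₀ n) (fun ω => ∑ k ∈ range n, g (k + 1) (ω (k + 1))) := by
  induction n with
  | zero => simp
  | succ n ih =>
    have key : ∀ h : ℕ → Turn alg → ℝ≥0∞, ex (historyLaw alg P ω₀ (n + 1))
        (fun ω => ∑ k ∈ range (n + 1), h (k + 1) (ω (k + 1))) =
        ex (historyLaw alg P ω₀ n) (fun ω => ∑ k ∈ range n, h (k + 1) (ω (k + 1))) +
        ex (historyLaw alg P ω₀ n)
          (fun ω => ex (turnLaw alg P (n + 1) (endState alg ω n)) (h (n + 1))) := by
      intro h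
      rw [historyLaw, ex_bind, ← ex_add]
      refine ex_congr _ fun ω _ => ?_
      rw [ex_map]
      have : ∀ x, ∑ k ∈ range (n + 1), h (k + 1) (Function.update ω (n + 1) x (k + 1)) =
          (∑ k ∈ range n, h (k + 1) (ω (k + 1))) + h (n + 1) x := by
        intro x
        rw [sum_range_succ, Function.update_self]
        congr 1
        refine sum_congr rfl fun k hk => ?_
        have hk' := mem_range.1 hk
        rw [Function.update_of_ne (by omega)]
      simp only [this, ex_add, ex_const]
    rw [key f, key g, ih fun k hk => hfg k (by omega)]
    congr 2
    funext ω
    exact hfg n (by omega) _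

end Trace

open scoped ENNReal

/-! ### Conditional laws of a single round -/

section Round

variable {K : ℕ} [NeZero K]

lemma learningRate_pos (n : ℕ) : 0 < learningRate K n := by
  have hK : (0 : ℝ) < K := by exact_mod_cast Nat.pos_of_ne_zero (NeZero.ne K)
  unfold learningRate
  split_ifs with h
  · exact one_pos
  · have : (0 : ℝ) < n := by exact_mod_cast Nat.pos_of_ne_zero h
    positivity

omit [NeZero K] in
lemma learningRate_le_one (n : ℕ) : learningRate K n ≤ 1 := by
  unfold learningRate
  split_ifs
  · exact le_rfl
  · exact min_le_right _ _

lemma playDist_toReal {A : Finset (Fin K)} {η : ℝ} (hA : A.Nonempty) (h0 : 0 ≤ η) (h1 : η ≤ 1)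
    (a : Fin K) :
    (playDist A η a).toReal = η / K + (1 - η) * if a ∈ A then (1 : ℝ) / #A else 0 := by
  classical
  have key : playDist A η a = ENNReal.ofReal η * (K : ℝ≥0∞)⁻¹ +
      ENNReal.ofReal (1 - η) * if a ∈ A then (#A : ℝ≥0∞)⁻¹ else 0 := by
    have h : ENNReal.ofReal η ≤ 1 := by simpa using h1
    have h' : (1 : ℝ≥0∞) - ENNReal.ofReal η = ENNReal.ofReal (1 - η) := by
      rw [ENNReal.ofReal_sub _ h0, ENNReal.ofReal_one]
    rw [playDist, PMF.bind_apply, tsum_fintype, Fintype.sum_bool]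
    simp only [coin, PMF.ofFintype_apply, Bool.false_eq_true, false_and, if_true, if_false,
      dite_false, true_and, hA, dite_true, PMF.uniformOfFintype_apply, Fintype.card_fin,
      PMF.uniformOfFinset_apply, min_eq_left h, reduceCtorEq]
    rw [h']
    congr
  have hK : (K : ℝ≥0∞) ≠ 0 := by exact_mod_cast NeZero.ne K
  have hA' : (#A : ℝ≥0∞) ≠ 0 := by exact_mod_cast hA.card_ne_zero
  rw [key, ENNReal.toReal_add, ENNReal.toReal_mul, ENNReal.toReal_mul, ENNReal.toReal_ofReal h0,
    ENNReal.toReal_ofReal (by linarith)]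
  · split_ifs <;> simp [div_eq_mul_inv]
  · exact ENNReal.mul_ne_top ENNReal.ofReal_ne_top (by simpa using hK)
  · refine ENNReal.mul_ne_top ENNReal.ofReal_ne_top ?_
    split_ifs
    · simpa using hA.ne_empty
    · simp

/-- A candidate is played with probability at least `1 / K`. -/
lemma one_div_le_playDist {A : Finset (Fin K)} {η : ℝ} (h0 : 0 ≤ η) (h1 : η ≤ 1) {a : Fin K}
    (ha : a ∈ A) : (1 : ℝ) / K ≤ (playDist A η a).toReal := by
  have hc : (0 : ℝ) < #A := by exact_mod_cast card_pos.2 ⟨a, ha⟩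
  have hcK : (#A : ℝ) ≤ K := by exact_mod_cast (card_le_univ A).trans_eq (by simp)
  have hdiv : (1 : ℝ) / K ≤ 1 / #A := one_div_le_one_div_of_le hc hcK
  rw [playDist_toReal ⟨a, ha⟩ h0 h1, if_pos ha]
  calc (1 : ℝ) / K = η / K + (1 - η) * (1 / K) := by ring
    _ ≤ _ := by gcongr

lemma rate_div_le_playDist {A : Finset (Fin K)} {η : ℝ} (hA : A.Nonempty) (h0 : 0 ≤ η)
    (h1 : η ≤ 1) (a : Fin K) : η / K ≤ (playDist A η a).toReal := by
  rw [playDist_toReal hA h0 h1]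
  have : 0 ≤ (1 - η) * if a ∈ A then (1 : ℝ) / #A else 0 := by
    refine mul_nonneg (by linarith) ?_
    split_ifs <;> positivity
  linarith

lemma bordaEstimate_single (r : RoundLog K) (a c : Fin K) :
    bordaEstimate r a (Pi.single c 1) = if r.fst = a ∧ r.snd = c then
      ((if r.win then (1 : ℝ) else 0) - 1 / 2) /
        ((playDist r.cand r.rate a).toReal * (playDist r.cand r.rate c).toReal) else 0 := by
  unfold bordaEstimate
  rw [sum_eq_single c]
  · simp
  · intro b _ hb
    simp [hb]
  · simp

lemma exp_le_quadratic {y : ℝ} (hy : |y| ≤ 1) : Real.exp y ≤ 1 + y + y ^ 2 := by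
  have := (abs_le.1 (Real.abs_exp_sub_one_sub_id_le hy)).2
  linarith

/-- Bernstein's bound for the moment generating function of the estimated score difference of two
candidates in one round. -/
lemma ex_exp_estimate_le {A : Finset (Fin K)} {η : ℝ} (h0 : 0 < η) (h1 : η ≤ 1)
    {M : Fin K → Fin K → ℝ} (hM : IsPreferenceMatrix M) {a a' : Fin K} (c : Fin K)
    (ha : a ∈ A) (ha' : a' ∈ A) {n : ℝ} (hn : (K : ℝ) ^ 2 / η ≤ n) :
    ex ((playDist A η).bind fun i => (playDist A η).map fun j => (i, j)) (fun ij =>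
      ex (coin (M ij.1 ij.2)) fun o => ENNReal.ofReal (Real.exp (
        (bordaEstimate ⟨A, η, ij.1, ij.2, o⟩ a' (Pi.single c 1)
          - bordaEstimate ⟨A, η, ij.1, ij.2, o⟩ a (Pi.single c 1) - (M a' c - M a c)) / n
          - (K : ℝ) ^ 2 / (2 * η * n ^ 2)))) ≤ 1 := by
  classical
  have hK : (0 : ℝ) < K := by exact_mod_cast Nat.pos_of_ne_zero (NeZero.ne K)
  have hn0 : 0 < n := lt_of_lt_of_le (by positivity) hn
  rcases eq_or_ne a a' with rfl | hne
  · refine ex_le_const _ fun ij _ => ex_le_const _ fun o _ => ?_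
    rw [← ENNReal.ofReal_one]
    apply ENNReal.ofReal_le_ofReal
    rw [Real.exp_le_one_iff]
    have : 0 ≤ (K : ℝ) ^ 2 / (2 * η * n ^ 2) := by positivity
    simpa using this
  set q : Fin K → ℝ := fun i => (playDist A η i).toReal with hq
  have hqa : 1 / (K : ℝ) ≤ q a := one_div_le_playDist h0.le h1 ha
  have hqa' : 1 / (K : ℝ) ≤ q a' := one_div_le_playDist h0.le h1 ha'
  have hqc : η / K ≤ q c := rate_div_le_playDist ⟨a, ha⟩ h0.le h1 c
  have hqa0 : 0 < q a := lt_of_lt_of_le (by positivity) hqa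
  have hqa0' : 0 < q a' := lt_of_lt_of_le (by positivity) hqa'
  have hqc0 : 0 < q c := lt_of_lt_of_le (by positivity) hqc
  have hq0 : ∀ i, 0 ≤ q i := fun i => ENNReal.toReal_nonneg
  have hq1 : ∑ i, q i = 1 := sum_toReal_pmf _
  -- the inverse sampling probabilities
  have inv_le : ∀ b, 1 / (K : ℝ) ≤ q b → 1 / (q b * q c) ≤ (K : ℝ) ^ 2 / η := by
    intro b hb
    have : η / (K : ℝ) ^ 2 ≤ q b * q c := by
      calc η / (K : ℝ) ^ 2 = 1 / K * (η / K) := by field_simp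
        _ ≤ _ := by gcongr
    calc 1 / (q b * q c) ≤ 1 / (η / (K : ℝ) ^ 2) := one_div_le_one_div_of_le (by positivity) this
      _ = _ := by field_simp
  set u : Fin K → Fin K → ℝ := fun i j =>
    (if i = a' ∧ j = c then 1 / (q a' * q c) else 0)
      - (if i = a ∧ j = c then 1 / (q a * q c) else 0) with hu
  set sg : Bool → ℝ := fun o => (if o then (1 : ℝ) else 0) - 1 / 2 with hsg
  have hX : ∀ i j o, bordaEstimate ⟨A, η, i, j, o⟩ a' (Pi.single c 1)
      - bordaEstimate ⟨A, η, i, j, o⟩ a (Pi.single c 1) = sg o * u i j := by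
    intro i j o
    simp only [bordaEstimate_single, hu, hsg, hq]
    split_ifs <;> ring
  have hub : ∀ i j, |u i j| ≤ (K : ℝ) ^ 2 / η := by
    intro i j
    have h2 : 0 ≤ (K : ℝ) ^ 2 / η := by positivity
    simp only [hu]
    by_cases h : i = a' ∧ j = c
    · have h' : ¬ (i = a ∧ j = c) := fun h' => hne (h'.1.symm.trans h.1)
      rw [if_pos h, if_neg h', sub_zero, abs_of_nonneg (by positivity)]
      exact inv_le _ hqa'
    · rw [if_neg h, zero_sub, abs_neg]
      split_ifs
      · rw [abs_of_nonneg (by positivity)]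
        exact inv_le _ hqa
      · simpa using h2
  set l : ℝ := 1 / n with hl
  have hl0 : 0 < l := by positivity
  have hlu : ∀ i j, |l * u i j| ≤ 1 := by
    intro i j
    rw [abs_mul, abs_of_pos hl0, hl, one_div, inv_mul_le_iff₀ hn0, mul_one]
    exact (hub i j).trans hn
  set μ : ℝ := M a' c - M a c with hμ
  set V : ℝ := (K : ℝ) ^ 2 / (2 * η) with hV
  set E : ℝ := Real.exp (-(l * μ) - l ^ 2 * V) with hE
  have hexp : ∀ i j o, Real.exp ((bordaEstimate ⟨A, η, i, j, o⟩ a' (Pi.single c 1)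
      - bordaEstimate ⟨A, η, i, j, o⟩ a (Pi.single c 1) - μ) / n
        - (K : ℝ) ^ 2 / (2 * η * n ^ 2)) = Real.exp (sg o * (l * u i j)) * E := by
    intro i j o
    rw [hX, hE, ← Real.exp_add]
    congr 1
    simp only [hl, hV]
    field_simp
    ring
  -- the conditional expectation given the pair
  have hcoin : ∀ i j, ex (coin (M i j)) (fun o => ENNReal.ofReal (Real.exp (
        (bordaEstimate ⟨A, η, i, j, o⟩ a' (Pi.single c 1)
          - bordaEstimate ⟨A, η, i, j, o⟩ a (Pi.single c 1) - μ) / n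
          - (K : ℝ) ^ 2 / (2 * η * n ^ 2)))) ≤
      ENNReal.ofReal ((1 + (M i j - 1 / 2) * (l * u i j) + (l * u i j) ^ 2 / 4) * E) := by
    intro i j
    obtain ⟨hM0, hM1, -⟩ := hM i j
    have hE0 : 0 < E := Real.exp_pos _
    have hs : ∀ o, |sg o * (l * u i j)| ≤ 1 := by
      intro o
      rw [abs_mul]
      have h12 : |sg o| = 1 / 2 := by
        cases o <;> norm_num [hsg, abs_of_pos, abs_of_neg]
      rw [h12]
      linarith [hlu i j]
    rw [ex_coin_of_mem hM0 hM1]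
    simp only [hexp]
    rw [← ENNReal.ofReal_mul hM0, ← ENNReal.ofReal_mul (by linarith), ← ENNReal.ofReal_add
      (by positivity) (mul_nonneg (by linarith) (by positivity))]
    apply ENNReal.ofReal_le_ofReal
    have e1 := exp_le_quadratic (hs true)
    have e2 := exp_le_quadratic (hs false)
    have s1 : sg true = 1 / 2 := by norm_num [hsg]
    have s2 : sg false = -(1 / 2) := by norm_num [hsg]
    rw [s1] at e1
    rw [s2] at e2
    rw [s1, s2]
    calc M i j * (Real.exp (1 / 2 * (l * u i j)) * E)
          + (1 - M i j) * (Real.exp (-(1 / 2) * (l * u i j)) * E)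
        = (M i j * Real.exp (1 / 2 * (l * u i j))
          + (1 - M i j) * Real.exp (-(1 / 2) * (l * u i j))) * E := by ring
      _ ≤ (M i j * (1 + 1 / 2 * (l * u i j) + (1 / 2 * (l * u i j)) ^ 2)
          + (1 - M i j) * (1 + -(1 / 2) * (l * u i j) + (-(1 / 2) * (l * u i j)) ^ 2)) * E := by
          gcongr
      _ = _ := by ring
  rw [ex_bind]
  simp only [ex_map]
  -- averaging over the pair
  have hnn : ∀ i j, 0 ≤ (1 + (M i j - 1 / 2) * (l * u i j) + (l * u i j) ^ 2 / 4) * E := by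
    intro i j
    obtain ⟨hM0, hM1, -⟩ := hM i j
    refine mul_nonneg ?_ (Real.exp_pos _).le
    have h1 := hlu i j
    have h2 : |(M i j - 1 / 2) * (l * u i j)| ≤ 1 / 2 * 1 := by
      rw [abs_mul]
      refine mul_le_mul ?_ h1 (abs_nonneg _) (by norm_num)
      rw [abs_le]; constructor <;> linarith
    have h3 := (abs_le.1 h2).1
    nlinarith [sq_nonneg (l * u i j)]
  calc ex (playDist A η) (fun i => ex (playDist A η) (fun j => ex (coin (M i j))
        (fun o => ENNReal.ofReal (Real.exp (
        (bordaEstimate ⟨A, η, i, j, o⟩ a' (Pi.single c 1)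
          - bordaEstimate ⟨A, η, i, j, o⟩ a (Pi.single c 1) - μ) / n
          - (K : ℝ) ^ 2 / (2 * η * n ^ 2))))))
      ≤ ex (playDist A η) (fun i => ex (playDist A η) (fun j =>
          ENNReal.ofReal ((1 + (M i j - 1 / 2) * (l * u i j) + (l * u i j) ^ 2 / 4) * E))) :=
        ex_mono _ fun i _ => ex_mono _ fun j _ => hcoin i j
    _ = ENNReal.ofReal (∑ i, q i * ∑ j, q j *
          ((1 + (M i j - 1 / 2) * (l * u i j) + (l * u i j) ^ 2 / 4) * E)) := by
        rw [← ex_ofReal_fintype]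
        · congr 1
          funext i
          rw [ex_ofReal_fintype _ (hnn i)]
        · exact fun i => sum_nonneg fun j _ => mul_nonneg (hq0 j) (hnn i j)
    _ ≤ 1 := by
        rw [← ENNReal.ofReal_one]
        apply ENNReal.ofReal_le_ofReal
        have hsumu : ∀ f : Fin K → Fin K → ℝ, ∑ i, q i * ∑ j, q j * (f i j * u i j) =
            f a' c - f a c := by
          intro f
          have e : ∀ b : Fin K, 0 < q b → ∑ i, q i * ∑ j, q j *
              (f i j * if i = b ∧ j = c then 1 / (q b * q c) else 0) = f b c := by
            intro b hb
            rw [sum_eq_single b, sum_eq_single c]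
            · simp only [and_self, if_true]
              field_simp
            · intro j _ hj; simp [hj]
            · simp
            · intro i _ hi; simp [hi]
            · simp
          simp only [hu, mul_sub, sum_sub_distrib]
          rw [e a' hqa0', e a hqa0]
        have hua' : u a' c = 1 / (q a' * q c) := by simp [hu, hne.symm]
        have hua : u a c = -(1 / (q a * q c)) := by simp [hu, hne]
        have hconst : ∑ i, q i * ∑ j, q j * (1 : ℝ) = 1 := by simp [hq1]
        have hsplit : ∑ i, q i * ∑ j, q j *
            ((1 + (M i j - 1 / 2) * (l * u i j) + (l * u i j) ^ 2 / 4) * E) =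
            (1 + l * μ + l ^ 2 / 4 * (1 / (q a' * q c) + 1 / (q a * q c))) * E := by
          have h1 := hsumu fun i j => l * (M i j - 1 / 2)
          have h2 := hsumu fun i j => l ^ 2 / 4 * u i j
          calc _ = (∑ i, q i * ∑ j, q j * (1 : ℝ)
                + ∑ i, q i * ∑ j, q j * (l * (M i j - 1 / 2) * u i j)
                + ∑ i, q i * ∑ j, q j * (l ^ 2 / 4 * u i j * u i j)) * E := by
                simp only [mul_sum, sum_mul, ← sum_add_distrib]
                refine sum_congr rfl fun i _ => sum_congr rfl fun j _ => ?_
                ring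
            _ = _ := by
                rw [hconst, h1, h2, hua, hua', hμ]
                ring
        rw [hsplit]
        have hVle : 1 / 4 * (1 / (q a' * q c) + 1 / (q a * q c)) ≤ V := by
          have e1 := inv_le _ hqa
          have e2 := inv_le _ hqa'
          have e3 : V = 1 / 2 * ((K : ℝ) ^ 2 / η) := by rw [hV]; field_simp
          linarith
        have hle : 1 + l * μ + l ^ 2 / 4 * (1 / (q a' * q c) + 1 / (q a * q c)) ≤
            Real.exp (l * μ + l ^ 2 * V) := by
          have := Real.add_one_le_exp (l * μ + l ^ 2 * V)
          have h2 := mul_le_mul_of_nonneg_left hVle (sq_nonneg l)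
          linarith
        calc _ ≤ Real.exp (l * μ + l ^ 2 * V) * E := by
              gcongr
          _ = 1 := by rw [hE, ← Real.exp_add]; simp

/-- The probability with which a replay of size `2 ^ k` is scheduled `n` rounds after the start of
an episode. -/
def replayProb (n k : ℕ) : ℝ := ((2 : ℝ) ^ k) ^ (-(1 / 3) : ℝ) * (n : ℝ) ^ (-(2 / 3) : ℝ)

lemma replayProb_nonneg (n k : ℕ) : 0 ≤ replayProb n k := by unfold replayProb; positivity

lemma replayProb_le_one (n k : ℕ) : replayProb n k ≤ 1 := by
  unfold replayProb
  have h1 : ((2 : ℝ) ^ k) ^ (-(1 / 3) : ℝ) ≤ 1 :=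
    Real.rpow_le_one_of_one_le_of_nonpos (one_le_pow₀ (by norm_num)) (by norm_num)
  have h2 : (n : ℝ) ^ (-(2 / 3) : ℝ) ≤ 1 := by
    rcases Nat.eq_zero_or_pos n with rfl | hn
    · rw [Nat.cast_zero, Real.zero_rpow (by norm_num)]; exact zero_le_one
    · exact Real.rpow_le_one_of_one_le_of_nonpos (by exact_mod_cast hn) (by norm_num)
  exact mul_le_one₀ h1 (by positivity) h2

lemma ex_drawReplay_succ (n k : ℕ) (f : Option ℕ → ℝ≥0∞) :
    ex (drawReplay n (k + 1)) f = ENNReal.ofReal (replayProb n (k + 1)) * f (some (2 ^ (k + 1)))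
      + ENNReal.ofReal (1 - replayProb n (k + 1)) * ex (drawReplay n k) f := by
  rw [drawReplay, ex_bind, ← replayProb,
    ex_coin_of_mem (replayProb_nonneg _ _) (replayProb_le_one _ _)]
  simp [ex_map, ex_const]

lemma ex_drawReplay_of_lt (n : ℕ) {j k : ℕ} (h : k < j) (x : ℝ≥0∞) :
    ex (drawReplay n k) (fun r => if r = some (2 ^ j) then x else 1) = 1 := by
  induction k with
  | zero => simp [drawReplay, ex_pure]
  | succ k ih =>
    have : (2 : ℕ) ^ (k + 1) ≠ 2 ^ j := fun e => h.ne (Nat.pow_right_injective le_rfl e)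
    rw [ex_drawReplay_succ, ih (by omega)]
    simp only [Option.some.injEq, this, if_false, mul_one]
    rw [← ENNReal.ofReal_add (replayProb_nonneg _ _) (by linarith [replayProb_le_one n (k + 1)])]
    simp

lemma ex_drawReplay_eq_le (n j k : ℕ) {x : ℝ} (hx : 1 ≤ x) :
    ex (drawReplay n k) (fun r => if r = some (2 ^ j) then ENNReal.ofReal x else 1) ≤
      ENNReal.ofReal (1 + (x - 1) * replayProb n j) := by
  have hj0 := replayProb_nonneg n j
  have h1 : (1 : ℝ) ≤ 1 + (x - 1) * replayProb n j := by nlinarith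
  induction k with
  | zero => simpa [drawReplay, ex_pure] using h1
  | succ k ih =>
    have p0 := replayProb_nonneg n (k + 1)
    have p1 := replayProb_le_one n (k + 1)
    rw [ex_drawReplay_succ]
    rcases eq_or_ne (k + 1) j with rfl | hne
    · rw [ex_drawReplay_of_lt n (Nat.lt_succ_self k), if_pos rfl, mul_one,
        ← ENNReal.ofReal_mul p0, ← ENNReal.ofReal_add (by positivity) (by linarith)]
      apply ENNReal.ofReal_le_ofReal
      linarith
    · have : (2 : ℕ) ^ (k + 1) ≠ 2 ^ j := fun e => hne (Nat.pow_right_injective le_rfl e)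
      simp only [Option.some.injEq, this, if_false, mul_one]
      calc _ ≤ ENNReal.ofReal (replayProb n (k + 1)) + ENNReal.ofReal (1 - replayProb n (k + 1)) *
            ENNReal.ofReal (1 + (x - 1) * replayProb n j) := by
            gcongr
        _ = ENNReal.ofReal (replayProb n (k + 1) + (1 - replayProb n (k + 1)) *
            (1 + (x - 1) * replayProb n j)) := by
            rw [← ENNReal.ofReal_mul (by linarith), ← ENNReal.ofReal_add p0
              (mul_nonneg (by linarith) (by linarith))]
        _ ≤ _ := by
            apply ENNReal.ofReal_le_ofReal
            nlinarith

lemma ex_drawReplay_ge_le (n : ℕ) {j k : ℕ} (hj : 1 ≤ j) (hjk : j ≤ k) (x : ℝ≥0∞) :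
    ex (drawReplay n k) (fun r => if ∃ m, r = some m ∧ 2 ^ j ≤ m then 0 else x) ≤
      ENNReal.ofReal (1 - replayProb n j) * x := by
  induction k with
  | zero => omega
  | succ k ih =>
    have p0 := replayProb_nonneg n (k + 1)
    rw [ex_drawReplay_succ, if_pos ⟨_, rfl, Nat.pow_le_pow_right (by norm_num) hjk⟩, mul_zero,
      zero_add]
    rcases Nat.lt_or_eq_of_le hjk with hlt | rfl
    · refine le_trans (mul_le_of_le_one_left' ?_) (ih (by omega))
      rw [ENNReal.ofReal_le_one]
      linarith
    · gcongr
      refine ex_le_const _ fun r _ => ?_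
      split_ifs
      · exact zero_le
      · exact le_rfl

/-- The state after a replay of size `m` has been started at round `t`. -/
def startReplay (t m : ℕ) (s : MetaState K) : MetaState K :=
  { s with cur := ⟨t, m, univ⟩, suspended := s.cur :: s.suspended }

omit [NeZero K] in
lemma startReplay_injective {t m m' : ℕ} {s : MetaState K}
    (h : startReplay t m s = startReplay t m' s) : m = m' := by
  have := congrArg (fun σ => σ.cur.dur) h
  simpa [startReplay] using this

lemma length_suspended_resume_le (T : ℕ) (C : ℝ) (t : ℕ) (s : MetaState K) :
    (resume T C t s).suspended.length ≤ s.suspended.length := by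
  unfold resume
  split
  · simp [newEpisode]
  · rename_i b rest h
    have h1 := (List.dropWhile_sublist (fun b : BaseRun K => decide (b.first + b.dur < t))
      (l := s.cur :: s.suspended)).length_le
    rw [h] at h1
    simp only [List.length_cons] at h1
    dsimp only
    split_ifs
    · simp [newEpisode]
    · simpa using h1

/-- Resuming never looks like starting a replay, as it does not lengthen the list of suspended
instances. -/
lemma resume_ne_startReplay (T : ℕ) (C : ℝ) (t m : ℕ) (s : MetaState K) :
    resume T C t s ≠ startReplay t m s := by
  intro h
  have h1 := length_suspended_resume_le T C t s
  rw [h] at h1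
  simp [startReplay] at h1

/-- The state after planning in a round in which `r` is drawn. -/
def planned (T : ℕ) (C : ℝ) (t : ℕ) (s : MetaState K) : Option ℕ → MetaState K
  | some m => startReplay t m s
  | none => resume T C t s

/-- Law of the state of the meta algorithm after planning. -/
def planLaw (T : ℕ) (C : ℝ) (t : ℕ) (s : MetaState K) : PMF (MetaState K) :=
  if t ≤ s.episode then PMF.pure s else
    (drawReplay (t - s.episode) (Nat.clog 2 T)).map (planned T C t s)

/-- Law of the pair played by the meta algorithm. -/
def drawLaw (t : ℕ) (σ : MetaState K) : PMF (Fin K × Fin K) :=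
  (playDist σ.cur.cand (learningRate K (t - σ.cur.first))).bind fun i =>
    (playDist σ.cur.cand (learningRate K (t - σ.cur.first))).map fun j => (i, j)

/-- What happens in one round of the meta algorithm. -/
abbrev MetaTurn (K : ℕ) := MetaState K × (Fin K × Fin K) × Bool

/-- Law of what happens in round `t` of the meta algorithm. -/
def metaTurnLaw (T : ℕ) (C : ℝ) (P : ℕ → Fin K → Fin K → ℝ) (t : ℕ) (s : MetaState K) :
    PMF (MetaTurn K) :=
  (planLaw T C t s).bind fun σ => (drawLaw t σ).bind fun ij =>
    (coin (P t ij.1 ij.2)).map fun o => (σ, ij, o)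

lemma turnLaw_metaAlgorithm (T : ℕ) (C : ℝ) (P : ℕ → Fin K → Fin K → ℝ) (t : ℕ)
    (s : MetaState K) : turnLaw (metaAlgorithm K T C) P t s = metaTurnLaw T C P t s := by
  have h : (metaAlgorithm K T C).plan t s = planLaw T C t s := by
    simp only [metaAlgorithm, planLaw]
    congr 2
  unfold turnLaw
  simp only [h]
  rfl

lemma ex_metaTurnLaw_fst (T : ℕ) (C : ℝ) (P : ℕ → Fin K → Fin K → ℝ) (t : ℕ)
    (s : MetaState K) (f : MetaState K → ℝ≥0∞) :
    ex (metaTurnLaw T C P t s) (fun x => f x.1) = ex (planLaw T C t s) f := by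
  simp [metaTurnLaw, ex_bind, ex_map, ex_const]

lemma planned_eq_startReplay {T : ℕ} {C : ℝ} {t m : ℕ} {s : MetaState K} {r : Option ℕ} :
    planned T C t s r = startReplay t m s ↔ r = some m := by
  cases r with
  | none => simp [planned, resume_ne_startReplay]
  | some m' =>
    simp only [planned, Option.some.injEq]
    exact ⟨startReplay_injective, fun h => h ▸ rfl⟩

/-- The exponential weight that counts replays of size `2 ^ j` has conditional mean at most one. -/
lemma ex_count_le_one (T : ℕ) (C : ℝ) (P : ℕ → Fin K → Fin K → ℝ) (t t₀ j : ℕ)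
    (s : MetaState K) :
    ex (metaTurnLaw T C P t s) (fun x => open Classical in ENNReal.ofReal (Real.exp
      ((if x.1 = startReplay t (2 ^ j) s ∧ s.episode = t₀ ∧ t₀ < t then 1 else 0)
        - 2 * replayProb (t - t₀) j))) ≤ 1 := by
  classical
  have p0 := replayProb_nonneg (t - t₀) j
  by_cases h : s.episode = t₀ ∧ t₀ < t
  · rw [ex_metaTurnLaw_fst T C P t s fun σ => ENNReal.ofReal (Real.exp
      ((if σ = startReplay t (2 ^ j) s ∧ s.episode = t₀ ∧ t₀ < t then 1 else 0)
        - 2 * replayProb (t - t₀) j)), planLaw, if_neg (by omega), ex_map, h.1]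
    simp only [planned_eq_startReplay, h.2, and_true]
    have e : ∀ r : Option ℕ, ENNReal.ofReal (Real.exp ((if r = some (2 ^ j) then 1 else 0)
        - 2 * replayProb (t - t₀) j)) = ENNReal.ofReal (Real.exp (- (2 * replayProb (t - t₀) j))) *
        (if r = some (2 ^ j) then ENNReal.ofReal (Real.exp 1) else 1) := by
      intro r
      split_ifs
      · rw [← ENNReal.ofReal_mul (Real.exp_pos _).le, ← Real.exp_add]; congr 2; ring
      · simp
    simp only [e, ex_mul_left]
    calc _ ≤ ENNReal.ofReal (Real.exp (- (2 * replayProb (t - t₀) j))) *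
          ENNReal.ofReal (1 + (Real.exp 1 - 1) * replayProb (t - t₀) j) := by
          gcongr
          exact ex_drawReplay_eq_le _ _ _ (Real.one_le_exp zero_le_one)
      _ ≤ ENNReal.ofReal (Real.exp (- (2 * replayProb (t - t₀) j)) *
          Real.exp (2 * replayProb (t - t₀) j)) := by
          rw [← ENNReal.ofReal_mul (Real.exp_pos _).le]
          apply ENNReal.ofReal_le_ofReal
          gcongr
          have := Real.exp_one_lt_d9
          have := Real.add_one_le_exp (2 * replayProb (t - t₀) j)
          nlinarith
      _ = 1 := by rw [← Real.exp_add]; simp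
  · refine ex_le_const _ fun x _ => ?_
    rw [if_neg fun h' => h h'.2, ENNReal.ofReal_le_one, Real.exp_le_one_iff]
    linarith

/-- The weight that grows as long as no replay of size `2 ^ j` or more starts, and vanishes once one
does, has conditional mean at most one. -/
lemma ex_detect_le_one (T : ℕ) (C : ℝ) (P : ℕ → Fin K → Fin K → ℝ) {t t₀ j : ℕ}
    (hj : 1 ≤ j) (hjT : j ≤ Nat.clog 2 T) (s : MetaState K) :
    ex (metaTurnLaw T C P t s) (fun x => open Classical in
      if s.episode = t₀ ∧ t₀ < t then
        if ∃ m, x.1 = startReplay t m s ∧ 2 ^ j ≤ m then 0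
        else ENNReal.ofReal (Real.exp (replayProb (t - t₀) j))
      else 1) ≤ 1 := by
  classical
  have p1 := replayProb_le_one (t - t₀) j
  by_cases h : s.episode = t₀ ∧ t₀ < t
  · simp only [h, and_self, if_true]
    rw [ex_metaTurnLaw_fst T C P t s fun σ => if ∃ m, σ = startReplay t m s ∧ 2 ^ j ≤ m then 0
        else ENNReal.ofReal (Real.exp (replayProb (t - t₀) j)), planLaw,
        if_neg (by omega), ex_map, h.1]
    simp only [planned_eq_startReplay]
    refine (ex_drawReplay_ge_le _ hj hjT _).trans ?_
    rw [← ENNReal.ofReal_mul (by linarith), ENNReal.ofReal_le_one]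
    have := Real.one_sub_le_exp_neg (replayProb (t - t₀) j)
    calc _ ≤ Real.exp (-replayProb (t - t₀) j) * Real.exp (replayProb (t - t₀) j) := by gcongr
      _ = 1 := by rw [← Real.exp_add]; simp
  · simp [h, ex_const]

end Round

/-! ### The stack of base instances -/

section Run

variable {K : ℕ} [NeZero K]

lemma Evicted.mono {T : ℕ} {C : ℝ} {log log' : ℕ → RoundLog K} {lo lo' t t' : ℕ} {a : Fin K}
    (h : Evicted T C log lo t a) (hlo : lo' ≤ lo) (ht : t ≤ t')
    (hlog : ∀ r < t, log r = log' r) : Evicted T C log' lo' t' a := by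
  obtain ⟨s₁, s₂, h1, h2, h3, a', c, hmem, hlt⟩ := h
  have hl : ∀ r ∈ Icc s₁ s₂, log r = log' r := fun r hr => hlog r ((mem_Icc.1 hr).2.trans_lt h3)
  refine ⟨s₁, s₂, hlo.trans h1, h2, h3.trans_le ht, a', c, fun s hs => hl s hs ▸ hmem s hs, ?_⟩
  have e1 : evictionThreshold log' s₁ s₂ = evictionThreshold log s₁ s₂ := by
    unfold evictionThreshold
    congr 2
    · congr 2
      exact sum_congr rfl fun s hs => by rw [hl s hs]
    · congr 1
      exact iSup_congr fun s => by rw [hl s (mem_Icc.2 s.2)]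
  rw [e1]
  refine hlt.trans_eq (sum_congr rfl fun s hs => by rw [hl s hs])

lemma Evicted.mono' {T : ℕ} {C : ℝ} {log : ℕ → RoundLog K} {lo lo' t t' : ℕ} {a : Fin K}
    (h : Evicted T C log lo t a) (hlo : lo' ≤ lo) (ht : t ≤ t') : Evicted T C log lo' t' a :=
  h.mono hlo ht fun _ _ => rfl

lemma not_evicted_self {T : ℕ} {C : ℝ} {log : ℕ → RoundLog K} {t : ℕ} {a : Fin K} :
    ¬ Evicted T C log t t a := by
  rintro ⟨s₁, s₂, h1, h2, h3, -⟩
  omega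

/-- The running and the suspended base instances, innermost first. -/
def bases (s : MetaState K) : List (BaseRun K) := s.cur :: s.suspended

/-- A run of the meta algorithm: `σ t` is the state after planning in round `t`, `S t` the state at
the end of that round, and `L t` the log entry of that round. -/
structure IsRun (T : ℕ) (C : ℝ) (σ S : ℕ → MetaState K) (L : ℕ → RoundLog K) : Prop where
  cand : ∀ t, 1 ≤ t → (L t).cand = (σ t).cur.cand
  rate : ∀ t, 1 ≤ t → (L t).rate = learningRate K (t - (σ t).cur.first)
  init : (σ 1).episode = 1 ∧ (σ 1).glob = univ ∧ (σ 1).cur = ⟨1, T + 1 - 1, univ⟩ ∧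
    (σ 1).suspended = []
  endState : ∀ t, 1 ≤ t → (S t).episode = (σ t).episode ∧ (S t).glob = (σ t).glob ∧
    (S t).cur = (σ t).cur ∧ (S t).suspended = (σ t).suspended
  log : ∀ t ≤ T, ∀ r ≤ t, (S t).log r = L r
  step : ∀ t, 1 ≤ t → t < T →
    (∃ k, 1 ≤ k ∧ k ≤ Nat.clog 2 T ∧ σ (t + 1) = startReplay (t + 1) (2 ^ k) (S t)) ∨
      σ (t + 1) = resume T C (t + 1) (S t)

variable {T : ℕ} {C : ℝ} {σ S : ℕ → MetaState K} {L : ℕ → RoundLog K}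

omit [NeZero K] in
lemma mem_dropWhile_of_not {α : Type*} {p : α → Bool} {l : List α} {x : α} (hx : x ∈ l)
    (hp : p x = false) : x ∈ l.dropWhile p := by
  induction l with
  | nil => simp at hx
  | cons y l ih =>
    rw [List.dropWhile_cons]
    split_ifs with h
    · rcases List.mem_cons.1 hx with rfl | hx
      · simp [hp] at h
      · exact ih hx
    · exact hx

/-- What is known about the state after planning in round `t`. -/
structure Inv (T : ℕ) (C : ℝ) (σ : ℕ → MetaState K) (L : ℕ → RoundLog K) (t : ℕ) : Prop where
  one_le : 1 ≤ (σ t).episode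
  le : (σ t).episode ≤ t
  sorted : (bases (σ t)).Pairwise fun b b' => b'.first < b.first
  main : ∃ b ∈ bases (σ t), b.first = (σ t).episode ∧ b.dur = T + 1 - (σ t).episode
  bases : ∀ b ∈ bases (σ t), (σ t).episode ≤ b.first ∧ b.first ≤ t ∧
    b.dur = (σ b.first).cur.dur ∧ (σ b.first).cur.first = b.first ∧
    (∀ r, b.first ≤ r → r ≤ t → b.first ≤ (σ r).cur.first ∧ (σ r).episode = (σ t).episode) ∧
    (∀ a, a ∉ b.cand → Evicted T C L b.first t a) ∧ (σ t).glob ⊆ b.cand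
  alive : t ≤ (σ t).cur.first + (σ t).cur.dur
  nonempty : (σ t).glob.Nonempty
  live : ∀ τ, (σ t).episode ≤ τ → τ ≤ t → (σ τ).cur.first = τ → (σ τ).episode = (σ t).episode →
    t ≤ τ + (σ τ).cur.dur → ∃ b ∈ DuelingBandit.bases (σ t), b.first = τ
  glob_evicted : ∀ a, a ∉ (σ t).glob → Evicted T C L (σ t).episode t a
  glob_kept : ∃ t', (σ t).episode ≤ t' ∧ t' ≤ t ∧
    (∀ a ∈ (σ t).glob, ¬ Evicted T C L (σ t).episode t' a) ∧
    ∀ r, t' < r → r ≤ t → (σ r).cur.first = r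
  kept : ∀ a ∈ (σ t).cur.cand, ¬ Evicted T C L (σ t).cur.first t a
  glob_mono : ∀ r, (σ t).episode ≤ r → r ≤ t → (σ t).glob ⊆ (σ r).glob
  replay : (σ t).cur.first = t → (σ t).episode < t →
    ∃ k, 1 ≤ k ∧ k ≤ Nat.clog 2 T ∧ (σ t).cur.dur = 2 ^ k

lemma inv_fresh {t : ℕ} (h1 : 1 ≤ t) (hT : t ≤ T) (he : (σ t).episode = t)
    (hg : (σ t).glob = univ) (hc : (σ t).cur = ⟨t, T + 1 - t, univ⟩)
    (hs : (σ t).suspended = []) : Inv T C σ L t where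
  one_le := by rw [he]; exact h1
  le := he.le
  sorted := by simp [DuelingBandit.bases, hs]
  main := by simp [DuelingBandit.bases, hs, hc, he]
  bases := by
    simp only [DuelingBandit.bases, hs, hc, he, hg, List.mem_singleton]
    rintro b rfl
    refine ⟨le_rfl, le_rfl, ?_, ?_, ?_, ?_, ?_⟩
    · rw [hc]
    · rw [hc]
    · intro r hr hr'
      obtain rfl : r = t := le_antisymm hr' hr
      exact ⟨by rw [hc], he⟩
    · intro a ha; exact absurd (mem_univ a) ha
    · exact subset_univ _
  alive := by rw [hc]; simp
  nonempty := by rw [hg]; exact univ_nonempty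
  live := by
    intro τ h2 h3 _ _ _
    rw [he] at h2
    obtain rfl : τ = t := le_antisymm h3 h2
    exact ⟨(σ τ).cur, by simp [DuelingBandit.bases], by rw [hc]⟩
  glob_evicted := by
    intro a ha
    rw [hg] at ha
    exact absurd (mem_univ a) ha
  glob_kept := ⟨t, he.le, le_rfl, fun a _ => by rw [he]; exact not_evicted_self,
    fun r h2 h3 => by omega⟩
  kept := by
    intro a _
    rw [hc]
    exact not_evicted_self
  glob_mono := by
    intro r h2 h3
    rw [he] at h2
    obtain rfl : r = t := le_antisymm h3 h2
    exact Subset.rfl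
  replay := by intro _ h; omega

/-- How the state changes from one round to the next: a replay starts, an instance is resumed, or
a new episode begins. -/
lemma IsRun.step_cases (h : IsRun T C σ S L) {t : ℕ} (h1 : 1 ≤ t) (hT : t < T)
    (hI : Inv T C σ L t) :
    ((∃ k, 1 ≤ k ∧ k ≤ Nat.clog 2 T ∧ (σ (t + 1)).cur = ⟨t + 1, 2 ^ k, univ⟩) ∧
      (σ (t + 1)).episode = (σ t).episode ∧ (σ (t + 1)).glob = (σ t).glob ∧
      (σ (t + 1)).suspended = bases (σ t)) ∨
    (∃ b rest, (bases (σ t)).dropWhile (fun b => decide (b.first + b.dur < t + 1)) = b :: rest ∧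
      (σ (t + 1)).episode = (σ t).episode ∧
      (∀ a, a ∈ (σ (t + 1)).glob ↔
        a ∈ (σ t).glob ∧ ¬ Evicted T C L (σ t).episode (t + 1) a) ∧
      (σ (t + 1)).glob.Nonempty ∧ (σ (t + 1)).cur.first = b.first ∧
      (σ (t + 1)).cur.dur = b.dur ∧
      (∀ a, a ∈ (σ (t + 1)).cur.cand ↔ a ∈ b.cand ∧ ¬ Evicted T C L b.first (t + 1) a) ∧
      (σ (t + 1)).suspended = rest) ∨
    ((∀ a ∈ (σ t).glob, Evicted T C L (σ t).episode (t + 1) a) ∧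
      (σ (t + 1)).episode = t + 1 ∧ (σ (t + 1)).glob = univ ∧
      (σ (t + 1)).cur = ⟨t + 1, T + 1 - (t + 1), univ⟩ ∧ (σ (t + 1)).suspended = []) := by
  classical
  obtain ⟨e1, e2, e3, e4⟩ := h.endState t h1
  have hlog := h.log t hT.le
  have hev : ∀ lo a, Evicted T C (S t).log lo (t + 1) a ↔ Evicted T C L lo (t + 1) a := fun lo a =>
    ⟨fun h => h.mono le_rfl le_rfl fun r hr => hlog r (by omega),
      fun h => h.mono le_rfl le_rfl fun r hr => (hlog r (by omega)).symm⟩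
  rcases h.step t h1 hT with ⟨k, hk, hkT, hst⟩ | hst
  · left
    rw [hst]
    exact ⟨⟨k, hk, hkT, rfl⟩, e1, e2, by simp [startReplay, bases, e3, e4]⟩
  · right
    have hb : (S t).cur :: (S t).suspended = bases (σ t) := by simp [bases, e3, e4]
    unfold resume at hst
    rw [hb] at hst
    split at hst
    · rename_i hnil
      exfalso
      obtain ⟨b, hbm, hb1, hb2⟩ := hI.main
      have := mem_dropWhile_of_not (p := fun b => decide (b.first + b.dur < t + 1)) hbm
        (by have := hI.le; simp; omega)
      rw [hnil] at this
      simp at this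
    · rename_i b rest hcons
      dsimp only at hst
      split_ifs at hst with hemp
      · right
        refine ⟨fun a ha => ?_, ?_⟩
        · by_contra hne
          have : a ∈ (S t).glob.filter fun a => ¬ Evicted T C (S t).log (S t).episode (t + 1) a := by
            rw [mem_filter, hev, e1, e2]
            exact ⟨ha, hne⟩
          rw [hemp] at this
          simp at this
        · rw [hst]
          simp [newEpisode]
      · left
        refine ⟨b, rest, hcons, ?_⟩
        rw [hst]
        refine ⟨e1, fun a => ?_, nonempty_iff_ne_empty.2 hemp, rfl, rfl, fun a => ?_, rfl⟩
        · rw [mem_filter, hev, e1, e2]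
        · rw [mem_filter, hev]

lemma IsRun.inv (h : IsRun T C σ S L) {t : ℕ} (h1 : 1 ≤ t) (hT : t ≤ T) : Inv T C σ L t := by
  induction t, h1 using Nat.le_induction with
  | base =>
    obtain ⟨e1, e2, e3, e4⟩ := h.init
    exact inv_fresh le_rfl hT e1 e2 e3 e4
  | succ t h1 ih =>
    have hI := ih (by omega)
    have hle := hI.le
    rcases h.step_cases h1 hT hI with ⟨⟨k, hk, hkT, hc⟩, he, hg, hs⟩ |
      ⟨b, rest, hdrop, he, hg, hgne, hcf, hcd, hcc, hs⟩ | ⟨-, he, hg, hc, hs⟩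
    · have hb : bases (σ (t + 1)) = ⟨t + 1, 2 ^ k, univ⟩ :: bases (σ t) := by
        rw [bases, hc, hs]
      refine ⟨?_, ?_, ?_, ?_, ?_, ?_, ?_, ?_, ?_, ?_, ?_, ?_, ?_⟩
      · rw [he]; exact hI.one_le
      · omega
      · rw [hb, List.pairwise_cons]
        exact ⟨fun b hb => by have := (hI.bases b hb).2.1; dsimp only; omega, hI.sorted⟩
      · obtain ⟨b, hbm, hb'⟩ := hI.main
        exact ⟨b, by rw [hb]; exact List.mem_cons_of_mem _ hbm, by rw [he]; exact hb'⟩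
      · intro b hbm
        rw [hb] at hbm
        rw [he, hg]
        rcases List.mem_cons.1 hbm with rfl | hbm
        · refine ⟨by dsimp only; omega, le_rfl, by rw [hc], by rw [hc], ?_, ?_, subset_univ _⟩
          · intro r hr hr'
            obtain rfl : r = t + 1 := le_antisymm hr' hr
            exact ⟨by rw [hc], he⟩
          · intro a ha; exact absurd (mem_univ a) ha
        · obtain ⟨c1, c2, c3, c4, c5, c6, c7⟩ := hI.bases b hbm
          refine ⟨c1, by omega, c3, c4, ?_, fun a ha => (c6 a ha).mono' le_rfl (by omega), c7⟩
          intro r hr hr'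
          rcases Nat.lt_or_eq_of_le hr' with hr' | rfl
          · exact c5 r hr (by omega)
          · exact ⟨by rw [hc]; dsimp only; omega, he⟩
      · rw [hc]; simp
      · rw [hg]; exact hI.nonempty
      · intro τ h2 h3 h4 h5 h6
        rcases Nat.lt_or_eq_of_le h3 with h3 | rfl
        · rw [he] at h2 h5
          obtain ⟨b, hbm, hb'⟩ := hI.live τ h2 (by omega) h4 h5 (by omega)
          exact ⟨b, by rw [hb]; exact List.mem_cons_of_mem _ hbm, hb'⟩
        · exact ⟨_, by rw [hb]; exact List.mem_cons_self, rfl⟩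
      · intro a ha
        rw [hg] at ha
        rw [he]
        exact (hI.glob_evicted a ha).mono' le_rfl (by omega)
      · obtain ⟨t', k1, k2, k3, k4⟩ := hI.glob_kept
        rw [he, hg]
        refine ⟨t', k1, by omega, k3, fun r hr hr' => ?_⟩
        rcases Nat.lt_or_eq_of_le hr' with hr' | rfl
        · exact k4 r hr (by omega)
        · rw [hc]
      · intro a _
        rw [hc]
        exact not_evicted_self
      · intro r hr hr'
        rw [hg]
        rw [he] at hr
        rcases Nat.lt_or_eq_of_le hr' with hr' | rfl
        · exact hI.glob_mono r hr (by omega)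
        · rw [hg]
      · intro _ _
        exact ⟨k, hk, hkT, by rw [hc]⟩
    · have hsub : ∀ x ∈ b :: rest, x ∈ bases (σ t) := fun x hx => by
        rw [← hdrop] at hx
        exact (List.dropWhile_sublist _).subset hx
      have hbt := hI.bases b (hsub b (by simp))
      have hsorted : (b :: rest).Pairwise fun b b' => b'.first < b.first := by
        rw [← hdrop]
        exact hI.sorted.sublist (List.dropWhile_sublist _)
      have hnot : t + 1 ≤ b.first + b.dur := by
        have := List.head_dropWhile_not (fun b : BaseRun K => decide (b.first + b.dur < t + 1))
          (l := bases (σ t)) (by rw [hdrop]; simp)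
        simp only [hdrop, List.head_cons, decide_eq_false_iff_not] at this
        omega
      have hkeep : ∀ x ∈ bases (σ t), t + 1 ≤ x.first + x.dur → x ∈ b :: rest := by
        intro x hx hx'
        rw [← hdrop]
        exact mem_dropWhile_of_not hx (by simp; omega)
      have hfirst : ∀ x ∈ b :: rest, x.first ≤ b.first := by
        intro x hx
        rcases List.mem_cons.1 hx with rfl | hx
        · exact le_rfl
        · exact ((List.pairwise_cons.1 hsorted).1 x hx).le
      have hb : bases (σ (t + 1)) = (σ (t + 1)).cur :: rest := by rw [bases, hs]
      have hlift : ∀ x ∈ b :: rest, ∃ y ∈ bases (σ (t + 1)), y.first = x.first ∧ y.dur = x.dur := by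
        intro x hx
        rcases List.mem_cons.1 hx with rfl | hx
        · exact ⟨_, by rw [hb]; exact List.mem_cons_self, hcf, hcd⟩
        · exact ⟨x, by rw [hb]; exact List.mem_cons_of_mem _ hx, rfl, rfl⟩
      have hgsub : (σ (t + 1)).glob ⊆ (σ t).glob := fun a ha => ((hg a).1 ha).1
      refine ⟨?_, ?_, ?_, ?_, ?_, ?_, hgne, ?_, ?_, ?_, ?_, ?_, ?_⟩
      · rw [he]; exact hI.one_le
      · omega
      · rw [hb, List.pairwise_cons]
        exact ⟨fun x hx => by rw [hcf]; exact (List.pairwise_cons.1 hsorted).1 x hx,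
          (List.pairwise_cons.1 hsorted).2⟩
      · obtain ⟨x, hxm, hx1, hx2⟩ := hI.main
        obtain ⟨y, hy, hy1, hy2⟩ := hlift x (hkeep x hxm (by omega))
        exact ⟨y, hy, by rw [hy1, he, hx1], by rw [hy2, he, hx2]⟩
      · intro x hx
        have key : ∃ y ∈ b :: rest, x.first = y.first ∧ x.dur = y.dur ∧
            (∀ a, a ∉ x.cand → a ∉ y.cand ∨ Evicted T C L y.first (t + 1) a) ∧
            (σ (t + 1)).glob ⊆ x.cand := by
          rw [hb] at hx
          rcases List.mem_cons.1 hx with rfl | hx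
          · refine ⟨b, List.mem_cons_self, hcf, hcd, fun a ha => ?_, fun a ha => ?_⟩
            · rw [hcc] at ha; tauto
            · rw [hcc]
              obtain ⟨ha1, ha2⟩ := (hg a).1 ha
              exact ⟨hbt.2.2.2.2.2.2 ha1, fun hE => ha2 (hE.mono' hbt.1 le_rfl)⟩
          · exact ⟨x, List.mem_cons_of_mem _ hx, rfl, rfl, fun a ha => Or.inl ha,
              hgsub.trans (hI.bases x (hsub x (List.mem_cons_of_mem _ hx))).2.2.2.2.2.2⟩
        obtain ⟨y, hy, hy1, hy2, hy3, hy4⟩ := key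
        obtain ⟨c1, c2, c3, c4, c5, c6, c7⟩ := hI.bases y (hsub y hy)
        rw [he, hy1, hy2]
        refine ⟨c1, by omega, c3, c4, ?_, ?_, hy4⟩
        · intro r hr hr'
          rcases Nat.lt_or_eq_of_le hr' with hr' | rfl
          · exact c5 r hr (by omega)
          · exact ⟨by rw [hcf]; exact hfirst y hy, he⟩
        · intro a ha
          rcases hy3 a ha with h | h
          · exact (c6 a h).mono' le_rfl (by omega)
          · exact h
      · rw [hcf, hcd]; exact hnot
      · intro τ h2 h3 h4 h5 h6
        rcases Nat.lt_or_eq_of_le h3 with h3 | rfl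
        · rw [he] at h2 h5
          obtain ⟨x, hxm, hx'⟩ := hI.live τ h2 (by omega) h4 h5 (by omega)
          have := (hI.bases x hxm).2.2.1
          obtain ⟨y, hy, hy1, hy2⟩ := hlift x (hkeep x hxm (by rw [this, hx']; exact h6))
          exact ⟨y, hy, hy1.trans hx'⟩
        · exact ⟨_, by rw [hb]; exact List.mem_cons_self, h4⟩
      · intro a ha
        rw [he]
        rw [hg] at ha
        by_cases ha' : a ∈ (σ t).glob
        · by_contra hE
          exact ha ⟨ha', hE⟩
        · exact (hI.glob_evicted a ha').mono' le_rfl (by omega)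
      · refine ⟨t + 1, by omega, le_rfl, fun a ha => ?_, fun r h2 h3 => by omega⟩
        rw [he]
        exact ((hg a).1 ha).2
      · intro a ha
        rw [hcf]
        exact ((hcc a).1 ha).2
      · intro r hr hr'
        rw [he] at hr
        rcases Nat.lt_or_eq_of_le hr' with hr' | rfl
        · exact hgsub.trans (hI.glob_mono r hr (by omega))
        · exact Subset.rfl
      · intro h2 _
        rw [hcf] at h2
        have := hbt.2.1
        omega
    · exact inv_fresh (by omega) hT he hg hc hs

namespace IsRun

variable (h : IsRun T C σ S L) {t r : ℕ}
include h

lemma first_mem (h1 : 1 ≤ t) (hT : t ≤ T) :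
    (σ t).episode ≤ (σ t).cur.first ∧ (σ t).cur.first ≤ t := by
  have := (h.inv h1 hT).bases (σ t).cur (by simp [bases])
  exact ⟨this.1, this.2.1⟩

lemma episode_mem (h1 : 1 ≤ t) (hT : t ≤ T) : 1 ≤ (σ t).episode ∧ (σ t).episode ≤ t :=
  ⟨(h.inv h1 hT).one_le, (h.inv h1 hT).le⟩

lemma first_first (h1 : 1 ≤ t) (hT : t ≤ T) :
    (σ (σ t).cur.first).cur.first = (σ t).cur.first ∧
      (σ (σ t).cur.first).cur.dur = (σ t).cur.dur := by
  have := (h.inv h1 hT).bases (σ t).cur (by simp [bases])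
  exact ⟨this.2.2.2.1, this.2.2.1.symm⟩

lemma le_first_add_dur (h1 : 1 ≤ t) (hT : t ≤ T) : t ≤ (σ t).cur.first + (σ t).cur.dur :=
  (h.inv h1 hT).alive

lemma first_le_first (h1 : 1 ≤ t) (hT : t ≤ T) (hr : (σ t).cur.first ≤ r) (hrt : r ≤ t) :
    (σ t).cur.first ≤ (σ r).cur.first ∧ (σ r).episode = (σ t).episode :=
  ((h.inv h1 hT).bases (σ t).cur (by simp [bases])).2.2.2.2.1 r hr hrt

lemma evicted_of_not_mem (h1 : 1 ≤ t) (hT : t ≤ T) {a : Fin K} (ha : a ∉ (σ t).cur.cand) :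
    Evicted T C L (σ t).cur.first t a :=
  ((h.inv h1 hT).bases (σ t).cur (by simp [bases])).2.2.2.2.2.1 a ha

lemma not_evicted (h1 : 1 ≤ t) (hT : t ≤ T) {a : Fin K} (ha : a ∈ (σ t).cur.cand) :
    ¬ Evicted T C L (σ t).cur.first t a :=
  (h.inv h1 hT).kept a ha

/-- A candidate of the running instance was a candidate in all rounds since the start of that
instance, including those in which other instances were running. -/
lemma mem_cand_of_mem (h1 : 1 ≤ t) (hT : t ≤ T) {a : Fin K} (ha : a ∈ (σ t).cur.cand)
    (hr : (σ t).cur.first ≤ r) (hrt : r ≤ t) : a ∈ (σ r).cur.cand := by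
  by_contra hne
  have h0 := h.first_mem h1 hT
  have h0' := h.episode_mem h1 hT
  exact h.not_evicted h1 hT ha ((h.evicted_of_not_mem (by omega) (by omega) hne).mono'
    (h.first_le_first h1 hT hr hrt).1 hrt)

lemma main_facts (h1 : 1 ≤ t) (hT : t ≤ T) :
    (σ (σ t).episode).cur.first = (σ t).episode ∧
      (σ (σ t).episode).cur.dur = T + 1 - (σ t).episode ∧
      (σ (σ t).episode).episode = (σ t).episode := by
  obtain ⟨b, hb, hb1, hb2⟩ := (h.inv h1 hT).main
  obtain ⟨c1, c2, c3, c4, c5, -⟩ := (h.inv h1 hT).bases b hb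
  have c6 := (c5 b.first le_rfl c2).2
  rw [hb1] at c3 c4 c6
  exact ⟨c4, c3.symm.trans hb2, c6⟩

lemma episode_eq (h1 : 1 ≤ t) (hT : t ≤ T) (hr : (σ t).episode ≤ r) (hrt : r ≤ t) :
    (σ r).episode = (σ t).episode := by
  obtain ⟨b, hb, hb1, hb2⟩ := (h.inv h1 hT).main
  exact (((h.inv h1 hT).bases b hb).2.2.2.2.1 r (hb1 ▸ hr) hrt).2

lemma glob_subset (h1 : 1 ≤ t) (hT : t ≤ T) (hr : (σ t).episode ≤ r) (hrt : r ≤ t) :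
    (σ t).glob ⊆ (σ r).cur.cand := by
  have h0' := h.episode_mem h1 hT
  exact ((h.inv h1 hT).glob_mono r hr hrt).trans
    ((h.inv (by omega) (by omega)).bases (σ r).cur (by simp [bases])).2.2.2.2.2.2

lemma cand_nonempty (h1 : 1 ≤ t) (hT : t ≤ T) : (σ t).cur.cand.Nonempty :=
  (h.inv h1 hT).nonempty.mono (h.glob_subset h1 hT (h.inv h1 hT).le le_rfl)

/-- In the scheduled rounds of an instance, only it and instances started later are running. -/
lemma le_first_of_replay {τ : ℕ} (h1 : 1 ≤ τ) (hτr : τ ≤ r) (hT : r ≤ T)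
    (hτ : (σ τ).cur.first = τ) (he : (σ τ).episode = (σ r).episode)
    (hr : r ≤ τ + (σ τ).cur.dur) : τ ≤ (σ r).cur.first := by
  have hI := h.inv (h1.trans hτr) hT
  have he' := (h.episode_mem h1 (hτr.trans hT)).2
  obtain ⟨b, hb, rfl⟩ := hI.live τ (by omega) hτr hτ he hr
  rcases List.mem_cons.1 hb with rfl | hb
  · exact le_rfl
  · exact ((List.pairwise_cons.1 hI.sorted).1 b hb).le

/-- The arm has left the candidate set within the scheduled rounds of an instance only if it was
evicted over these rounds. -/
lemma evicted_of_replay {τ v : ℕ} (h1 : 1 ≤ τ) (hT : v ≤ T)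
    (hτ : (σ τ).cur.first = τ) (he : (σ τ).episode = (σ v).episode)
    (hv : v ≤ τ + (σ τ).cur.dur) {a : Fin K} (hτr : τ ≤ r) (hrv : r ≤ v)
    (ha : a ∉ (σ r).cur.cand) : Evicted T C L τ r a := by
  have e1 := (h.episode_mem h1 (hτr.trans (hrv.trans hT))).2
  have e2 : (σ r).episode = (σ v).episode :=
    h.episode_eq (by omega) hT (by omega) hrv
  exact (h.evicted_of_not_mem (by omega) (by omega) ha).mono'
    (h.le_first_of_replay h1 hτr (by omega) hτ (by omega) (by omega)) le_rfl

/-- A new episode begins only once all arms are evicted over the current one. -/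
lemma evicted_of_episode_ne (h1 : 1 ≤ t) (hT : t < T)
    (hne : (σ (t + 1)).episode ≠ (σ t).episode) (a : Fin K) :
    Evicted T C L (σ t).episode (t + 1) a ∧ (σ (t + 1)).episode = t + 1 := by
  have hI := h.inv h1 hT.le
  rcases h.step_cases h1 hT hI with h' | ⟨_, _, h'⟩ | h'
  · exact absurd h'.2.1 hne
  · exact absurd h'.2.1 hne
  · refine ⟨?_, h'.2.1⟩
    by_cases ha : a ∈ (σ t).glob
    · exact h'.1 a ha
    · exact (hI.glob_evicted a ha).mono' le_rfl (by omega)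

lemma eq_startReplay (h1 : 1 ≤ t) (hT : t < T) (hf : (σ (t + 1)).cur.first = t + 1)
    (he : (σ (t + 1)).episode < t + 1) :
    σ (t + 1) = startReplay (t + 1) (σ (t + 1)).cur.dur (S t) ∧
      (S t).episode = (σ (t + 1)).episode := by
  have hI := h.inv h1 hT.le
  rcases h.step t h1 hT with ⟨k, hk, hkT, hst⟩ | hst
  · rw [hst]
    exact ⟨by simp [startReplay], rfl⟩
  · exfalso
    rcases h.step_cases h1 hT hI with h' | ⟨b, rest, hd, h'⟩ | h'
    · have e1 := congrArg (fun s => s.suspended.length) hst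
      have e2 := length_suspended_resume_le T C (t + 1) (S t)
      rw [← hst, h'.2.2.2, (h.endState t h1).2.2.2, bases] at e2
      simp at e2
    · have hb : b ∈ bases (σ t) := (List.dropWhile_sublist _).subset (by rw [hd]; simp)
      have := (hI.bases b hb).2.1
      have := h'.2.2.2.1
      omega
    · omega

lemma of_eq_startReplay {m : ℕ} (h1 : 1 ≤ t) (he : σ (t + 1) = startReplay (t + 1) m (S t)) :
    (σ (t + 1)).cur.first = t + 1 ∧ (σ (t + 1)).cur.dur = m ∧
      (σ (t + 1)).episode = (σ t).episode := by
  rw [he]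
  exact ⟨rfl, rfl, (h.endState t h1).1⟩

end IsRun

end Run

/-! ### Approximate winner phases -/

section Phases

variable {K : ℕ}

/-- A division of the rounds `1, …, T` into phases: `Z` is the set of first rounds of the phases,
`z t` is the first round of the phase of `t`, and `α t` is an arm, the same for all rounds of a
phase, that is an approximate winner throughout that phase. -/
structure IsPhasing (P : ℕ → Fin K → Fin K → ℝ) (astar : ℕ → Fin K) (T : ℕ) (Z : Finset ℕ)
    (z : ℕ → ℕ) (α : ℕ → Fin K) : Prop where
  mem : ∀ t, 1 ≤ t → t ≤ T → z t ∈ Z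
  one_le : ∀ t, 1 ≤ t → t ≤ T → 1 ≤ z t
  le : ∀ t, 1 ≤ t → t ≤ T → z t ≤ t
  const : ∀ t r, 1 ≤ t → t ≤ T → z t ≤ r → r ≤ t → z r = z t
  winner : ∀ t, α t = α (z t)
  gap : ∀ t, 1 ≤ t → t ≤ T → z t < t → ∀ b,
    |P t (astar t) b - P t (α t) b| ≤ ((K : ℝ) ^ 2 / ((t : ℝ) - (z t : ℝ))) ^ (1 / 3 : ℝ)

variable {P : ℕ → Fin K → Fin K → ℝ} {astar : ℕ → Fin K} {T : ℕ}

lemma approxChange_lt {i : ℕ} (h : approxChange P astar i ≠ ⊤) :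
    approxChange P astar i < approxChange P astar (i + 1) := by
  obtain ⟨z, hz⟩ := ENat.ne_top_iff_exists.1 h
  rw [← ENat.add_one_le_iff h]
  show _ ≤ sInf _
  refine le_sInf ?_
  rintro x ⟨z', t, h1, rfl, h3, -⟩
  rw [h1]
  exact_mod_cast h3

lemma approxChange_le_succ (i : ℕ) : approxChange P astar i ≤ approxChange P astar (i + 1) := by
  by_cases h : approxChange P astar i = ⊤
  · rw [h]
    show _ ≤ sInf _
    refine le_sInf ?_
    rintro x ⟨z', t, h1, -⟩
    rw [h] at h1
    exact absurd h1 (by simp)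
  · exact (approxChange_lt h).le

lemma approxChange_mono : Monotone (approxChange P astar) :=
  monotone_nat_of_le_succ approxChange_le_succ

lemma lt_approxChange (i : ℕ) : (i : ℕ∞) < approxChange P astar i := by
  induction i with
  | zero => simp [approxChange]
  | succ i ih =>
    by_cases h : approxChange P astar i = ⊤
    · have := approxChange_le_succ (P := P) (astar := astar) i
      rw [h, top_le_iff] at this
      rw [this]
      exact ENat.natCast_lt_top _
    · have h1 := approxChange_lt h
      have h2 : ((i + 1 : ℕ) : ℕ∞) ≤ approxChange P astar i := by
        push_cast
        exact Order.add_one_le_of_lt ih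
      exact h2.trans_lt h1

lemma exists_winner [NeZero K] {i z t : ℕ} (hz : approxChange P astar i = z)
    (ht : (t : ℕ∞) < approxChange P astar (i + 1)) : ∃ a, IsApproxWinner P astar z t a := by
  by_contra hne
  by_cases hzt : z < t
  · refine absurd ht (not_lt.2 ?_)
    show sInf _ ≤ _
    exact sInf_le ⟨z, t, hz, rfl, hzt, hne⟩
  · exact hne ⟨0, fun s h1 h2 => by omega⟩

variable (P astar) in
/-- The set of first rounds of the phases. -/
def phaseStarts (T : ℕ) : Finset ℕ :=
  ((range T).filter fun i => approxChange P astar i ≤ (T : ℕ∞)).image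
    fun i => (approxChange P astar i).toNat

lemma setOf_approxChange_le (T : ℕ) : {i : ℕ | approxChange P astar i ≤ (T : ℕ∞)} =
    ((range T).filter fun i => approxChange P astar i ≤ (T : ℕ∞) : Finset ℕ) := by
  ext i
  simp only [Set.mem_ofPred_eq, coe_filter, mem_range, iff_and_self]
  intro h
  exact_mod_cast (lt_approxChange i).trans_le h

lemma approxPhases_eq_card (T : ℕ) : approxPhases P astar T =
    #((range T).filter fun i => approxChange P astar i ≤ (T : ℕ∞)) := by
  rw [approxPhases, setOf_approxChange_le, Set.ncard_coe_finset]

lemma card_phaseStarts_le (T : ℕ) : #(phaseStarts P astar T) ≤ approxPhases P astar T := by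
  rw [approxPhases_eq_card]
  exact card_image_le

/-- The approximate winner phases are phases. -/
lemma exists_isPhasing [NeZero K] (P : ℕ → Fin K → Fin K → ℝ) (astar : ℕ → Fin K) (T : ℕ) :
    ∃ z α, IsPhasing P astar T (phaseStarts P astar T) z α := by
  classical
  set ζ := approxChange P astar with hζ
  have hz0 : ζ 0 = 1 := rfl
  -- the index of the phase of a round
  set idx : ℕ → ℕ := fun t => Nat.findGreatest (fun i => ζ i ≤ (t : ℕ∞)) t with hidx
  have idx_spec : ∀ t : ℕ, 1 ≤ t → ζ (idx t) ≤ t := by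
    intro t ht
    refine Nat.findGreatest_spec (P := fun i => ζ i ≤ (t : ℕ∞)) (Nat.zero_le t) ?_
    rw [hz0]
    exact_mod_cast ht
  have idx_lt : ∀ t : ℕ, (t : ℕ∞) < ζ (idx t + 1) := by
    intro t
    by_contra hle
    rw [not_lt] at hle
    have h1 : idx t + 1 ≤ t := by
      have := (lt_approxChange (P := P) (astar := astar) (idx t + 1)).trans_le hle
      exact_mod_cast this.le
    exact Nat.findGreatest_is_greatest (Nat.lt_succ_self (idx t)) h1 hle
  have idx_unique : ∀ t i : ℕ, ζ i ≤ (t : ℕ∞) → (t : ℕ∞) < ζ (i + 1) → idx t = i := by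
    intro t i h1 h2
    have hi : 1 ≤ t := by
      have := (hz0 ▸ approxChange_mono (Nat.zero_le i) : (1 : ℕ∞) ≤ ζ i).trans h1
      exact_mod_cast this
    refine le_antisymm (not_lt.1 fun hlt => ?_) (not_lt.1 fun hlt => ?_)
    · exact absurd ((approxChange_mono hlt).trans (idx_spec t hi)) (not_le.2 h2)
    · exact absurd ((approxChange_mono hlt).trans h1) (not_le.2 (idx_lt t))
  set z : ℕ → ℕ := fun t => (ζ (idx t)).toNat with hz
  have z_coe : ∀ t : ℕ, 1 ≤ t → ((z t : ℕ) : ℕ∞) = ζ (idx t) := by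
    intro t ht
    exact ENat.natCast_toNat (ne_top_of_le_ne_top (ENat.natCast_ne_top t) (idx_spec t ht))
  have z_le : ∀ t : ℕ, 1 ≤ t → z t ≤ t := by
    intro t ht
    have := idx_spec t ht
    rw [← z_coe t ht] at this
    exact_mod_cast this
  have z_one : ∀ t : ℕ, 1 ≤ t → 1 ≤ z t := by
    intro t ht
    have : (1 : ℕ∞) ≤ ζ (idx t) := hz0 ▸ approxChange_mono (Nat.zero_le _)
    rw [← z_coe t ht] at this
    exact_mod_cast this
  have idx_const : ∀ t r : ℕ, 1 ≤ t → z t ≤ r → r ≤ t → idx r = idx t := by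
    intro t r ht h1 h2
    refine idx_unique r _ ?_ ?_
    · rw [← z_coe t ht]
      exact_mod_cast h1
    · exact lt_of_le_of_lt (by exact_mod_cast h2) (idx_lt t)
  -- the winner of the phase with index `i`, on all of its rounds up to `T`
  set last : ℕ → ℕ := fun i => Nat.findGreatest (fun t => (t : ℕ∞) < ζ (i + 1)) T with hlast
  have hw : ∀ i, ∃ a, ζ i ≠ ⊤ → IsApproxWinner P astar (ζ i).toNat (last i) a := by
    intro i
    by_cases hi : ζ i = ⊤
    · exact ⟨0, fun h => absurd hi h⟩
    · have h0 : (0 : ℕ∞) < ζ (i + 1) := lt_of_le_of_lt (zero_le) (lt_approxChange (i + 1))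
      have : ((last i : ℕ) : ℕ∞) < ζ (i + 1) :=
        Nat.findGreatest_spec (P := fun t : ℕ => (t : ℕ∞) < ζ (i + 1)) (Nat.zero_le T)
          (by exact_mod_cast h0)
      obtain ⟨a, ha⟩ := exists_winner (ENat.natCast_toNat hi).symm this
      exact ⟨a, fun _ => ha⟩
  choose w hw using hw
  refine ⟨z, fun t => if 1 ≤ t then w (idx t) else w (idx (z t)), ?_⟩
  refine ⟨?_, fun t ht _ => z_one t ht, fun t ht _ => z_le t ht, ?_, ?_, ?_⟩
  · intro t ht htT
    refine mem_image.2 ⟨idx t, ?_, rfl⟩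
    have h1 : ζ (idx t) ≤ (T : ℕ∞) := (idx_spec t ht).trans (by exact_mod_cast htT)
    have : idx t ∈ {i : ℕ | approxChange P astar i ≤ (T : ℕ∞)} := h1
    rw [setOf_approxChange_le] at this
    exact this
  · intro t r ht _ h1 h2
    simp only [hz, idx_const t r ht h1 h2]
  · intro t
    by_cases ht : 1 ≤ t
    · rw [if_pos ht, if_pos (z_one t ht), idx_const t (z t) ht le_rfl (z_le t ht)]
    · rw [if_neg ht]
      have h0 : t = 0 := by omega
      split_ifs with h1
      · rfl
      · have h2 : z t = t := by omega
        rw [h2, h2]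
  · intro t ht htT hlt b
    rw [if_pos ht]
    have hne : ζ (idx t) ≠ ⊤ := ne_top_of_le_ne_top (ENat.natCast_ne_top t) (idx_spec t ht)
    exact hw (idx t) hne t hlt (Nat.le_findGreatest htT (idx_lt t)) b

lemma setOf_approxChange_le_eq (T : ℕ) : {i : ℕ | approxChange P astar i ≤ (T : ℕ∞)} =
    Set.Iio (approxPhases P astar T) := by
  classical
  set F := (range T).filter fun i => approxChange P astar i ≤ (T : ℕ∞) with hF
  have hmem : ∀ i, i ∈ F ↔ approxChange P astar i ≤ (T : ℕ∞) := fun i => by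
    rw [← mem_coe, hF, ← setOf_approxChange_le]; rfl
  have hrange : F = range #F := by
    have hsub : ∀ i ∈ F, range (i + 1) ⊆ F := fun i hi j hj =>
      (hmem j).2 ((approxChange_mono (Nat.lt_succ_iff.1 (mem_range.1 hj))).trans ((hmem i).1 hi))
    refine eq_of_subset_of_card_le (fun i hi => ?_) (by simp)
    have := card_le_card (hsub i hi)
    rw [card_range] at this
    exact mem_range.2 this
  rw [approxPhases_eq_card, setOf_approxChange_le, ← hF]
  conv_lhs => rw [hrange]
  ext i
  simp

/-- Over a completed phase the environment changes by a margin that is large if the phase is short: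
the dominant arm of the round at which the phase ends was far from dominant at some round of it. -/
lemma le_variation_of_approxChange {V : ℕ → ℝ}
    (hV : ∀ t, 2 ≤ t → t ≤ T → ∀ a b, |P t a b - P (t - 1) a b| ≤ V t)
    (hP : ∀ t ∈ Icc 1 T, IsDominantArm (P t) (astar t)) {i z t : ℕ}
    (hz : approxChange P astar i = z) (hz1 : 1 ≤ z) (ht : approxChange P astar (i + 1) = t)
    (htT : t ≤ T) :
    ((K : ℝ) ^ 2 / ((t : ℝ) - z)) ^ (1 / 3 : ℝ) ≤ 2 * ∑ r ∈ Ioc z t, V r := by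
  have hmem : approxChange P astar (i + 1) ∈ {x : ℕ∞ | ∃ z t : ℕ,
      approxChange P astar i = (z : ℕ∞) ∧ x = (t : ℕ∞) ∧ z < t ∧
        ¬ ∃ a, IsApproxWinner P astar z t a} := by
    refine csInf_mem (Set.nonempty_iff_ne_empty.2 fun h => ?_)
    have h1 : approxChange P astar (i + 1) = sInf _ := rfl
    rw [ht, h, sInf_empty] at h1
    exact absurd h1 (by simp)
  obtain ⟨z', t', h1, h2, hzt, hne⟩ := hmem
  rw [hz] at h1
  rw [ht] at h2
  obtain rfl : z = z' := by exact_mod_cast h1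
  obtain rfl : t = t' := by exact_mod_cast h2
  have hw : ¬ IsApproxWinner P astar z t (astar t) := fun h => hne ⟨_, h⟩
  simp only [IsApproxWinner, not_forall, not_le] at hw
  obtain ⟨s, hzs, hst, b, hlt⟩ := hw
  have hs1 : s ∈ Icc 1 T := mem_Icc.2 ⟨by omega, by omega⟩
  have hd := hP s hs1 (astar t) b
  have hd' := hP t (mem_Icc.2 ⟨by omega, htT⟩) (astar s) b
  rw [abs_of_nonneg (by linarith)] at hlt
  have hV0 : ∀ r ∈ Ioc z t, 0 ≤ V r := fun r hr =>
    (abs_nonneg _).trans (hV r (by have := (mem_Ioc.1 hr).1; omega)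
      ((mem_Ioc.1 hr).2.trans htT) b b)
  have tele : ∀ a : Fin K, ∀ u, s ≤ u → u ≤ t → |P u a b - P s a b| ≤ ∑ r ∈ Ioc s u, V r := by
    intro a u hu
    induction u, hu using Nat.le_induction with
    | base => simp
    | succ u hu ih =>
      intro hut
      rw [sum_Ioc_succ_top (by omega)]
      have h1 := hV (u + 1) (by omega) (by omega) a b
      have h2 := ih (by omega)
      rw [Nat.add_sub_cancel] at h1
      have h3 := abs_sub_le (P (u + 1) a b) (P u a b) (P s a b)
      linarith
  have t1 := tele (astar s) t hst le_rfl
  have t2 := tele (astar t) t hst le_rfl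
  have hsub : ∑ r ∈ Ioc s t, V r ≤ ∑ r ∈ Ioc z t, V r :=
    sum_le_sum_of_subset_of_nonneg (Ioc_subset_Ioc_left hzs.le) fun r hr _ => hV0 r hr
  have hle : ((K : ℝ) ^ 2 / ((t : ℝ) - z)) ^ (1 / 3 : ℝ) ≤
      ((K : ℝ) ^ 2 / ((s : ℝ) - z)) ^ (1 / 3 : ℝ) := by
    have h1 : (z : ℝ) < s := by exact_mod_cast hzs
    have h2 : (s : ℝ) ≤ t := by exact_mod_cast hst
    apply Real.rpow_le_rpow
    · apply div_nonneg (by positivity); linarith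
    · apply div_le_div_of_nonneg_left (by positivity) <;> linarith
    · norm_num
  have t1' := (abs_le.1 t1).1
  have t2' := (abs_le.1 t2).2
  linarith

/-- Few phases begin if the total variation is small. -/
lemma approxPhases_sub_one_pow_le [NeZero K] (hT : 1 ≤ T)
    (hP : ∀ t ∈ Icc 1 T, IsDominantArm (P t) (astar t)) :
    1 ≤ approxPhases P astar T ∧ ((approxPhases P astar T : ℝ) - 1) ^ 4 * (K : ℝ) ^ 2 ≤
      T * (2 * totalVariation P T) ^ 3 := by
  set S := approxPhases P astar T with hS
  have hmem : ∀ i, approxChange P astar i ≤ (T : ℕ∞) ↔ i < S := fun i => by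
    have := Set.ext_iff.1 (setOf_approxChange_le_eq (P := P) (astar := astar) T) i
    simpa using this
  have hS1 : 1 ≤ S := (hmem 0).1 (by show (1 : ℕ∞) ≤ T; exact_mod_cast hT)
  refine ⟨hS1, ?_⟩
  set ζ : ℕ → ℕ := fun i => (approxChange P astar i).toNat with hζ
  have hcoe : ∀ i, i < S → approxChange P astar i = ζ i := fun i hi =>
    (ENat.natCast_toNat (ne_top_of_le_ne_top (ENat.natCast_ne_top T) ((hmem i).2 hi))).symm
  have hζT : ∀ i, i < S → ζ i ≤ T := fun i hi => by
    have := (hmem i).2 hi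
    rw [hcoe i hi] at this
    exact_mod_cast this
  have hζ1 : ∀ i, i < S → 1 ≤ ζ i := fun i hi => by
    have := (lt_approxChange (P := P) (astar := astar) i)
    rw [hcoe i hi] at this
    have : i < ζ i := by exact_mod_cast this
    omega
  have hζlt : ∀ i, i + 1 < S → ζ i < ζ (i + 1) := fun i hi => by
    have := approxChange_lt (P := P) (astar := astar) (i := i) (by rw [hcoe i (by omega)]; simp)
    rw [hcoe i (by omega), hcoe _ hi] at this
    exact_mod_cast this
  set v : ℕ → ℝ := fun t => ⨆ x : Fin K × Fin K, |P t x.1 x.2 - P (t - 1) x.1 x.2| with hv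
  have hvle : ∀ t a b, |P t a b - P (t - 1) a b| ≤ v t := fun t a b =>
    le_ciSup (f := fun x : Fin K × Fin K => |P t x.1 x.2 - P (t - 1) x.1 x.2|)
      (Set.finite_range _).bddAbove (a, b)
  have hv0 : ∀ t, 0 ≤ v t := fun t => (abs_nonneg _).trans (hvle t 0 0)
  set n := S - 1 with hn
  have hK : (0 : ℝ) < K := by exact_mod_cast Nat.pos_of_ne_zero (NeZero.ne K)
  set x : ℕ → ℝ := fun i =>
    ((K : ℝ) ^ 2 / ((ζ (i + 1) : ℝ) - ζ i)) ^ (1 / 3 : ℝ) with hx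
  have hlen : ∀ i ∈ range n, (0 : ℝ) < (ζ (i + 1) : ℝ) - ζ i := fun i hi => by
    have := hζlt i (by have := mem_range.1 hi; omega)
    have : (ζ i : ℝ) < ζ (i + 1) := by exact_mod_cast this
    linarith
  have hx0 : ∀ i ∈ range n, 0 < x i := fun i hi => by
    have := hlen i hi
    positivity
  have hx3 : ∀ i ∈ range n, (1 / x i) ^ 3 = ((ζ (i + 1) : ℝ) - ζ i) / (K : ℝ) ^ 2 := fun i hi => by
    have h1 := hlen i hi
    have : x i ^ 3 = (K : ℝ) ^ 2 / ((ζ (i + 1) : ℝ) - ζ i) := by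
      rw [hx]
      dsimp only
      rw [← Real.rpow_natCast, ← Real.rpow_mul (by positivity)]
      norm_num
    rw [div_pow, one_pow, this, one_div_div]
  have htel : ∀ m, m ≤ n → ∑ i ∈ range m, ∑ r ∈ Ioc (ζ i) (ζ (i + 1)), v r =
      ∑ r ∈ Ioc (ζ 0) (ζ m), v r := by
    intro m
    induction m with
    | zero => simp
    | succ m ih =>
      intro hm
      have hmono : ζ 0 ≤ ζ m := ENat.toNat_le_toNat (approxChange_mono (Nat.zero_le m))
        (by rw [hcoe m (by omega)]; simp)
      rw [sum_range_succ, ih (by omega), sum_Ioc_consecutive _ hmono (hζlt m (by omega)).le]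
  have hsumx : ∑ i ∈ range n, x i ≤ 2 * totalVariation P T := by
    calc ∑ i ∈ range n, x i ≤ ∑ i ∈ range n, 2 * ∑ r ∈ Ioc (ζ i) (ζ (i + 1)), v r := by
          refine sum_le_sum fun i hi => ?_
          have hi' := mem_range.1 hi
          exact le_variation_of_approxChange (fun t _ _ => hvle t) hP (hcoe i (by omega))
            (hζ1 i (by omega)) (hcoe (i + 1) (by omega)) (hζT _ (by omega))
      _ = 2 * ∑ r ∈ Ioc (ζ 0) (ζ n), v r := by rw [← mul_sum, htel n le_rfl]
      _ ≤ 2 * totalVariation P T := by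
          refine mul_le_mul_of_nonneg_left ?_ (by norm_num)
          refine sum_le_sum_of_subset_of_nonneg (fun r hr => ?_) fun r _ _ => hv0 r
          have h1 := mem_Ioc.1 hr
          have h2 := hζ1 0 (by omega)
          have h3 := hζT n (by omega)
          exact mem_Icc.2 ⟨by omega, by omega⟩
  have hsum3 : (∑ i ∈ range n, (1 / x i) ^ 3) * (K : ℝ) ^ 2 ≤ T := by
    rw [sum_congr rfl hx3, ← sum_div, sum_range_sub (fun i => (ζ i : ℝ)),
      div_mul_cancel₀ _ (by positivity)]
    have h3 : (ζ n : ℝ) ≤ T := by exact_mod_cast hζT n (by omega)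
    have : (0 : ℝ) ≤ ζ 0 := by positivity
    linarith
  -- Hölder's inequality, as two applications of the Cauchy-Schwarz inequality
  have cs1 : (n : ℝ) ^ 2 ≤ (∑ i ∈ range n, x i) * ∑ i ∈ range n, 1 / x i := by
    have := sum_sq_le_sum_mul_sum_of_sq_le_mul (range n) (r := fun _ => (1 : ℝ)) (f := x)
      (g := fun i => 1 / x i) (fun i hi => (hx0 i hi).le)
      (fun i hi => (one_div_pos.2 (hx0 i hi)).le) (fun i hi => le_of_eq <| by
        have := (hx0 i hi).ne'
        field_simp)
    simpa using this
  have cs2 : (∑ i ∈ range n, 1 / x i) ^ 2 ≤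
      (∑ i ∈ range n, (1 / x i) ^ 3) * ∑ i ∈ range n, x i := by
    refine sum_sq_le_sum_mul_sum_of_sq_le_mul (range n) (fun i hi => ?_)
      (fun i hi => (hx0 i hi).le) (fun i hi => ?_)
    · have := hx0 i hi
      positivity
    · have := (hx0 i hi).ne'
      exact le_of_eq (by field_simp)
  set X := ∑ i ∈ range n, x i
  set Y := ∑ i ∈ range n, 1 / x i
  set W := ∑ i ∈ range n, (1 / x i) ^ 3
  have hX0 : 0 ≤ X := sum_nonneg fun i hi => (hx0 i hi).le
  have hY0 : 0 ≤ Y := sum_nonneg fun i hi => (one_div_pos.2 (hx0 i hi)).le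
  have hW0 : 0 ≤ W := sum_nonneg fun i hi => pow_nonneg (one_div_pos.2 (hx0 i hi)).le 3
  have hV0 : 0 ≤ 2 * totalVariation P T := hX0.trans hsumx
  have hnS : (S : ℝ) - 1 = n := by rw [hn, Nat.cast_sub hS1]; simp
  rw [hnS]
  calc (n : ℝ) ^ 4 * (K : ℝ) ^ 2 = ((n : ℝ) ^ 2) ^ 2 * (K : ℝ) ^ 2 := by ring
    _ ≤ (X * Y) ^ 2 * (K : ℝ) ^ 2 := by gcongr
    _ = X ^ 2 * Y ^ 2 * (K : ℝ) ^ 2 := by ring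
    _ ≤ X ^ 2 * (W * X) * (K : ℝ) ^ 2 := by gcongr
    _ = X ^ 3 * (W * (K : ℝ) ^ 2) := by ring
    _ ≤ (2 * totalVariation P T) ^ 3 * T := by gcongr
    _ = _ := by ring

end Phases

/-! ### Cube roots, harmonic sums and sums over phases -/

section Aux

/-- The cube root of a nonnegative real number. -/
def cbrt (x : ℝ) : ℝ := x ^ (1 / 3 : ℝ)

lemma cbrt_nonneg {x : ℝ} (hx : 0 ≤ x) : 0 ≤ cbrt x := Real.rpow_nonneg hx _

lemma cbrt_pos {x : ℝ} (hx : 0 < x) : 0 < cbrt x := Real.rpow_pos_of_pos hx _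

lemma cbrt_pow_three {x : ℝ} (hx : 0 ≤ x) : cbrt x ^ 3 = x := by
  rw [cbrt, ← Real.rpow_natCast, ← Real.rpow_mul hx]
  norm_num

lemma cbrt_le_cbrt {x y : ℝ} (hx : 0 ≤ x) (h : x ≤ y) : cbrt x ≤ cbrt y :=
  Real.rpow_le_rpow hx h (by norm_num)

lemma cbrt_one : cbrt 1 = 1 := Real.one_rpow _

lemma one_le_cbrt {x : ℝ} (h : 1 ≤ x) : 1 ≤ cbrt x := Real.one_le_rpow h (by norm_num)

lemma cbrt_mul {x y : ℝ} (hx : 0 ≤ x) (hy : 0 ≤ y) : cbrt (x * y) = cbrt x * cbrt y :=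
  Real.mul_rpow hx hy

lemma rpow_two_thirds {x : ℝ} (hx : 0 ≤ x) : x ^ (2 / 3 : ℝ) = cbrt x ^ 2 := by
  rw [cbrt, ← Real.rpow_natCast, ← Real.rpow_mul hx]
  norm_num

lemma rpow_neg_third {x : ℝ} (hx : 0 ≤ x) : x ^ (-(1 / 3) : ℝ) = 1 / cbrt x := by
  rw [Real.rpow_neg hx, cbrt, ← one_div]

lemma rpow_neg_two_thirds {x : ℝ} (hx : 0 ≤ x) : x ^ (-(2 / 3) : ℝ) = 1 / cbrt x ^ 2 := by
  rw [Real.rpow_neg hx, rpow_two_thirds hx, ← one_div]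

lemma cbrt_le_of_le_pow {x y : ℝ} (hx : 0 ≤ x) (hy : 0 ≤ y) (h : x ≤ y ^ 3) : cbrt x ≤ y := by
  rw [← cbrt_pow_three hx] at h
  exact le_of_pow_le_pow_left₀ (by norm_num) hy h

/-- Young's inequality for the exponents `3/2` and `3`. -/
lemma sq_le_mul_cube_add {w A : ℝ} (hw : 0 ≤ w) (hA : 0 < A) : w ^ 2 ≤ A * w ^ 3 + 1 / A ^ 2 := by
  set y := A * w with hy
  have hy0 : 0 ≤ y := by positivity
  have hw' : w = y / A := by rw [hy]; field_simp
  have e : A * w ^ 3 + 1 / A ^ 2 - w ^ 2 = (y ^ 3 + 1 - y ^ 2) / A ^ 2 := by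
    rw [hw']; field_simp
  have h1 : 0 ≤ y ^ 3 + 1 - y ^ 2 := by
    rcases le_total y 1 with h | h
    · nlinarith [pow_nonneg hy0 3]
    · nlinarith [pow_nonneg hy0 2]
  have : 0 ≤ (y ^ 3 + 1 - y ^ 2) / A ^ 2 := by positivity
  linarith

lemma sum_inv_cbrt_le (N : ℕ) :
    ∑ i ∈ range N, 1 / cbrt ((i : ℝ) + 1) ≤ 3 / 2 * cbrt N ^ 2 := by
  induction N with
  | zero => simp; positivity
  | succ N ih =>
    rw [sum_range_succ]
    set x := cbrt ((N : ℝ) + 1) with hx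
    set y := cbrt (N : ℝ) with hy
    have hx0 : 0 < x := cbrt_pos (by positivity)
    have hy0 : 0 ≤ y := cbrt_nonneg (by positivity)
    have h3 : x ^ 3 - y ^ 3 = 1 := by
      rw [cbrt_pow_three (by positivity), cbrt_pow_three (by positivity)]; ring
    have h1 : 1 / x ≤ 3 / 2 * (x ^ 2 - y ^ 2) := by
      rw [div_le_iff₀ hx0]
      nlinarith [mul_nonneg (sq_nonneg (x - y)) (by positivity : 0 ≤ x + 2 * y)]
    push_cast
    rw [← hx]
    linarith

lemma sum_inv_cbrt_sq_le (N : ℕ) :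
    ∑ i ∈ range N, 1 / cbrt ((i : ℝ) + 1) ^ 2 ≤ 3 * cbrt N := by
  induction N with
  | zero => simp; exact cbrt_nonneg le_rfl
  | succ N ih =>
    rw [sum_range_succ]
    set x := cbrt ((N : ℝ) + 1) with hx
    set y := cbrt (N : ℝ) with hy
    have hx0 : 0 < x := cbrt_pos (by positivity)
    have hy0 : 0 ≤ y := cbrt_nonneg (by positivity)
    have hyx : y ≤ x := cbrt_le_cbrt (by positivity) (by linarith)
    have h3 : x ^ 3 - y ^ 3 = 1 := by
      rw [cbrt_pow_three (by positivity), cbrt_pow_three (by positivity)]; ring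
    have h1 : 1 / x ^ 2 ≤ 3 * (x - y) := by
      rw [div_le_iff₀ (by positivity)]
      nlinarith [mul_nonneg (sub_nonneg.2 hyx) (mul_nonneg (sub_nonneg.2 hyx)
        (by positivity : 0 ≤ 2 * x + y))]
    push_cast
    rw [← hx]
    linarith

/-- If the sets of the elements at least as late as `a` all weigh equally, the total weight is a
harmonic number. -/
lemma sum_one_div_card_le {ι : Type*} [DecidableEq ι] (M : ι → ℕ) (s : Finset ι) :
    ∑ a ∈ s, (1 : ℝ) / #{a' ∈ s | M a ≤ M a'} ≤ ∑ i ∈ range #s, (1 : ℝ) / (i + 1) := by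
  induction s using Finset.induction_on_min_value M with
  | empty => simp
  | insert a s ha hmin ih =>
    rw [sum_insert ha, card_insert_of_notMem ha, sum_range_succ, add_comm]
    refine add_le_add (le_trans (sum_le_sum fun b hb => ?_) ih) ?_
    · refine one_div_le_one_div_of_le ?_ ?_
      · exact_mod_cast card_pos.2 ⟨b, by simp [hb]⟩
      · exact_mod_cast card_le_card (filter_subset_filter _ (subset_insert _ _))
    · rw [filter_true_of_mem]
      · rw [card_insert_of_notMem ha]; push_cast; rfl
      · intro b hb
        rcases mem_insert.1 hb with rfl | hb
        · exact le_rfl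
        · exact hmin b hb

lemma sum_one_div_card_le_log {ι : Type*} [DecidableEq ι] (M : ι → ℕ) (s : Finset ι) :
    ∑ a ∈ s, (1 : ℝ) / #{a' ∈ s | M a ≤ M a'} ≤ 1 + Real.log #s := by
  refine (sum_one_div_card_le M s).trans ?_
  have := harmonic_le_one_add_log #s
  simp only [harmonic, Rat.cast_sum, Rat.cast_inv, Rat.cast_add, Rat.cast_one,
    Rat.cast_natCast, Nat.cast_add, Nat.cast_one] at this
  simpa only [one_div] using this

variable {K : ℕ} {P : ℕ → Fin K → Fin K → ℝ} {astar : ℕ → Fin K} {T : ℕ} {Z : Finset ℕ}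
  {z : ℕ → ℕ} {α : ℕ → Fin K}

/-- The number of phases that begin in the rounds `u + 1, …, v`. -/
def changes (Z : Finset ℕ) (u v : ℕ) : ℕ := #{w ∈ Z | u < w ∧ w ≤ v}

lemma changes_mono {u u' v v' : ℕ} (hu : u' ≤ u) (hv : v ≤ v') :
    changes Z u v ≤ changes Z u' v' := by
  refine card_le_card fun w hw => ?_
  simp only [mem_filter] at hw ⊢
  exact ⟨hw.1, by omega, by omega⟩

lemma changes_lt {u v w : ℕ} (hw : w ∈ Z) (hu : u < w) (hv : w ≤ v) :
    changes Z u (w - 1) + 1 ≤ changes Z u v := by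
  refine Nat.succ_le_of_lt (card_lt_card ?_)
  rw [ssubset_iff_of_subset]
  · exact ⟨w, by simp [hw, hu, hv], by simp; omega⟩
  · intro x hx
    simp only [mem_filter] at hx ⊢
    exact ⟨hx.1, by omega, by omega⟩

/-- A bound for sums over rounds of one phase extends to sums over several phases. -/
lemma IsPhasing.sum_le (h : IsPhasing P astar T Z z α) {f : ℕ → ℝ} {A B : ℝ}
    (hB : 0 ≤ B) {u v : ℕ} (hu : 1 ≤ u) (huv : u ≤ v) (hv : v ≤ T)
    (hf : ∀ x y, u ≤ x → x ≤ y → y ≤ v → z y ≤ x →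
      ∑ t ∈ Icc x y, f t ≤ A * ((y : ℝ) - x + 1) + B) :
    ∑ t ∈ Icc u v, f t ≤ A * ((v : ℝ) - u + 1) + B * (changes Z u v + 1) := by
  induction v using Nat.strong_induction_on with
  | _ v ih =>
    by_cases hzv : z v ≤ u
    · have h1 := hf u v le_rfl huv le_rfl hzv
      have h2 : (0 : ℝ) ≤ changes Z u v := by positivity
      nlinarith
    · have hzle := h.le v (hu.trans huv) hv
      have ih' := ih (z v - 1) (by omega) (by omega) (by omega)
        fun x y h1 h2 h3 h4 => hf x y h1 h2 (by omega) h4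
      have h1 := hf (z v) v (by omega) hzle le_rfl le_rfl
      have h2 := changes_lt (h.mem v (hu.trans huv) hv) (not_le.1 hzv) hzle
      have h2' : (changes Z u (z v - 1) : ℝ) + 1 ≤ changes Z u v := by exact_mod_cast h2
      have hsplit : ∑ t ∈ Icc u v, f t = ∑ t ∈ Icc u (z v - 1), f t + ∑ t ∈ Icc (z v) v, f t := by
        rw [← sum_union]
        · congr 1
          ext t
          simp only [mem_union, mem_Icc]
          omega
        · rw [disjoint_left]
          intro t
          simp only [mem_Icc]
          omega
      have hc : ((z v - 1 : ℕ) : ℝ) = (z v : ℝ) - 1 := by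
        rw [Nat.cast_sub (by omega)]; simp
      rw [hc] at ih'
      rw [hsplit]
      nlinarith

/-! ### Learning rates and eviction thresholds -/

variable [NeZero K]

lemma one_le_cbrt_arms : 1 ≤ cbrt (K : ℝ) :=
  one_le_cbrt (by exact_mod_cast Nat.one_le_iff_ne_zero.2 (NeZero.ne K))

omit [NeZero K] in
lemma learningRate_le {n : ℕ} (hn : n ≠ 0) :
    learningRate K n ≤ cbrt (K : ℝ) ^ 2 * (1 / cbrt n) := by
  rw [learningRate, if_neg hn, rpow_two_thirds (by positivity), rpow_neg_third (by positivity)]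
  exact min_le_left _ _

lemma inv_learningRate_le (n : ℕ) :
    (learningRate K n)⁻¹ ≤ 1 + cbrt n / cbrt (K : ℝ) ^ 2 := by
  have hκ := one_le_cbrt_arms (K := K)
  have h0 : 0 ≤ cbrt n / cbrt (K : ℝ) ^ 2 := div_nonneg (cbrt_nonneg (by positivity)) (by positivity)
  rw [learningRate]
  split_ifs with hn
  · simpa using h0
  · have hn' : 0 < cbrt (n : ℝ) := cbrt_pos (by exact_mod_cast Nat.pos_of_ne_zero hn)
    rw [rpow_two_thirds (by positivity), rpow_neg_third (by positivity)]
    rcases min_choice (cbrt (K : ℝ) ^ 2 * (1 / cbrt (n : ℝ))) 1 with h | h <;> rw [h]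
    · rw [mul_one_div, inv_div]; linarith
    · simpa using h0

lemma sum_learningRate_le (N : ℕ) (hN : 1 ≤ N) :
    ∑ n ∈ range N, learningRate K n ≤ 3 * cbrt (K : ℝ) ^ 2 * cbrt N ^ 2 := by
  obtain ⟨M, rfl⟩ : ∃ M, N = M + 1 := ⟨N - 1, by omega⟩
  have hκ := one_le_cbrt_arms (K := K)
  rw [sum_range_succ']
  have h1 : ∑ n ∈ range M, learningRate K (n + 1) ≤ cbrt (K : ℝ) ^ 2 * (3 / 2 * cbrt M ^ 2) := by
    refine le_trans ?_ (mul_le_mul_of_nonneg_left (sum_inv_cbrt_le M) (by positivity))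
    rw [mul_sum]
    refine sum_le_sum fun n _ => ?_
    have := learningRate_le (K := K) (n := n + 1) (by omega)
    push_cast at this
    exact this
  have h2 : cbrt (M : ℝ) ≤ cbrt ((M + 1 : ℕ) : ℝ) := cbrt_le_cbrt (by positivity) (by push_cast; linarith)
  have h3 : 1 ≤ cbrt ((M + 1 : ℕ) : ℝ) := one_le_cbrt (by push_cast; linarith [(Nat.cast_nonneg M : (0:ℝ) ≤ M)])
  have h4 := learningRate_le_one (K := K) 0
  have h5 : 0 ≤ cbrt (M : ℝ) := cbrt_nonneg (by positivity)
  have h6 : cbrt (M : ℝ) ^ 2 ≤ cbrt ((M + 1 : ℕ) : ℝ) ^ 2 := by gcongr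
  have h7 : 1 ≤ cbrt (K : ℝ) ^ 2 * cbrt ((M + 1 : ℕ) : ℝ) ^ 2 :=
    one_le_mul_of_one_le_of_one_le (one_le_pow₀ hκ) (one_le_pow₀ h3)
  have h8 : cbrt (K : ℝ) ^ 2 * cbrt (M : ℝ) ^ 2 ≤ cbrt (K : ℝ) ^ 2 * cbrt ((M + 1 : ℕ) : ℝ) ^ 2 := by
    gcongr
  nlinarith

/-- The part of the eviction threshold that comes from the noise of the estimates. -/
def noiseLevel (log : ℕ → RoundLog K) (s₁ s₂ : ℕ) : ℝ :=
  √((K : ℝ) ^ 2 * ∑ s ∈ Icc s₁ s₂, ((log s).rate)⁻¹)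
    + (K : ℝ) ^ 2 * ⨆ s : Set.Icc s₁ s₂, ((log s).rate)⁻¹

omit [NeZero K] in
lemma noiseLevel_le_evictionThreshold (log : ℕ → RoundLog K) (s₁ s₂ : ℕ) :
    noiseLevel log s₁ s₂ ≤ evictionThreshold log s₁ s₂ := le_max_right _ _

omit [NeZero K] in
lemma inv_rate_le_iSup (log : ℕ → RoundLog K) {s₁ s₂ s : ℕ} (hs : s ∈ Icc s₁ s₂) :
    ((log s).rate)⁻¹ ≤ ⨆ s : Set.Icc s₁ s₂, ((log s).rate)⁻¹ :=
  le_ciSup (f := fun s : Set.Icc s₁ s₂ => ((log s).rate)⁻¹) (Set.finite_range _).bddAbove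
    ⟨s, mem_Icc.1 hs⟩

/-- Regret incurred at the unit rate `A`, at the price of a constant cost, bounds the eviction
threshold. -/
lemma evictionThreshold_le {log : ℕ → RoundLog K} {s₁ s₂ : ℕ} (hs : s₁ ≤ s₂) {G A : ℝ}
    (hA : 0 < A) (hA1 : A ≤ 1) (hG : ∀ s ∈ Icc s₁ s₂, ((log s).rate)⁻¹ ≤ G) (hG0 : 0 ≤ G) :
    evictionThreshold log s₁ s₂ ≤
      2 * A * ((s₂ : ℝ) - s₁ + 1) + 2 * (K : ℝ) ^ 2 * G / A + (K : ℝ) ^ 2 / A ^ 2 := by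
  have hs' : (s₁ : ℝ) ≤ s₂ := by exact_mod_cast hs
  have hκ := one_le_cbrt_arms (K := K)
  set ℓ : ℝ := (s₂ : ℝ) - s₁ + 1 with hℓ
  have hℓ0 : 0 ≤ ℓ := by linarith
  have hK3 : cbrt (K : ℝ) ^ 3 = K := cbrt_pow_three (by positivity)
  have t1 : (K : ℝ) ^ (2 / 3 : ℝ) * ((s₂ : ℝ) - (s₁ : ℝ)) ^ (2 / 3 : ℝ) ≤
      A * ℓ + (K : ℝ) ^ 2 / A ^ 2 := by
    rw [rpow_two_thirds (by positivity), rpow_two_thirds (by linarith)]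
    have h1 : cbrt ((s₂ : ℝ) - s₁) ≤ cbrt ℓ := cbrt_le_cbrt (by linarith) (by linarith)
    have h0 : 0 ≤ cbrt ((s₂ : ℝ) - s₁) := cbrt_nonneg (by linarith)
    have hw := sq_le_mul_cube_add (w := cbrt ℓ) (A := A / cbrt (K : ℝ) ^ 2)
      (cbrt_nonneg hℓ0) (by positivity)
    rw [cbrt_pow_three hℓ0] at hw
    calc cbrt (K : ℝ) ^ 2 * cbrt ((s₂ : ℝ) - s₁) ^ 2 ≤ cbrt (K : ℝ) ^ 2 * cbrt ℓ ^ 2 := by gcongr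
      _ ≤ cbrt (K : ℝ) ^ 2 * (A / cbrt (K : ℝ) ^ 2 * ℓ + 1 / (A / cbrt (K : ℝ) ^ 2) ^ 2) := by
          gcongr
      _ = A * ℓ + (cbrt (K : ℝ) ^ 3) ^ 2 / A ^ 2 := by field_simp
      _ = _ := by rw [hK3]
  have hcard : (#(Icc s₁ s₂) : ℝ) = ℓ := by
    rw [Nat.card_Icc, Nat.cast_sub (by omega)]; push_cast; ring
  have t2 : √((K : ℝ) ^ 2 * ∑ s ∈ Icc s₁ s₂, ((log s).rate)⁻¹) ≤
      A * ℓ / 2 + (K : ℝ) ^ 2 * G / A / 2 := by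
    have hsum : ∑ s ∈ Icc s₁ s₂, ((log s).rate)⁻¹ ≤ ℓ * G := by
      rw [← hcard, ← nsmul_eq_mul]
      exact sum_le_card_nsmul _ _ _ hG
    apply Real.sqrt_le_iff.2
    refine ⟨by positivity, ?_⟩
    have e : (A * ℓ / 2 + (K : ℝ) ^ 2 * G / A / 2) ^ 2 =
        (A * ℓ / 2 - (K : ℝ) ^ 2 * G / A / 2) ^ 2 + (K : ℝ) ^ 2 * (ℓ * G) := by
      field_simp; ring
    rw [e]
    have := sq_nonneg (A * ℓ / 2 - (K : ℝ) ^ 2 * G / A / 2)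
    have h2 : (K : ℝ) ^ 2 * ∑ s ∈ Icc s₁ s₂, ((log s).rate)⁻¹ ≤ (K : ℝ) ^ 2 * (ℓ * G) := by gcongr
    linarith
  have hsup : ⨆ s : Set.Icc s₁ s₂, ((log s).rate)⁻¹ ≤ G := by
    have : Nonempty (Set.Icc s₁ s₂) := ⟨⟨s₁, le_rfl, hs⟩⟩
    exact ciSup_le fun s => hG s (mem_Icc.2 s.2)
  have t3 : (K : ℝ) ^ 2 * ⨆ s : Set.Icc s₁ s₂, ((log s).rate)⁻¹ ≤ (K : ℝ) ^ 2 * G / A := by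
    calc _ ≤ (K : ℝ) ^ 2 * G := by gcongr
      _ ≤ _ := le_div_self (by positivity) hA hA1
  have hAl : 0 ≤ A * ℓ := by positivity
  have hKG : 0 ≤ (K : ℝ) ^ 2 * G / A := by positivity
  have hKA : 0 ≤ (K : ℝ) ^ 2 / A ^ 2 := by positivity
  have e1 : 2 * (K : ℝ) ^ 2 * G / A = 2 * ((K : ℝ) ^ 2 * G / A) := by ring
  rw [evictionThreshold, e1]
  refine max_le ?_ ?_ <;> linarith

end Aux

/-! ### Consequences of accurate estimates -/

section Good

variable {K : ℕ} [NeZero K]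

/-- A start of a replay of size `m` in the episode that began at round `t₀`. -/
def IsReplay (σ : ℕ → MetaState K) (t₀ m t : ℕ) : Prop :=
  t₀ < t ∧ (σ t).cur.first = t ∧ (σ t).episode = t₀ ∧ (σ t).cur.dur = m

open Classical in
/-- The random events on which the regret bound relies: the estimates are accurate up to the noise
level, replays are not much more frequent than expected, and whichever replays are called for by a
schedule `D s a` (at round `τ`, a replay of size at least `2 ^ D s a τ`, unless `D s a τ = 0`),
one of them takes place unless they are unlikely even taken together. -/
structure IsGood (P : ℕ → Fin K → Fin K → ℝ) (T : ℕ) (Λ : ℝ) (σ : ℕ → MetaState K)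
    (L : ℕ → RoundLog K) (D : ℕ → Fin K → ℕ → ℕ) : Prop where
  conc : ∀ s₁ s₂, 1 ≤ s₁ → s₁ ≤ s₂ → s₂ ≤ T → ∀ a a' c : Fin K,
    (∀ s ∈ Icc s₁ s₂, a ∈ (L s).cand ∧ a' ∈ (L s).cand) →
    ∑ s ∈ Icc s₁ s₂, (bordaEstimate (L s) a' (Pi.single c 1)
        - bordaEstimate (L s) a (Pi.single c 1) - (P s a' c - P s a c)) ≤
      3 * Λ * noiseLevel L s₁ s₂
  count : ∀ t₀ k u v, 1 ≤ t₀ → t₀ < u → v ≤ T →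
    (#{t ∈ Icc u v | IsReplay σ t₀ (2 ^ k) t} : ℝ) ≤
      2 * ∑ t ∈ Icc u v, replayProb (t - t₀) k + Λ
  detect : ∀ t₀ s a t, 1 ≤ t₀ → t₀ ≤ s → s ≤ t → t ≤ T →
    (∀ τ, t₀ < τ → τ < t → (σ τ).episode = t₀) →
    (∀ τ ∈ Ioo s t, D s a τ ≠ 0 → ∀ m, IsReplay σ t₀ m τ → m < 2 ^ D s a τ) →
    ∑ τ ∈ Ioo s t, (if D s a τ ≠ 0 then replayProb (τ - t₀) (D s a τ) else 0) ≤ Λ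

/-- The hypotheses on the environment. -/
structure IsEnv (P : ℕ → Fin K → Fin K → ℝ) (astar : ℕ → Fin K) (T : ℕ) : Prop where
  pref : ∀ t ∈ Icc 1 T, IsPreferenceMatrix (P t)
  dom : ∀ t ∈ Icc 1 T, IsDominantArm (P t) (astar t)

/-- The gap between the dominant arm and arm `a`, in duels against the approximate winner of the
phase. -/
def gap (P : ℕ → Fin K → Fin K → ℝ) (astar α : ℕ → Fin K) (t : ℕ) (a : Fin K) : ℝ :=
  P t (astar t) (α t) - P t a (α t)

variable {P : ℕ → Fin K → Fin K → ℝ} {astar : ℕ → Fin K} {T : ℕ} {Z : Finset ℕ}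
  {z : ℕ → ℕ} {α : ℕ → Fin K} {C Λ : ℝ} {σ S : ℕ → MetaState K} {L : ℕ → RoundLog K}
  {D : ℕ → Fin K → ℕ → ℕ}

omit [NeZero K] in
lemma IsEnv.gap_mem (hE : IsEnv P astar T) {t : ℕ} (h1 : 1 ≤ t) (hT : t ≤ T) (a : Fin K) :
    0 ≤ gap P astar α t a ∧ gap P astar α t a ≤ 1 := by
  have ht := mem_Icc.2 ⟨h1, hT⟩
  have h2 := hE.dom t ht a (α t)
  obtain ⟨h3, h4, -⟩ := hE.pref t ht (astar t) (α t)
  obtain ⟨h5, h6, -⟩ := hE.pref t ht a (α t)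
  unfold gap
  constructor <;> linarith

omit [NeZero K] in
lemma IsEnv.sub_mem (hE : IsEnv P astar T) {t : ℕ} (h1 : 1 ≤ t) (hT : t ≤ T) (a b : Fin K) :
    0 ≤ P t (astar t) b - P t a b ∧ P t (astar t) b - P t a b ≤ 1 := by
  have ht := mem_Icc.2 ⟨h1, hT⟩
  have h2 := hE.dom t ht a b
  obtain ⟨h3, h4, -⟩ := hE.pref t ht (astar t) b
  obtain ⟨h5, h6, -⟩ := hE.pref t ht a b
  constructor <;> linarith

omit [NeZero K] in
lemma IsPhasing.sub_le (hZ : IsPhasing P astar T Z z α) {t : ℕ} (h1 : 1 ≤ t)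
    (hT : t ≤ T) (hz : z t < t) (b : Fin K) :
    P t (astar t) b - P t (α t) b ≤ cbrt (K : ℝ) ^ 2 * (1 / cbrt ((t : ℝ) - z t)) := by
  have hlt : (z t : ℝ) < t := by exact_mod_cast hz
  have h := (le_abs_self _).trans (hZ.gap t h1 hT hz b)
  rw [Real.div_rpow (by positivity) (by linarith), ← cbrt, ← cbrt, pow_two,
    cbrt_mul (by positivity) (by positivity)] at h
  rwa [pow_two, mul_one_div]

omit [NeZero K] in
/-- Regret of the approximate winner within its phase. -/
lemma IsPhasing.sum_sub_le (hZ : IsPhasing P astar T Z z α)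
    {x y : ℕ} (hx : 1 ≤ x) (hxy : x ≤ y) (hy : y ≤ T) (hz : z y ≤ x) {h : ℕ → ℝ}
    (h1 : ∀ t ∈ Icc x y, h t ≤ 1)
    (h2 : ∀ t ∈ Icc x y, z t < t → h t ≤ cbrt (K : ℝ) ^ 2 * (1 / cbrt ((t : ℝ) - z t))) :
    ∑ t ∈ Icc x y, h t ≤ 1 + 3 / 2 * (cbrt (K : ℝ) ^ 2 * cbrt ((y : ℝ) - x) ^ 2) := by
  obtain ⟨N, rfl⟩ := Nat.exists_eq_add_of_le hxy
  have e : Icc x (x + N) = insert x ((range N).image fun i => x + i + 1) := by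
    ext t
    simp only [mem_Icc, mem_insert, mem_image, mem_range]
    constructor
    · rintro ⟨h3, h4⟩
      rcases Nat.eq_or_lt_of_le h3 with rfl | h3
      · exact Or.inl rfl
      · exact Or.inr ⟨t - x - 1, by omega, by omega⟩
    · rintro (rfl | ⟨i, hi, rfl⟩) <;> omega
  have hinj : Set.InjOn (fun i => x + i + 1) (range N : Set ℕ) := fun i _ j _ hij => by
    dsimp only at hij; omega
  rw [e, sum_insert (by simp; omega), sum_image hinj]
  refine add_le_add (h1 x (by simp)) ?_
  have hc : ((x + N : ℕ) : ℝ) - x = N := by push_cast; ring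
  rw [hc]
  calc ∑ i ∈ range N, h (x + i + 1)
      ≤ ∑ i ∈ range N, cbrt (K : ℝ) ^ 2 * (1 / cbrt ((i : ℝ) + 1)) := by
        refine sum_le_sum fun i hi => ?_
        have hi' := mem_range.1 hi
        have hmem : x + i + 1 ∈ Icc x (x + N) := by simp; omega
        have hzt : z (x + i + 1) ≤ x := by
          have := hZ.const (x + N) (x + i + 1) (by omega) hy (by omega) (by omega)
          omega
        refine (h2 _ hmem (by omega)).trans ?_
        have h3 : (i : ℝ) + 1 ≤ ((x + i + 1 : ℕ) : ℝ) - z (x + i + 1) := by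
          have : (z (x + i + 1) : ℝ) ≤ x := by exact_mod_cast hzt
          push_cast; linarith
        have h4 : 0 < cbrt ((i : ℝ) + 1) := cbrt_pos (by positivity)
        have h5 := cbrt_le_cbrt (by positivity) h3
        gcongr
    _ ≤ _ := by
        rw [← mul_sum]
        have := sum_inv_cbrt_le N
        have h6 : 0 ≤ cbrt (K : ℝ) ^ 2 := by positivity
        nlinarith

lemma IsRun.rate_facts (hR : IsRun T C σ S L) {s : ℕ} (hs : 1 ≤ s) :
    0 < (L s).rate ∧ (L s).rate ≤ 1 := by
  rw [hR.rate s hs]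
  exact ⟨learningRate_pos _, learningRate_le_one _⟩

lemma IsRun.one_le_noiseLevel (hR : IsRun T C σ S L) {s₁ s₂ : ℕ} (h1 : 1 ≤ s₁)
    (h2 : s₁ ≤ s₂) : 1 ≤ noiseLevel L s₁ s₂ := by
  have h3 := hR.rate_facts h1
  have h4 := inv_rate_le_iSup L (s₁ := s₁) (s₂ := s₂) (s := s₁) (by simp [h2])
  have h5 : 1 ≤ ((L s₁).rate)⁻¹ := (one_le_inv₀ h3.1).2 h3.2
  have hK : (1 : ℝ) ≤ K := by exact_mod_cast Nat.one_le_iff_ne_zero.2 (NeZero.ne K)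
  have h6 := Real.sqrt_nonneg ((K : ℝ) ^ 2 * ∑ s ∈ Icc s₁ s₂, ((L s).rate)⁻¹)
  unfold noiseLevel
  have : 1 ≤ (K : ℝ) ^ 2 * ⨆ s : Set.Icc s₁ s₂, ((L s).rate)⁻¹ :=
    one_le_mul_of_one_le_of_one_le (one_le_pow₀ hK) (h5.trans h4)
  linarith

/-- The approximate winner of a phase is not evicted over rounds of that phase. -/
lemma not_evicted_winner (hE : IsEnv P astar T) (hZ : IsPhasing P astar T Z z α)
    (hR : IsRun T C σ S L) (hG : IsGood P T Λ σ L D) (hΛ : 0 ≤ Λ)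
    (hC : 3 * Λ + 3 ≤ C * Real.log T)
    {lo t y : ℕ} (hy : y ≤ T) (hy1 : 1 ≤ y) (hlo : z y ≤ lo) (ht : t ≤ y + 1) :
    ¬ Evicted T C L lo t (α y) := by
  rintro ⟨s₁, s₂, h1, h2, h3, a', c, hmem, hlt⟩
  have hz1 := hZ.one_le y hy1 hy
  have hs1 : 1 ≤ s₁ := by omega
  have hconc := hG.conc s₁ s₂ hs1 h2 (by omega) (α y) a' c hmem
  have hαs : ∀ s ∈ Icc s₁ s₂, α s = α y := by
    intro s hs
    have hs' := mem_Icc.1 hs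
    rw [hZ.winner s, hZ.winner y, hZ.const y s hy1 hy (by omega) (by omega)]
  have hsum : ∑ s ∈ Icc s₁ s₂, (P s a' c - P s (α y) c) ≤
      1 + 3 / 2 * (cbrt (K : ℝ) ^ 2 * cbrt ((s₂ : ℝ) - s₁) ^ 2) := by
    refine hZ.sum_sub_le hs1 h2 (by omega) ?_ (fun s hs => ?_) (fun s hs hzs => ?_)
    · rw [hZ.const y s₂ hy1 hy (by omega) (by omega)]; omega
    · have hs' := mem_Icc.1 hs
      have e1 := (hE.sub_mem (t := s) (by omega) (by omega) a' c).1
      have e2 := (hE.sub_mem (t := s) (by omega) (by omega) (α y) c).2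
      linarith
    · have hs' := mem_Icc.1 hs
      have e1 := (hE.sub_mem (t := s) (by omega) (by omega) a' c).1
      have e2 := hZ.sub_le (t := s) (by omega) (by omega) hzs c
      rw [hαs s hs] at e2
      linarith
  rw [sum_sub_distrib] at hconc
  have hF1 := noiseLevel_le_evictionThreshold L s₁ s₂
  have hF2 := hR.one_le_noiseLevel hs1 h2
  have hF3 : cbrt (K : ℝ) ^ 2 * cbrt ((s₂ : ℝ) - s₁) ^ 2 ≤ evictionThreshold L s₁ s₂ := by
    have : (s₁ : ℝ) ≤ s₂ := by exact_mod_cast h2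
    rw [evictionThreshold, rpow_two_thirds (by positivity), rpow_two_thirds (by linarith)]
    exact le_max_left _ _
  have h4 : 3 * Λ * noiseLevel L s₁ s₂ ≤ 3 * Λ * evictionThreshold L s₁ s₂ := by gcongr
  have h5 : (3 * Λ + 3) * evictionThreshold L s₁ s₂ ≤
      C * Real.log T * evictionThreshold L s₁ s₂ := by
    gcongr
    linarith
  nlinarith

/-- Two arms that remain candidates over some rounds, without one being evicted over these rounds,
have close scores over these rounds. -/
lemma sum_sub_le_of_not_evicted (hR : IsRun T C σ S L) (hG : IsGood P T Λ σ L D) (hΛ : 0 ≤ Λ)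
    {x y t : ℕ} {a a' : Fin K} (hx : 1 ≤ x) (hxy : x ≤ y) (hyt : y < t) (hy : y ≤ T)
    (ha : ∀ s ∈ Icc x y, a ∈ (σ s).cur.cand) (ha' : ∀ s ∈ Icc x y, a' ∈ (σ s).cur.cand)
    (hne : ¬ Evicted T C L x t a) (c : Fin K) :
    ∑ s ∈ Icc x y, (P s a' c - P s a c) ≤
      (C * Real.log T + 3 * Λ) * evictionThreshold L x y := by
  have hmem : ∀ s ∈ Icc x y, a ∈ (L s).cand ∧ a' ∈ (L s).cand := fun s hs => by
    rw [hR.cand s (by have := mem_Icc.1 hs; omega)]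
    exact ⟨ha s hs, ha' s hs⟩
  have h1 : ∑ s ∈ Icc x y, (bordaEstimate (L s) a' (Pi.single c 1)
        - bordaEstimate (L s) a (Pi.single c 1)) ≤ C * Real.log T * evictionThreshold L x y := by
    by_contra hlt
    exact hne ⟨x, y, le_rfl, hxy, hyt, a', c, hmem, not_le.1 hlt⟩
  have h2 := hG.conc x y hx hxy hy a' a c fun s hs => (hmem s hs).symm
  have h3 : 3 * Λ * noiseLevel L x y ≤ 3 * Λ * evictionThreshold L x y :=
    mul_le_mul_of_nonneg_left (noiseLevel_le_evictionThreshold L x y) (by positivity)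
  have h4 : ∑ s ∈ Icc x y, (bordaEstimate (L s) a (Pi.single c 1)
        - bordaEstimate (L s) a' (Pi.single c 1) - (P s a c - P s a' c)) =
      ∑ s ∈ Icc x y, (P s a' c - P s a c) - ∑ s ∈ Icc x y, (bordaEstimate (L s) a' (Pi.single c 1)
        - bordaEstimate (L s) a (Pi.single c 1)) := by
    rw [← sum_sub_distrib]
    exact sum_congr rfl fun s _ => by ring
  rw [h4] at h2
  linarith

end Good

/-! ### Segments of significant regret -/

section Segments

/-- The rounds from `s` on are cut into segments: a segment that started at round `u` ends at round
`t` if the sum of `f` over it exceeds `θ (t - u + 1)^{2/3}` (it is then called bad), or if a new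
phase starts at round `t + 1`. This is the start of the segment of round `s + k`. -/
def segStart (f : ℕ → ℝ) (θ : ℝ) (z : ℕ → ℕ) (s : ℕ) : ℕ → ℕ
  | 0 => s
  | k + 1 => open Classical in
    if θ * cbrt (((s + k : ℕ) : ℝ) - segStart f θ z s k + 1) ^ 2 <
        ∑ r ∈ Icc (segStart f θ z s k) (s + k), f r ∨ z (s + k + 1) = s + k + 1
    then s + k + 1 else segStart f θ z s k

/-- The segment of round `s + k` ends at that round, and is bad. -/
def IsBadEnd (f : ℕ → ℝ) (θ : ℝ) (z : ℕ → ℕ) (s k : ℕ) : Prop :=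
  θ * cbrt (((s + k : ℕ) : ℝ) - segStart f θ z s k + 1) ^ 2 <
    ∑ r ∈ Icc (segStart f θ z s k) (s + k), f r

/-- Round `τ` is in the first half of a bad segment, which ends at round `s + k ≤ T`. -/
def IsEarly (f : ℕ → ℝ) (θ : ℝ) (z : ℕ → ℕ) (T s τ k : ℕ) : Prop :=
  s + k ≤ T ∧ IsBadEnd f θ z s k ∧ segStart f θ z s k < τ ∧ τ ≤ s + k ∧
    2 * (τ - segStart f θ z s k) ≤ s + k - segStart f θ z s k + 1

open Classical in
/-- In the first half of a bad segment of length `ℓ` a replay of size at least `ℓ` is called for;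
this is the binary logarithm of that size, rounded up. -/
def replayNeed (f : ℕ → ℝ) (θ : ℝ) (z : ℕ → ℕ) (T s τ : ℕ) : ℕ :=
  if h : ∃ k, IsEarly f θ z T s τ k then
    Nat.clog 2 (s + h.choose - segStart f θ z s h.choose + 1) else 0

lemma cast_length {u v : ℕ} (h : u ≤ v) : (v : ℝ) - u + 1 = ((v - u + 1 : ℕ) : ℝ) := by
  rw [Nat.cast_add, Nat.cast_sub h]; simp

lemma Icc_eq_Ico_add_one (u v : ℕ) : Icc u v = Ico u (v + 1) := by
  ext
  simp only [mem_Icc, mem_Ico]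
  omega

variable {f : ℕ → ℝ} {θ : ℝ} {z : ℕ → ℕ} {T s : ℕ}

lemma segStart_succ_of_end {k : ℕ} (h : IsBadEnd f θ z s k ∨ z (s + k + 1) = s + k + 1) :
    segStart f θ z s (k + 1) = s + k + 1 := by
  rw [segStart]; exact if_pos h

lemma segStart_succ_of_not {k : ℕ} (h : ¬ (IsBadEnd f θ z s k ∨ z (s + k + 1) = s + k + 1)) :
    segStart f θ z s (k + 1) = segStart f θ z s k := by
  rw [segStart]; exact if_neg h

lemma segStart_mem (k : ℕ) : s ≤ segStart f θ z s k ∧ segStart f θ z s k ≤ s + k := by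
  induction k with
  | zero => simp [segStart]
  | succ k ih =>
    by_cases h : IsBadEnd f θ z s k ∨ z (s + k + 1) = s + k + 1
    · rw [segStart_succ_of_end h]; omega
    · rw [segStart_succ_of_not h]; omega

lemma segStart_mono {j k : ℕ} (h : j ≤ k) : segStart f θ z s j ≤ segStart f θ z s k := by
  induction k, h using Nat.le_induction with
  | base => exact le_rfl
  | succ k _ ih =>
    refine ih.trans ?_
    by_cases h : IsBadEnd f θ z s k ∨ z (s + k + 1) = s + k + 1
    · rw [segStart_succ_of_end h]; have := (segStart_mem (f := f) (θ := θ) (z := z) (s := s) k).2; omega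
    · rw [segStart_succ_of_not h]

/-- Within a segment, before its last round, the segment has not ended. -/
lemma not_end_of_segStart_le {j k : ℕ} (hjk : j < k) (h : segStart f θ z s k ≤ s + j) :
    segStart f θ z s j = segStart f θ z s k ∧ ¬ IsBadEnd f θ z s j := by
  induction k with
  | zero => omega
  | succ k ih =>
    by_cases hend : IsBadEnd f θ z s k ∨ z (s + k + 1) = s + k + 1
    · rw [segStart_succ_of_end hend] at h; omega
    · rw [segStart_succ_of_not hend] at h ⊢
      rcases Nat.lt_succ_iff_lt_or_eq.1 hjk with hjk | rfl
      · exact ih hjk h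
      · exact ⟨rfl, fun hb => hend (Or.inl hb)⟩

lemma IsEarly.unique {τ j k : ℕ} (hj : IsEarly f θ z T s τ j) (hk : IsEarly f θ z T s τ k) :
    j = k := by
  have key : ∀ {j k : ℕ}, IsEarly f θ z T s τ j → IsEarly f θ z T s τ k → ¬ j < k := by
    intro j k hj hk hjk
    have h1 := hk.2.2.1
    have h2 := hj.2.2.2.1
    exact (not_end_of_segStart_le hjk (by omega)).2 hj.2.1
  exact le_antisymm (not_lt.1 (key hk hj)) (not_lt.1 (key hj hk))

lemma IsEarly.replayNeed_eq {τ k : ℕ} (hk : IsEarly f θ z T s τ k) :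
    replayNeed f θ z T s τ = Nat.clog 2 (s + k - segStart f θ z s k + 1) := by
  have h : ∃ k, IsEarly f θ z T s τ k := ⟨k, hk⟩
  rw [replayNeed, dif_pos h, h.choose_spec.unique hk]

lemma exists_isEarly {τ : ℕ} (h : replayNeed f θ z T s τ ≠ 0) : ∃ k, IsEarly f θ z T s τ k := by
  by_contra hne
  exact h (by rw [replayNeed, dif_neg hne])

/-- A bad segment has more than one round, since a single round contributes at most one. -/
lemma IsBadEnd.lt (hθ : 1 ≤ θ) {k : ℕ} (hf : f (s + k) ≤ 1) (h : IsBadEnd f θ z s k) :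
    segStart f θ z s k < s + k := by
  by_contra hle
  have h1 := (segStart_mem (f := f) (θ := θ) (z := z) (s := s) k).2
  have h2 : segStart f θ z s k = s + k := by omega
  rw [IsBadEnd, h2] at h
  simp [cbrt_one] at h
  linarith

lemma replayNeed_le (τ : ℕ) (hs : 1 ≤ s) : replayNeed f θ z T s τ ≤ Nat.clog 2 T := by
  by_cases h : replayNeed f θ z T s τ = 0
  · omega
  · obtain ⟨k, hk⟩ := exists_isEarly h
    rw [hk.replayNeed_eq]
    have h1 := (segStart_mem (f := f) (θ := θ) (z := z) (s := s) k).1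
    have h2 := hk.1
    exact Nat.clog_mono_right 2 (by omega)

/-- The probability mass of the replays called for in a bad segment of length `ℓ`, at most `N` rounds
after the start of the episode, is at least of the order `(ℓ / N)^{2/3}`. -/
lemma le_sum_replayProb_of_isBadEnd {t₀ k N : ℕ} (hkT : s + k ≤ T) (hb : IsBadEnd f θ z s k)
    (hlt : segStart f θ z s k < s + k) (ht₀ : t₀ ≤ s) (hN : s + k - t₀ ≤ N) :
    cbrt (((s + k : ℕ) : ℝ) - segStart f θ z s k + 1) ^ 2 ≤
      6 * cbrt N ^ 2 * ∑ τ ∈ Icc (segStart f θ z s k + 1) (s + k),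
        (if replayNeed f θ z T s τ ≠ 0 then
          replayProb (τ - t₀) (replayNeed f θ z T s τ) else 0) := by
  set u := segStart f θ z s k with hu
  have hsu : s ≤ u := (segStart_mem k).1
  set ℓ := s + k - u + 1 with hℓ
  have hℓ2 : 2 ≤ ℓ := by omega
  have hℓr : ((s + k : ℕ) : ℝ) - u + 1 = ℓ := by
    rw [hℓ]; exact cast_length (by omega)
  rw [hℓr]
  have hℓ0 : (0 : ℝ) < ℓ := by exact_mod_cast (by omega : 0 < ℓ)
  have hN1 : 1 ≤ N := by omega
  have hcN : 0 < cbrt (N : ℝ) := cbrt_pos (by exact_mod_cast hN1)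
  have hcℓ : 0 < cbrt (ℓ : ℝ) := cbrt_pos hℓ0
  have hclog : 1 ≤ Nat.clog 2 ℓ := Nat.clog_pos (by norm_num) hℓ2
  have hpow : (2 : ℝ) ^ Nat.clog 2 ℓ ≤ 2 * ℓ := by
    have h1 : 2 ^ (Nat.clog 2 ℓ - 1) < ℓ := Nat.pow_pred_clog_lt_self (by norm_num) (by omega)
    have h2 : 2 ^ Nat.clog 2 ℓ = 2 * 2 ^ (Nat.clog 2 ℓ - 1) := by
      rw [← pow_succ']; congr 1; omega
    have h3 : 2 ^ Nat.clog 2 ℓ ≤ 2 * ℓ := by omega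
    exact_mod_cast h3
  have hcpow : cbrt ((2 : ℝ) ^ Nat.clog 2 ℓ) ≤ 2 * cbrt (ℓ : ℝ) := by
    refine cbrt_le_of_le_pow (by positivity) (by positivity) ?_
    rw [mul_pow, cbrt_pow_three hℓ0.le]
    linarith
  have hterm : ∀ τ ∈ Icc (u + 1) (u + ℓ / 2), 1 / (2 * cbrt (ℓ : ℝ) * cbrt (N : ℝ) ^ 2) ≤
      (if replayNeed f θ z T s τ ≠ 0 then
          replayProb (τ - t₀) (replayNeed f θ z T s τ) else 0) := by
    intro τ hτ
    have hτ' := mem_Icc.1 hτ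
    have hE : IsEarly f θ z T s τ k := ⟨hkT, hb, by omega, by omega, by omega⟩
    rw [hE.replayNeed_eq, ← hu, ← hℓ, if_pos (by omega), replayProb,
      rpow_neg_third (by positivity), rpow_neg_two_thirds (by positivity)]
    have hn1 : (0 : ℝ) < ((τ - t₀ : ℕ) : ℝ) := by exact_mod_cast (by omega : 0 < τ - t₀)
    have hn2 : ((τ - t₀ : ℕ) : ℝ) ≤ N := by exact_mod_cast (by omega : τ - t₀ ≤ N)
    have hc1 := cbrt_pos hn1
    have hc2 := cbrt_le_cbrt hn1.le hn2
    have hc3 : 0 < cbrt ((2 : ℝ) ^ Nat.clog 2 ℓ) := cbrt_pos (by positivity)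
    rw [one_div_mul_one_div]
    apply one_div_le_one_div_of_le (by positivity)
    gcongr
  have hnn : ∀ τ, 0 ≤ (if replayNeed f θ z T s τ ≠ 0 then
          replayProb (τ - t₀) (replayNeed f θ z T s τ) else 0) := fun τ => by
    split_ifs
    · exact replayProb_nonneg _ _
    · exact le_rfl
  have hsum : (ℓ : ℝ) / 3 * (1 / (2 * cbrt (ℓ : ℝ) * cbrt (N : ℝ) ^ 2)) ≤
      ∑ τ ∈ Icc (u + 1) (s + k), (if replayNeed f θ z T s τ ≠ 0 then
          replayProb (τ - t₀) (replayNeed f θ z T s τ) else 0) := by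
    refine le_trans ?_ (sum_le_sum_of_subset_of_nonneg (Icc_subset_Icc_right
      (by omega : u + ℓ / 2 ≤ s + k)) fun τ _ _ => hnn τ)
    refine le_trans ?_ (card_nsmul_le_sum _ _ _ hterm)
    rw [Nat.card_Icc, nsmul_eq_mul]
    have h1 : ℓ ≤ 3 * (u + ℓ / 2 + 1 - (u + 1)) := by omega
    have h2 : (ℓ : ℝ) ≤ 3 * ((u + ℓ / 2 + 1 - (u + 1) : ℕ) : ℝ) := by exact_mod_cast h1
    gcongr
    linarith
  have e : cbrt (ℓ : ℝ) ^ 2 =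
      6 * cbrt (N : ℝ) ^ 2 * ((ℓ : ℝ) / 3 * (1 / (2 * cbrt (ℓ : ℝ) * cbrt (N : ℝ) ^ 2))) := by
    have : (ℓ : ℝ) = cbrt (ℓ : ℝ) ^ 3 := (cbrt_pow_three hℓ0.le).symm
    field_simp
    linarith
  rw [e]
  gcongr

variable {K : ℕ} {P : ℕ → Fin K → Fin K → ℝ} {astar : ℕ → Fin K} {Z : Finset ℕ} {α : ℕ → Fin K}

lemma sum_Ico_le_of_segStart (hθ : 1 ≤ θ) {k : ℕ} :
    ∑ r ∈ Ico (segStart f θ z s k) (s + k), f r ≤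
      θ * cbrt (((s + k : ℕ) : ℝ) - segStart f θ z s k) ^ 2 := by
  cases k with
  | zero =>
    have : 0 ≤ θ * cbrt (((s + 0 : ℕ) : ℝ) - segStart f θ z s 0) ^ 2 := by positivity
    simpa [segStart] using this
  | succ k =>
    by_cases h : segStart f θ z s (k + 1) ≤ s + k
    · obtain ⟨h1, h2⟩ := not_end_of_segStart_le (Nat.lt_succ_self k) h
      rw [IsBadEnd, not_lt, h1] at h2
      rw [show s + (k + 1) = s + k + 1 by ring, ← Icc_eq_Ico_add_one]
      have e : ((s + k + 1 : ℕ) : ℝ) - segStart f θ z s (k + 1) =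
          ((s + k : ℕ) : ℝ) - segStart f θ z s (k + 1) + 1 := by push_cast; ring
      rw [e]
      exact h2
    · have : segStart f θ z s (k + 1) = s + (k + 1) := by
        have := (segStart_mem (f := f) (θ := θ) (z := z) (s := s) (k + 1)).2
        omega
      rw [this]
      simp [cbrt]

/-- The sum of `f` over an initial stretch of rounds is controlled by the lengths of the segments
that are not bad, and by the probability mass of the replays called for in the bad ones. -/
lemma sum_Ico_le_of_replayProb (hZ : IsPhasing P astar T Z z α) (hθ : 1 ≤ θ) {A B : ℝ}
    (hB : 0 ≤ B) (hAB : ∀ ℓ : ℕ, cbrt ℓ ^ 2 ≤ A * ℓ + B) (hA : 0 ≤ A)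
    (hs : 1 ≤ s) (hf : ∀ r, s ≤ r → r ≤ T → f r ≤ 1) {t₀ N k : ℕ} (ht₀ : t₀ ≤ s)
    (hk : s + k ≤ T) (hN : s + k - t₀ ≤ N) :
    ∑ r ∈ Ico s (segStart f θ z s k), f r ≤
      θ * (A * ((segStart f θ z s k : ℝ) - s) + B * changes Z s (segStart f θ z s k)) +
      12 * θ * cbrt N ^ 2 * ∑ τ ∈ Ioo s (segStart f θ z s k),
        (if replayNeed f θ z T s τ ≠ 0 then
          replayProb (τ - t₀) (replayNeed f θ z T s τ) else 0) := by
  have hnn : ∀ τ, 0 ≤ (if replayNeed f θ z T s τ ≠ 0 then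
          replayProb (τ - t₀) (replayNeed f θ z T s τ) else 0) := fun τ => by
    split_ifs
    · exact replayProb_nonneg _ _
    · exact le_rfl
  have hcN : 0 ≤ cbrt (N : ℝ) := cbrt_nonneg (by positivity)
  induction k with
  | zero => simp [segStart]; positivity
  | succ k ih =>
    have ih' := ih (by omega) (by omega)
    obtain ⟨hu1, hu2⟩ := segStart_mem (f := f) (θ := θ) (z := z) (s := s) k
    by_cases hend : IsBadEnd f θ z s k ∨ z (s + k + 1) = s + k + 1
    swap
    · rw [segStart_succ_of_not hend]; exact ih'
    rw [segStart_succ_of_end hend]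
    set u := segStart f θ z s k with hu
    set w : ℕ → ℝ := fun τ => (if replayNeed f θ z T s τ ≠ 0 then
          replayProb (τ - t₀) (replayNeed f θ z T s τ) else 0) with hw
    have hsplit : ∑ r ∈ Ico s (s + k + 1), f r =
        ∑ r ∈ Ico s u, f r + ∑ r ∈ Icc u (s + k), f r := by
      rw [Icc_eq_Ico_add_one,
        sum_Ico_consecutive _ hu1 (by omega)]
    have hwsplit : ∑ τ ∈ Ioo s u, w τ + ∑ τ ∈ Icc (u + 1) (s + k), w τ ≤
        ∑ τ ∈ Ioo s (s + k + 1), w τ := by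
      rw [← sum_union]
      · refine sum_le_sum_of_subset_of_nonneg (fun τ => ?_) fun τ _ _ => hnn τ
        simp only [mem_union, mem_Ioo, mem_Icc]
        omega
      · rw [disjoint_left]
        intro τ
        simp only [mem_Ioo, mem_Icc]
        omega
    have hur : (u : ℝ) ≤ ((s + k : ℕ) : ℝ) := by exact_mod_cast hu2
    set ℓ := s + k - u + 1 with hℓ
    have hℓr : ((s + k : ℕ) : ℝ) - u + 1 = ℓ := by
      rw [hℓ]; exact cast_length (by omega)
    have hℓ1 : (1 : ℝ) ≤ ℓ := by exact_mod_cast (by omega : 1 ≤ ℓ)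
    have hsumw0 : 0 ≤ ∑ τ ∈ Icc (u + 1) (s + k), w τ := sum_nonneg fun τ _ => hnn τ
    have hc1 : (0 : ℝ) ≤ 12 * θ * cbrt N ^ 2 := by positivity
    have hmul := mul_le_mul_of_nonneg_left hwsplit hc1
    have e1 : ((s + k + 1 : ℕ) : ℝ) - s = ((u : ℝ) - s) + ℓ := by
      rw [← hℓr]; push_cast; ring
    rw [hsplit, e1]
    by_cases hb : IsBadEnd f θ z s k
    · have hlt := hb.lt hθ (hf _ (by omega) (by omega))
      have h1 := le_sum_replayProb_of_isBadEnd (T := T) (by omega) hb hlt ht₀ (N := N) (by omega)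
      rw [← hu, hℓr] at h1
      have h2 := sum_Ico_le_of_segStart (f := f) (z := z) (s := s) hθ (k := k)
      rw [← hu] at h2
      have h3 : ∑ r ∈ Icc u (s + k), f r ≤ 2 * θ * cbrt ℓ ^ 2 := by
        have e2 : ∑ r ∈ Icc u (s + k), f r = ∑ r ∈ Ico u (s + k), f r + f (s + k) := by
          rw [Icc_eq_Ico_add_one, sum_Ico_succ_top hu2]
        have h4 := hf (s + k) (by omega) (by omega)
        have h5 : cbrt (((s + k : ℕ) : ℝ) - u) ≤ cbrt ℓ :=
          cbrt_le_cbrt (by linarith) (by linarith)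
        have h6 : 0 ≤ cbrt (((s + k : ℕ) : ℝ) - u) := cbrt_nonneg (by linarith)
        have h7 : cbrt (((s + k : ℕ) : ℝ) - u) ^ 2 ≤ cbrt (ℓ : ℝ) ^ 2 := by gcongr
        have h8 : 1 ≤ cbrt (ℓ : ℝ) ^ 2 := one_le_pow₀ (one_le_cbrt hℓ1)
        rw [e2]
        nlinarith
      have h9 : 2 * θ * cbrt (ℓ : ℝ) ^ 2 ≤ 12 * θ * cbrt N ^ 2 * ∑ τ ∈ Icc (u + 1) (s + k), w τ := by
        have := mul_le_mul_of_nonneg_left h1 (by linarith : 0 ≤ 2 * θ)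
        linarith
      have h10 : (changes Z s u : ℝ) ≤ changes Z s (s + k + 1) := by
        exact_mod_cast changes_mono le_rfl (by omega)
      have h11 : θ * (A * ((u : ℝ) - s) + B * changes Z s u) ≤
          θ * (A * ((u : ℝ) - s + ℓ) + B * changes Z s (s + k + 1)) := by
        gcongr
        linarith
      linarith
    · have hz := hend.resolve_left hb
      have h1 := not_lt.1 hb
      rw [← hu, hℓr] at h1
      have h2 : s + k + 1 ∈ Z := by
        have := hZ.mem (s + k + 1) (by omega) (by omega)
        rwa [hz] at this
      have h3 := changes_lt h2 (u := s) (v := s + k + 1) (by omega) le_rfl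
      have h4 : changes Z s u + 1 ≤ changes Z s (s + k + 1) :=
        le_trans (Nat.add_le_add_right (changes_mono le_rfl (by omega)) 1) h3
      have h5 : (changes Z s u : ℝ) + 1 ≤ changes Z s (s + k + 1) := by exact_mod_cast h4
      have h6 := hAB ℓ
      have h7 : θ * cbrt (ℓ : ℝ) ^ 2 ≤ θ * (A * ℓ + B) := by gcongr
      have h8 : θ * (A * ((u : ℝ) - s) + B * changes Z s u) + θ * (A * ℓ + B) ≤
          θ * (A * ((u : ℝ) - s + ℓ) + B * changes Z s (s + k + 1)) := by
        have : B * (changes Z s u + 1) ≤ B * changes Z s (s + k + 1) := by gcongr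
        have : A * ((u : ℝ) - s) + B * changes Z s u + (A * ℓ + B) ≤
          A * ((u : ℝ) - s + ℓ) + B * changes Z s (s + k + 1) := by linarith
        calc _ = θ * (A * ((u : ℝ) - s) + B * changes Z s u + (A * ℓ + B)) := by ring
          _ ≤ _ := by gcongr
      have h9 : 0 ≤ 12 * θ * cbrt N ^ 2 * ∑ τ ∈ Icc (u + 1) (s + k), w τ := by positivity
      linarith

end Segments

section Detection

variable {K : ℕ} [NeZero K]
variable {P : ℕ → Fin K → Fin K → ℝ} {astar : ℕ → Fin K} {T : ℕ} {Z : Finset ℕ}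
  {z : ℕ → ℕ} {α : ℕ → Fin K} {C Λ θ : ℝ} {σ S : ℕ → MetaState K} {L : ℕ → RoundLog K}
  {D : ℕ → Fin K → ℕ → ℕ}

omit [NeZero K] in
/-- A segment lies within one phase. -/
lemma IsPhasing.le_segStart (hZ : IsPhasing P astar T Z z α) {f : ℕ → ℝ} {θ : ℝ} {s k : ℕ}
    (hs : 1 ≤ s) (hk : s + k ≤ T) : z (s + k) ≤ segStart f θ z s k := by
  induction k with
  | zero => exact hZ.le s hs hk
  | succ k ih =>
    have h1 := hZ.le (s + k + 1) (by omega) hk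
    by_cases hend : IsBadEnd f θ z s k ∨ z (s + k + 1) = s + k + 1
    · rw [segStart_succ_of_end hend]; exact h1
    · rw [segStart_succ_of_not hend]
      have h2 : z (s + k + 1) ≤ s + k := by
        have : z (s + k + 1) ≠ s + k + 1 := fun h => hend (Or.inr h)
        omega
      have h3 := hZ.const (s + k + 1) (s + k) (by omega) hk h2 (by omega)
      have := ih (by omega)
      rw [h3] at this
      exact this

/-- A replay that starts in the first half of a bad segment of some arm, and is scheduled until its
end, gets that arm evicted: the learning rates of the replay are large enough for the regret of the
arm to exceed the eviction threshold, and the approximate winner of the phase is not lost. -/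
lemma evicted_of_isEarly (hE : IsEnv P astar T) (hZ : IsPhasing P astar T Z z α)
    (hR : IsRun T C σ S L) (hG : IsGood P T Λ σ L D) (hΛ : 0 ≤ Λ)
    (hC : 3 * Λ + 3 ≤ C * Real.log T) (hθ : 3 * (3 + 7 * (C * Real.log T + 3 * Λ)) ≤ θ)
    {a : Fin K} {s τ k : ℕ} (hs : 1 ≤ s)
    (h : IsEarly (fun t => gap P astar α t a) (θ * cbrt (K : ℝ) ^ 2) z T s τ k)
    (hτ : (σ τ).cur.first = τ) (he : (σ τ).episode = (σ (s + k)).episode)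
    (hdur : s + k - segStart (fun t => gap P astar α t a) (θ * cbrt (K : ℝ) ^ 2) z s k + 1 ≤
      (σ τ).cur.dur) : Evicted T C L τ (s + k + 1) a := by
  set f : ℕ → ℝ := fun t => gap P astar α t a with hf
  set κ := cbrt (K : ℝ) with hκ
  have hκ1 : 1 ≤ κ := one_le_cbrt_arms
  set u := segStart f (θ * κ ^ 2) z s k with hu
  set v := s + k with hv
  obtain ⟨hvT, hbad, huτ, hτv, hhalf⟩ := h
  rw [← hu] at huτ hhalf
  obtain ⟨hsu, huv⟩ := segStart_mem (f := f) (θ := θ * κ ^ 2) (z := z) (s := s) k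
  have hzu : z v ≤ u := hZ.le_segStart hs hvT
  have hv1 : 1 ≤ v := by omega
  have hne_w : ∀ r, τ ≤ r → r ≤ v → α v ∈ (σ r).cur.cand := by
    intro r h1 h2
    by_contra hne
    exact not_evicted_winner hE hZ hR hG hΛ hC hvT hv1 (by omega : z v ≤ τ) (by omega : r ≤ v + 1)
      (hR.evicted_of_replay (by omega) hvT hτ he (by omega) h1 h2 hne)
  by_contra hne
  have hne_a : ∀ r, τ ≤ r → r ≤ v → a ∈ (σ r).cur.cand := by
    intro r h1 h2
    by_contra hne'
    exact hne ((hR.evicted_of_replay (by omega) hvT hτ he (by omega) h1 h2 hne').mono' le_rfl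
      (by omega))
  have h1 := sum_sub_le_of_not_evicted hR hG hΛ (x := τ) (y := v) (by omega) hτv (Nat.lt_succ_self v)
    hvT (fun r hr => hne_a r (mem_Icc.1 hr).1 (mem_Icc.1 hr).2)
    (fun r hr => hne_w r (mem_Icc.1 hr).1 (mem_Icc.1 hr).2) hne (α v)
  have hαv : ∀ r ∈ Icc τ v, α r = α v := by
    intro r hr
    have hr' := mem_Icc.1 hr
    rw [hZ.winner r, hZ.winner v, hZ.const v r hv1 hvT (by omega) (by omega)]
  -- lengths
  set ℓ := v - u + 1 with hℓ
  have hℓr : (v : ℝ) - u + 1 = ℓ := by rw [hℓ]; exact cast_length huv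
  have hℓ1 : (1 : ℝ) ≤ ℓ := by exact_mod_cast (by omega : 1 ≤ ℓ)
  set x := cbrt (ℓ : ℝ) with hx
  have hx1 : 1 ≤ x := one_le_cbrt hℓ1
  have hx3 : x ^ 3 = ℓ := cbrt_pow_three (by positivity)
  have hκ3 : κ ^ 3 = K := cbrt_pow_three (by positivity)
  have hvτ : (v : ℝ) - τ + 1 ≤ ℓ := by
    have : (u : ℝ) < τ := by exact_mod_cast huτ
    linarith
  have hτvr : (τ : ℝ) ≤ v := by exact_mod_cast hτv
  -- the regret in the second half of the segment
  have hbad' : θ * κ ^ 2 * x ^ 2 < ∑ r ∈ Icc u v, f r := by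
    rw [IsBadEnd, ← hu, ← hv, hℓr] at hbad
    exact hbad
  have hpre : ∑ r ∈ Ico u τ, f r ≤ θ * κ ^ 2 * (2 / 3 * x ^ 2) := by
    have hθ0 : 0 ≤ θ := by
      have : 0 ≤ C * Real.log T + 3 * Λ := by linarith
      linarith
    obtain ⟨j, hj⟩ := Nat.exists_eq_add_of_le (by omega : s ≤ τ - 1)
    have h2 := (not_end_of_segStart_le (f := f) (θ := θ * κ ^ 2) (z := z) (s := s) (j := j)
      (k := k) (by omega) (by omega))
    have h3 := not_lt.1 h2.2
    rw [h2.1, ← hu, ← hj] at h3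
    have e1 : τ = τ - 1 + 1 := by omega
    rw [e1, ← Icc_eq_Ico_add_one]
    refine h3.trans ?_
    gcongr
    have e2 : ((τ - 1 : ℕ) : ℝ) - u + 1 = ((τ - u : ℕ) : ℝ) := by
      rw [Nat.cast_sub (by omega), Nat.cast_sub (by omega)]; push_cast; ring
    rw [e2]
    set y := cbrt ((τ - u : ℕ) : ℝ) with hy
    have hy0 : 0 ≤ y := cbrt_nonneg (by positivity)
    have hy3 : y ^ 3 = ((τ - u : ℕ) : ℝ) := cbrt_pow_three (by positivity)
    have h4 : 2 * y ^ 3 ≤ x ^ 3 := by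
      rw [hy3, hx3]
      exact_mod_cast hhalf
    have hcube : (y ^ 2) ^ 3 ≤ (2 / 3 * x ^ 2) ^ 3 := by
      have h5 : (2 * y ^ 3) ^ 2 ≤ (x ^ 3) ^ 2 := by gcongr
      have h6 : 0 ≤ (x ^ 3) ^ 2 := sq_nonneg _
      nlinarith
    exact le_of_pow_le_pow_left₀ (by norm_num) (by positivity) hcube
  have hpost : θ * κ ^ 2 * (1 / 3 * x ^ 2) < ∑ r ∈ Icc τ v, f r := by
    have : ∑ r ∈ Icc u v, f r = ∑ r ∈ Ico u τ, f r + ∑ r ∈ Icc τ v, f r := by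
      rw [Icc_eq_Ico_add_one, Icc_eq_Ico_add_one, sum_Ico_consecutive _ huτ.le (by omega)]
    linarith
  -- the regret of the approximate winner
  have hwin : ∑ r ∈ Icc τ v, (P r (astar r) (α v) - P r (α v) (α v)) ≤
      1 + 3 / 2 * (κ ^ 2 * cbrt ((v : ℝ) - τ) ^ 2) := by
    refine hZ.sum_sub_le (by omega) hτv hvT (hzu.trans huτ.le) (fun r hr => ?_) (fun r hr hzr => ?_)
    · have hr' := mem_Icc.1 hr
      exact (hE.sub_mem (by omega) (by omega) _ _).2
    · have hr' := mem_Icc.1 hr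
      have := hZ.sub_le (t := r) (by omega) (by omega) hzr (α v)
      rw [hαv r hr] at this
      exact this
  have hfsum : ∑ r ∈ Icc τ v, f r = ∑ r ∈ Icc τ v, (P r (astar r) (α v) - P r (α v) (α v)) +
      ∑ r ∈ Icc τ v, (P r (α v) (α v) - P r a (α v)) := by
    rw [← sum_add_distrib]
    refine sum_congr rfl fun r hr => ?_
    simp only [hf, gap, hαv r hr]
    ring
  have hcv : cbrt ((v : ℝ) - τ) ≤ x := cbrt_le_cbrt (by linarith) (by linarith)
  have hcv0 : 0 ≤ cbrt ((v : ℝ) - τ) := cbrt_nonneg (by linarith)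
  -- the eviction threshold
  have hκx : κ ^ 2 ≤ x := by
    have h5 : ∑ r ∈ Icc u v, f r ≤ ℓ := by
      calc ∑ r ∈ Icc u v, f r ≤ ∑ r ∈ Icc u v, (1 : ℝ) := sum_le_sum fun r hr => by
            have hr' := mem_Icc.1 hr
            exact (hE.gap_mem (by omega) (by omega) a).2
        _ = ℓ := by
            rw [sum_const, Nat.card_Icc, nsmul_eq_mul, mul_one]
            congr 1
            omega
    have hθ1 : 1 ≤ θ := by
      have : 0 ≤ C * Real.log T + 3 * Λ := by linarith
      linarith
    have h6 : κ ^ 2 * x ^ 2 ≤ x * x ^ 2 := by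
      have : κ ^ 2 * x ^ 2 ≤ θ * κ ^ 2 * x ^ 2 := by
        have : 0 ≤ κ ^ 2 * x ^ 2 := by positivity
        nlinarith
      calc κ ^ 2 * x ^ 2 ≤ ℓ := by linarith
        _ = x * x ^ 2 := by rw [← hx3]; ring
    exact le_of_mul_le_mul_right h6 (by positivity)
  have hF : evictionThreshold L τ v ≤ 7 * κ ^ 2 * x ^ 2 := by
    have hG' : ∀ r ∈ Icc τ v, ((L r).rate)⁻¹ ≤ 2 * x / κ ^ 2 := by
      intro r hr
      have hr' := mem_Icc.1 hr
      rw [hR.rate r (by omega)]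
      refine (inv_learningRate_le _).trans ?_
      have e1 := (hR.episode_mem (t := r) (by omega) (by omega)).2
      have e2 : (σ τ).episode = (σ r).episode := by
        have e3 := (hR.episode_mem (t := τ) (by omega) (by omega)).2
        rw [he]
        exact (hR.episode_eq hv1 hvT (by omega) hr'.2).symm
      have hfr := hR.le_first_of_replay (by omega) hr'.1 (by omega) hτ e2 (by omega)
      have e4 : cbrt ((r - (σ r).cur.first : ℕ) : ℝ) ≤ x :=
        cbrt_le_cbrt (by positivity) (by exact_mod_cast (by omega : r - (σ r).cur.first ≤ ℓ))
      have e5 : 1 ≤ x / κ ^ 2 := (one_le_div (by positivity)).2 hκx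
      have e6 : cbrt ((r - (σ r).cur.first : ℕ) : ℝ) / κ ^ 2 ≤ x / κ ^ 2 := by gcongr
      calc _ ≤ x / κ ^ 2 + x / κ ^ 2 := add_le_add e5 e6
        _ = _ := by ring
    have hA1 : κ ^ 2 / x ≤ 1 := (div_le_one (by positivity)).2 hκx
    have := evictionThreshold_le hτv (A := κ ^ 2 / x) (by positivity) hA1 hG' (by positivity)
    refine this.trans ?_
    calc 2 * (κ ^ 2 / x) * ((v : ℝ) - τ + 1) + 2 * (K : ℝ) ^ 2 * (2 * x / κ ^ 2) / (κ ^ 2 / x)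
          + (K : ℝ) ^ 2 / (κ ^ 2 / x) ^ 2
        ≤ 2 * (κ ^ 2 / x) * ℓ + 2 * (K : ℝ) ^ 2 * (2 * x / κ ^ 2) / (κ ^ 2 / x)
          + (K : ℝ) ^ 2 / (κ ^ 2 / x) ^ 2 := by gcongr
      _ = 7 * κ ^ 2 * x ^ 2 := by
          rw [← hx3, ← hκ3]
          field_simp
          ring
  have hCΛ : 0 ≤ C * Real.log T + 3 * Λ := by linarith
  have h7 : (C * Real.log T + 3 * Λ) * evictionThreshold L τ v ≤
      (C * Real.log T + 3 * Λ) * (7 * κ ^ 2 * x ^ 2) := by gcongr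
  have h8 : κ ^ 2 * cbrt ((v : ℝ) - τ) ^ 2 ≤ κ ^ 2 * x ^ 2 := by gcongr
  have h9 : 1 ≤ κ ^ 2 * x ^ 2 := one_le_mul_of_one_le_of_one_le (one_le_pow₀ hκ1) (one_le_pow₀ hx1)
  have h10 : 3 * (3 + 7 * (C * Real.log T + 3 * Λ)) * (κ ^ 2 * x ^ 2) ≤ θ * (κ ^ 2 * x ^ 2) := by
    gcongr
  linarith

/-- The schedule of replays that would reveal the regret of an arm. -/
def needFor (P : ℕ → Fin K → Fin K → ℝ) (astar α : ℕ → Fin K) (z : ℕ → ℕ) (T : ℕ) (θ : ℝ)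
    (s : ℕ) (a : Fin K) (τ : ℕ) : ℕ :=
  replayNeed (fun t => gap P astar α t a) (θ * cbrt (K : ℝ) ^ 2) z T s τ

/-- The regret, up to round `t`, of an arm that is not evicted over `[s, t)`: apart from what goes
unnoticed in each phase, it is limited because otherwise many replays would have revealed it. -/
lemma sum_gap_le_of_not_evicted (hE : IsEnv P astar T) (hZ : IsPhasing P astar T Z z α)
    (hR : IsRun T C σ S L) (hG : IsGood P T Λ σ L (needFor P astar α z T θ)) (hΛ : 0 ≤ Λ)
    (hC : 3 * Λ + 3 ≤ C * Real.log T) (hθ : 3 * (3 + 7 * (C * Real.log T + 3 * Λ)) ≤ θ)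
    {a : Fin K} {t₀ s t N : ℕ} (ht₀ : 1 ≤ t₀) (hs : t₀ ≤ s) (hst : s ≤ t) (htT : t ≤ T)
    (hN : t - t₀ ≤ N) (hep : ∀ τ, t₀ < τ → τ < t → (σ τ).episode = t₀)
    (hne : ¬ Evicted T C L s t a) {A B : ℝ} (hA : 0 ≤ A) (hB : 0 ≤ B)
    (hAB : ∀ ℓ : ℕ, cbrt ℓ ^ 2 ≤ A * ℓ + B) :
    ∑ r ∈ Ico s t, gap P astar α r a ≤
      θ * cbrt (K : ℝ) ^ 2 * (A * ((t : ℝ) - s) + B * (changes Z s t + 1)) +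
      12 * (θ * cbrt (K : ℝ) ^ 2) * cbrt N ^ 2 * Λ := by
  obtain ⟨k, rfl⟩ := Nat.exists_eq_add_of_le hst
  have hκ1 : 1 ≤ cbrt (K : ℝ) := one_le_cbrt_arms
  have hθ1 : 1 ≤ θ * cbrt (K : ℝ) ^ 2 := by
    have : 0 ≤ C * Real.log T + 3 * Λ := by linarith
    exact one_le_mul_of_one_le_of_one_le (by linarith) (one_le_pow₀ hκ1)
  set θ' := θ * cbrt (K : ℝ) ^ 2 with hθ'
  set f : ℕ → ℝ := fun t => gap P astar α t a with hf
  set u := segStart f θ' z s k with hu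
  obtain ⟨hsu, huk⟩ := segStart_mem (f := f) (θ := θ') (z := z) (s := s) k
  have hdet := hG.detect t₀ s a u ht₀ hs hsu (by omega)
    (fun τ h1 h2 => hep τ h1 (by omega)) (fun τ hτ hne0 m hm => by
      have hτ' := mem_Ioo.1 hτ
      by_contra hle
      obtain ⟨j, hj⟩ : ∃ j, IsEarly f θ' z T s τ j := exists_isEarly hne0
      have hD : needFor P astar α z T θ s a τ = Nat.clog 2 (s + j - segStart f θ' z s j + 1) :=
        hj.replayNeed_eq
      have hju : s + j < u := by
        by_contra hge
        have h3 := hj.2.2.1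
        rcases Nat.lt_or_ge j k with hjk | hjk
        · have := (not_end_of_segStart_le (f := f) (θ := θ') (z := z) (s := s) hjk (by omega)).1
          omega
        · have := segStart_mono (f := f) (θ := θ') (z := z) (s := s) hjk
          omega
      have h4 := hj.2.2.2.1
      refine hne ((evicted_of_isEarly hE hZ hR hG hΛ hC hθ (by omega) hj hm.2.1 ?_ ?_).mono'
        (by omega) (by omega))
      · rw [hep τ (by omega) (by omega), hep (s + j) (by omega) (by omega)]
      · rw [hm.2.2.2]
        rw [hD, not_lt] at hle
        exact (Nat.le_pow_clog (by norm_num) _).trans hle)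
  have hpre := sum_Ico_le_of_replayProb (f := f) hZ hθ1 hB hAB hA (by omega)
    (fun r h1 h2 => (hE.gap_mem (by omega) h2 a).2) hs htT hN
  have hpart := sum_Ico_le_of_segStart (f := f) (z := z) (s := s) hθ1 (k := k)
  rw [← hu] at hpre hpart
  have hsplit : ∑ r ∈ Ico s (s + k), f r = ∑ r ∈ Ico s u, f r + ∑ r ∈ Ico u (s + k), f r :=
    (sum_Ico_consecutive _ hsu huk).symm
  have hcast : ((s + k : ℕ) : ℝ) - u = ((s + k - u : ℕ) : ℝ) := (Nat.cast_sub huk).symm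
  have h1 := hAB (s + k - u)
  rw [← hcast] at h1
  have h2 : θ' * cbrt (((s + k : ℕ) : ℝ) - u) ^ 2 ≤ θ' * (A * (((s + k : ℕ) : ℝ) - u) + B) := by
    gcongr
  have h3 : (changes Z s u : ℝ) ≤ changes Z s (s + k) := by
    exact_mod_cast changes_mono le_rfl huk
  have h4 : θ' * (B * changes Z s u) ≤ θ' * (B * changes Z s (s + k)) := by gcongr
  have h5 : 12 * θ' * cbrt (N : ℝ) ^ 2 * ∑ τ ∈ Ioo s u, (if replayNeed f θ' z T s τ ≠ 0 then
          replayProb (τ - t₀) (replayNeed f θ' z T s τ) else 0) ≤ 12 * θ' * cbrt (N : ℝ) ^ 2 * Λ := by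
    gcongr
    exact hdet
  rw [hsplit]
  linarith

end Detection

/-! ### The rounds of one base instance -/

section Episode

variable {K : ℕ} [NeZero K]

/-- A run on which the random events behave as expected, and a number `H`, of logarithmic order, that
exceeds all logarithmic factors of the analysis. -/
structure IsTypical (P : ℕ → Fin K → Fin K → ℝ) (astar : ℕ → Fin K) (T : ℕ) (Z : Finset ℕ)
    (z : ℕ → ℕ) (α : ℕ → Fin K) (C Λ H : ℝ) (σ S : ℕ → MetaState K)
    (L : ℕ → RoundLog K) : Prop where
  env : IsEnv P astar T
  phasing : IsPhasing P astar T Z z α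
  run : IsRun T C σ S L
  good : IsGood P T Λ σ L (needFor P astar α z T H)
  nonneg : 0 ≤ Λ
  le_log : 3 * Λ + 3 ≤ C * Real.log T
  log_le : 3 * (3 + 7 * (C * Real.log T + 3 * Λ)) ≤ H
  twelve_le : 12 + Λ ≤ H
  clog_le : (Nat.clog 2 T : ℝ) ≤ H
  log_arms_le : 1 + Real.log K ≤ H

variable {P : ℕ → Fin K → Fin K → ℝ} {astar : ℕ → Fin K} {T : ℕ} {Z : Finset ℕ}
  {z : ℕ → ℕ} {α : ℕ → Fin K} {C Λ H : ℝ} {σ S : ℕ → MetaState K} {L : ℕ → RoundLog K}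

lemma sum_replayProb_le {t₀ u v k : ℕ} (hu : t₀ < u) (huv : u ≤ v) :
    ∑ t ∈ Icc u v, replayProb (t - t₀) k ≤
      3 * cbrt ((v - u + 1 : ℕ) : ℝ) / cbrt ((2 : ℝ) ^ k) := by
  obtain ⟨N, rfl⟩ := Nat.exists_eq_add_of_le huv
  have e : Icc u (u + N) = (range (N + 1)).image fun i => u + i := by
    ext t
    simp only [mem_Icc, mem_image, mem_range]
    constructor
    · rintro ⟨h1, h2⟩
      exact ⟨t - u, by omega, by omega⟩
    · rintro ⟨i, hi, rfl⟩
      omega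
  have hc : 0 < cbrt ((2 : ℝ) ^ k) := cbrt_pos (by positivity)
  rw [e, sum_image (fun i _ j _ hij => by omega), le_div_iff₀ hc, sum_mul,
    show u + N - u + 1 = N + 1 by omega]
  refine le_trans (sum_le_sum fun i _ => ?_) (sum_inv_cbrt_sq_le (N + 1))
  rw [replayProb, rpow_neg_third (by positivity), rpow_neg_two_thirds (by positivity)]
  have h1 : ((i : ℝ) + 1) ≤ ((u + i - t₀ : ℕ) : ℝ) := by
    exact_mod_cast (by omega : i + 1 ≤ u + i - t₀)
  have h2 : 0 < cbrt ((i : ℝ) + 1) := cbrt_pos (by positivity)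
  have h3 := cbrt_le_cbrt (by positivity) h1
  calc _ = 1 / cbrt ((u + i - t₀ : ℕ) : ℝ) ^ 2 := by field_simp
    _ ≤ _ := by gcongr

namespace IsTypical

variable (h : IsTypical P astar T Z z α C Λ H σ S L)
include h

lemma one_le : 1 ≤ H := by linarith [h.nonneg, h.twelve_le]

open Classical in
/-- Number of replays of a given size in an episode. -/
lemma card_replay_le {t₀ t₁ k : ℕ} (ht₀ : 1 ≤ t₀) (h01 : t₀ ≤ t₁) (hT : t₁ ≤ T) :
    (#{t ∈ Icc (t₀ + 1) t₁ | IsReplay σ t₀ (2 ^ k) t} : ℝ) ≤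
      6 * (cbrt ((t₁ - t₀ + 1 : ℕ) : ℝ) / cbrt ((2 : ℝ) ^ k)) + H := by
  have hc : 0 < cbrt ((2 : ℝ) ^ k) := cbrt_pos (by positivity)
  have hΛ := h.twelve_le
  have hc' : 0 ≤ cbrt ((t₁ - t₀ + 1 : ℕ) : ℝ) / cbrt ((2 : ℝ) ^ k) :=
    div_nonneg (cbrt_nonneg (by positivity)) hc.le
  rcases Nat.eq_or_lt_of_le h01 with rfl | hlt
  · rw [Icc_eq_empty (by omega), filter_empty, card_empty, Nat.cast_zero]
    linarith [h.one_le]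
  · have h1 := h.good.count t₀ k (t₀ + 1) t₁ ht₀ (Nat.lt_succ_self _) hT
    have h2 := sum_replayProb_le (t₀ := t₀) (k := k) (Nat.lt_succ_self t₀) (Nat.succ_le_of_lt hlt)
    have h3 : cbrt ((t₁ - (t₀ + 1) + 1 : ℕ) : ℝ) ≤ cbrt ((t₁ - t₀ + 1 : ℕ) : ℝ) :=
      cbrt_le_cbrt (by positivity) (by exact_mod_cast (by omega))
    have h4 : 3 * cbrt ((t₁ - (t₀ + 1) + 1 : ℕ) : ℝ) / cbrt ((2 : ℝ) ^ k) ≤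
        3 * cbrt ((t₁ - t₀ + 1 : ℕ) : ℝ) / cbrt ((2 : ℝ) ^ k) := by gcongr
    have h5 : 3 * cbrt ((t₁ - t₀ + 1 : ℕ) : ℝ) / cbrt ((2 : ℝ) ^ k) =
      3 * (cbrt ((t₁ - t₀ + 1 : ℕ) : ℝ) / cbrt ((2 : ℝ) ^ k)) := by ring
    simp only [Nat.succ_eq_add_one] at h2
    linarith

open Classical in
/-- Each round is within the scheduled rounds of few replays of a given size. -/
lemma card_replay_window_le {t₀ t k : ℕ} (ht₀ : 1 ≤ t₀) (hT : t ≤ T) :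
    (#{s ∈ Icc (t₀ + 1) t | IsReplay σ t₀ (2 ^ k) s ∧ t ≤ s + 2 ^ k} : ℝ) ≤ H := by
  have hΛ := h.twelve_le
  by_cases hlt : t₀ < t
  · have hc : 0 < cbrt ((2 : ℝ) ^ k) := cbrt_pos (by positivity)
    set u := max (t₀ + 1) (t - 2 ^ k) with hu
    have hut : u ≤ t := max_le hlt (Nat.sub_le _ _)
    have h0u : t₀ < u := lt_of_lt_of_le (Nat.lt_succ_self _) (le_max_left _ _)
    have h1 := h.good.count t₀ k u t ht₀ h0u hT
    have h2 := sum_replayProb_le (t₀ := t₀) (k := k) h0u hut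
    have hsub : #{s ∈ Icc (t₀ + 1) t | IsReplay σ t₀ (2 ^ k) s ∧ t ≤ s + 2 ^ k} ≤
        #{s ∈ Icc u t | IsReplay σ t₀ (2 ^ k) s} := by
      refine card_le_card fun s hs => ?_
      simp only [mem_filter, mem_Icc] at hs ⊢
      refine ⟨⟨max_le hs.1.1 (by omega), hs.1.2⟩, hs.2.1⟩
    have h3 : 3 * cbrt ((t - u + 1 : ℕ) : ℝ) / cbrt ((2 : ℝ) ^ k) ≤ 6 := by
      rw [div_le_iff₀ hc]
      have : cbrt ((t - u + 1 : ℕ) : ℝ) ≤ 2 * cbrt ((2 : ℝ) ^ k) := by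
        refine cbrt_le_of_le_pow (by positivity) (by positivity) ?_
        rw [mul_pow, cbrt_pow_three (by positivity)]
        have h5 : t - u + 1 ≤ 2 ^ k + 1 := by
          have : t - 2 ^ k ≤ u := le_max_right _ _
          omega
        have h6 : 1 ≤ 2 ^ k := Nat.one_le_two_pow
        have h7 : t - u + 1 ≤ 2 ^ 3 * 2 ^ k := by omega
        exact_mod_cast h7
      linarith
    have hsub' : (#{s ∈ Icc (t₀ + 1) t | IsReplay σ t₀ (2 ^ k) s ∧ t ≤ s + 2 ^ k} : ℝ) ≤
        #{s ∈ Icc u t | IsReplay σ t₀ (2 ^ k) s} := by exact_mod_cast hsub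
    linarith
  · rw [Icc_eq_empty (by omega)]
    simp
    linarith [h.one_le]

/-- Regret in the rounds in which the instance started at round `s` is running, if each of its
candidates `a` has regret at most `G` from round `s` on as long as it is a candidate. Ordering the
arms by the time of their eviction costs only a logarithmic factor. -/
lemma sum_avg_gap_le {s t₀ t₁ : ℕ} (ht₀ : 1 ≤ t₀) (h0s : t₀ ≤ s) (hT : t₁ ≤ T) {G : ℝ}
    (hG0 : 0 ≤ G)
    (hG : ∀ t ∈ Icc t₀ t₁, (σ t).cur.first = s → ∀ a ∈ (σ t).cur.cand,
      ∑ r ∈ Ico s t, gap P astar α r a ≤ G) :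
    ∑ t ∈ Icc t₀ t₁ with (σ t).cur.first = s,
      (1 / (#(σ t).cur.cand : ℝ)) * ∑ a ∈ (σ t).cur.cand, gap P astar α t a ≤ H * (1 + G) := by
  classical
  set R := {t ∈ Icc t₀ t₁ | (σ t).cur.first = s} with hR
  have hmemR : ∀ t ∈ R, t₀ ≤ t ∧ t ≤ t₁ ∧ (σ t).cur.first = s ∧ s ≤ t := by
    intro t ht
    simp only [hR, mem_filter, mem_Icc] at ht
    have := (h.run.first_mem (t := t) (by omega) (by omega)).2
    exact ⟨ht.1.1, ht.1.2, ht.2, by omega⟩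
  set A : ℕ → Finset (Fin K) := fun t => (σ t).cur.cand with hA
  have hanti : ∀ t ∈ R, ∀ t' ∈ R, t ≤ t' → A t' ⊆ A t := by
    intro t ht t' ht' htt a ha
    have h1 := hmemR t ht
    have h2 := hmemR t' ht'
    exact h.run.mem_cand_of_mem (by omega) (by omega) ha (by omega) htt
  set M : Fin K → ℕ := fun a => (R.filter fun t => a ∈ A t).sup id with hM
  set B : Finset (Fin K) := univ.filter fun a => (R.filter fun t => a ∈ A t).Nonempty with hB
  have hMmem : ∀ a ∈ B, M a ∈ R ∧ a ∈ A (M a) := by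
    intro a ha
    have hne : (R.filter fun t => a ∈ A t).Nonempty := (mem_filter.1 ha).2
    obtain ⟨t, ht, hte⟩ := exists_mem_eq_sup _ hne id
    have : M a = t := hte
    rw [this]
    exact mem_filter.1 ht
  have hMle : ∀ a t, t ∈ R → a ∈ A t → t ≤ M a := fun a t ht ha =>
    le_sup (f := id) (mem_filter.2 ⟨ht, ha⟩)
  have hgap0 : ∀ t ∈ R, ∀ a, 0 ≤ gap P astar α t a := fun t ht a => by
    have := hmemR t ht
    exact (h.env.gap_mem (by omega) (by omega) a).1
  calc ∑ t ∈ R, (1 / (#(A t) : ℝ)) * ∑ a ∈ A t, gap P astar α t a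
      = ∑ t ∈ R, ∑ a ∈ B, if a ∈ A t then (1 / (#(A t) : ℝ)) * gap P astar α t a else 0 := by
        refine sum_congr rfl fun t ht => ?_
        rw [mul_sum, ← sum_filter]
        refine sum_congr ?_ fun _ _ => rfl
        ext a
        simp only [mem_filter, hB, mem_univ, true_and]
        exact ⟨fun ha => ⟨⟨t, mem_filter.2 ⟨ht, ha⟩⟩, ha⟩, fun ha => ha.2⟩
    _ = ∑ a ∈ B, ∑ t ∈ R, if a ∈ A t then (1 / (#(A t) : ℝ)) * gap P astar α t a else 0 :=
        sum_comm
    _ ≤ ∑ a ∈ B, (1 / (#{a' ∈ B | M a ≤ M a'} : ℝ)) * (1 + G) := by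
        refine sum_le_sum fun a ha => ?_
        obtain ⟨hMR, hMA⟩ := hMmem a ha
        have hM' := hmemR _ hMR
        have hpos : (0 : ℝ) < #{a' ∈ B | M a ≤ M a'} := by
          exact_mod_cast card_pos.2 ⟨a, by simp [ha]⟩
        calc ∑ t ∈ R, (if a ∈ A t then (1 / (#(A t) : ℝ)) * gap P astar α t a else 0)
            ≤ ∑ t ∈ R, (if t ≤ M a then
                (1 / (#{a' ∈ B | M a ≤ M a'} : ℝ)) * gap P astar α t a else 0) := by
              refine sum_le_sum fun t ht => ?_
              have h0 := hgap0 t ht a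
              by_cases hat : a ∈ A t
              · rw [if_pos hat, if_pos (hMle a t ht hat)]
                refine mul_le_mul_of_nonneg_right (one_div_le_one_div_of_le hpos ?_) h0
                have : #{a' ∈ B | M a ≤ M a'} ≤ #(A t) := by
                  refine card_le_card fun a' ha' => ?_
                  obtain ⟨ha'B, hle⟩ := mem_filter.1 ha'
                  obtain ⟨h1, h2⟩ := hMmem a' ha'B
                  exact hanti t ht _ h1 ((hMle a t ht hat).trans hle) h2
                exact_mod_cast this
              · rw [if_neg hat]
                split_ifs
                · positivity
                · exact le_rfl
          _ = (1 / (#{a' ∈ B | M a ≤ M a'} : ℝ)) *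
                ∑ t ∈ R with t ≤ M a, gap P astar α t a := by
              rw [← sum_filter, mul_sum]
          _ ≤ _ := by
              refine mul_le_mul_of_nonneg_left ?_ (by positivity)
              calc ∑ t ∈ R with t ≤ M a, gap P astar α t a
                  ≤ ∑ t ∈ Icc s (M a), gap P astar α t a := by
                    refine sum_le_sum_of_subset_of_nonneg (fun t ht => ?_) fun t ht _ => ?_
                    · obtain ⟨h1, h2⟩ := mem_filter.1 ht
                      exact mem_Icc.2 ⟨(hmemR t h1).2.2.2, h2⟩
                    · have := mem_Icc.1 ht
                      exact (h.env.gap_mem (by omega) (by omega) a).1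
                _ = ∑ t ∈ Ico s (M a), gap P astar α t a + gap P astar α (M a) a := by
                    rw [Icc_eq_Ico_add_one, sum_Ico_succ_top hM'.2.2.2]
                _ ≤ G + 1 := by
                    refine add_le_add (hG _ (mem_Icc.2 ⟨hM'.1, hM'.2.1⟩) hM'.2.2.1 a hMA) ?_
                    exact (h.env.gap_mem (by omega) (by omega) a).2
                _ = 1 + G := add_comm _ _
    _ = (∑ a ∈ B, (1 / (#{a' ∈ B | M a ≤ M a'} : ℝ))) * (1 + G) := by rw [sum_mul]
    _ ≤ H * (1 + G) := by
        refine mul_le_mul_of_nonneg_right ?_ (by linarith)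
        refine (sum_one_div_card_le_log M B).trans (le_trans ?_ h.log_arms_le)
        have h1 : #B ≤ K := (card_le_univ B).trans_eq (by simp)
        rcases Nat.eq_zero_or_pos #B with h0 | h0
        · rw [h0]
          have : (1 : ℝ) ≤ K := by exact_mod_cast Nat.one_le_iff_ne_zero.2 (NeZero.ne K)
          have := Real.log_nonneg this
          simp; linarith
        · have : Real.log #B ≤ Real.log K :=
            Real.log_le_log (by exact_mod_cast h0) (by exact_mod_cast h1)
          linarith

/-- Exploration in the rounds in which the instance started at round `s` is running. -/
lemma sum_rate_le {s t₀ t₁ : ℕ} (ht₀ : 1 ≤ t₀) (h0s : t₀ ≤ s) (hT : t₁ ≤ T) :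
    ∑ t ∈ Icc t₀ t₁ with (σ t).cur.first = s, (L t).rate ≤
      3 * cbrt (K : ℝ) ^ 2 * cbrt ((min ((σ s).cur.dur + 1) (t₁ - t₀ + 1) : ℕ) : ℝ) ^ 2 := by
  refine le_trans ?_ (sum_learningRate_le (K := K) (min ((σ s).cur.dur + 1) (t₁ - t₀ + 1))
    (le_min (by omega) (by omega)))
  have hinj : Set.InjOn (fun t => t - s) ({t ∈ Icc t₀ t₁ | (σ t).cur.first = s} : Finset ℕ) := by
    intro t ht t' ht' htt
    simp only [coe_filter, mem_Icc, Set.mem_ofPred_eq] at ht ht'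
    have h1 := (h.run.first_mem (t := t) (by omega) (by omega)).2
    have h2 := (h.run.first_mem (t := t') (by omega) (by omega)).2
    dsimp only at htt
    omega
  calc ∑ t ∈ Icc t₀ t₁ with (σ t).cur.first = s, (L t).rate
      = ∑ t ∈ Icc t₀ t₁ with (σ t).cur.first = s, learningRate K (t - s) := by
        refine sum_congr rfl fun t ht => ?_
        simp only [mem_filter, mem_Icc] at ht
        rw [h.run.rate t (by omega), ht.2]
    _ = ∑ n ∈ ({t ∈ Icc t₀ t₁ | (σ t).cur.first = s}).image fun t => t - s,
          learningRate K n := by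
        rw [sum_image hinj]
    _ ≤ _ := by
        refine sum_le_sum_of_subset_of_nonneg (fun n hn => ?_) fun n _ _ => (learningRate_pos n).le
        obtain ⟨t, ht, rfl⟩ := mem_image.1 hn
        simp only [mem_filter, mem_Icc] at ht
        have h1 := h.run.le_first_add_dur (t := t) (by omega) (by omega)
        have h2 := (h.run.first_first (t := t) (by omega) (by omega)).2
        rw [ht.2] at h1 h2
        rw [mem_range, lt_min_iff]
        omega

end IsTypical

end Episode

/-! ### The regret of one episode -/

section EpisodeRegret

variable {K : ℕ} [NeZero K]

/-- The rounds `t₀, …, t₁` are the first rounds of the episode that begins at round `t₀`, possibly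
all of them, and they number at least `K ^ 2`. -/
structure IsSpan (K T : ℕ) (σ : ℕ → MetaState K) (t₀ t₁ : ℕ) : Prop where
  one_le : 1 ≤ t₀
  le : t₀ ≤ t₁
  le_horizon : t₁ ≤ T
  episode : (σ t₁).episode = t₀
  long : K ^ 2 ≤ t₁ - t₀ + 1

/-- Cube root of the number of rounds. -/
def lengthRoot (t₀ t₁ : ℕ) : ℝ := cbrt ((t₁ - t₀ + 1 : ℕ) : ℝ)

/-- Cube root of the number of phases that meet the rounds `t₀, …, t₁`. -/
def phaseRoot (Z : Finset ℕ) (t₀ t₁ : ℕ) : ℝ := cbrt ((changes Z t₀ t₁ + 1 : ℕ) : ℝ)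

lemma lengthRoot_pow_three (t₀ t₁ : ℕ) : lengthRoot t₀ t₁ ^ 3 = ((t₁ - t₀ + 1 : ℕ) : ℝ) :=
  cbrt_pow_three (by positivity)

lemma phaseRoot_pow_three (Z : Finset ℕ) (t₀ t₁ : ℕ) :
    phaseRoot Z t₀ t₁ ^ 3 = ((changes Z t₀ t₁ + 1 : ℕ) : ℝ) := cbrt_pow_three (by positivity)

lemma one_le_phaseRoot (Z : Finset ℕ) (t₀ t₁ : ℕ) : 1 ≤ phaseRoot Z t₀ t₁ :=
  one_le_cbrt (by exact_mod_cast (by omega : 1 ≤ changes Z t₀ t₁ + 1))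

lemma one_le_lengthRoot (t₀ t₁ : ℕ) : 1 ≤ lengthRoot t₀ t₁ :=
  one_le_cbrt (by exact_mod_cast (by omega : 1 ≤ t₁ - t₀ + 1))

lemma phaseRoot_le_lengthRoot (Z : Finset ℕ) (t₀ t₁ : ℕ) :
    phaseRoot Z t₀ t₁ ≤ lengthRoot t₀ t₁ := by
  refine cbrt_le_cbrt (by positivity) ?_
  have : changes Z t₀ t₁ ≤ #(Ioc t₀ t₁) := card_le_card fun w hw => by
    simp only [mem_filter] at hw
    exact mem_Ioc.2 hw.2
  rw [Nat.card_Ioc] at this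
  exact_mod_cast (by omega : changes Z t₀ t₁ + 1 ≤ t₁ - t₀ + 1)

lemma one_le_cbrt_two_pow (k : ℕ) : 1 ≤ cbrt ((2 : ℝ) ^ k) :=
  one_le_cbrt (one_le_pow₀ (by norm_num))

variable {P : ℕ → Fin K → Fin K → ℝ} {astar : ℕ → Fin K} {T : ℕ} {Z : Finset ℕ}
  {z : ℕ → ℕ} {α : ℕ → Fin K} {C Λ H : ℝ} {σ S : ℕ → MetaState K} {L : ℕ → RoundLog K}
  {t₀ t₁ : ℕ}

omit [NeZero K] in
lemma IsSpan.cbrt_arms_sq_le (hs : IsSpan K T σ t₀ t₁) : cbrt (K : ℝ) ^ 2 ≤ lengthRoot t₀ t₁ := by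
  refine le_of_pow_le_pow_left₀ (n := 3) (by norm_num)
    (zero_le_one.trans (one_le_lengthRoot _ _)) ?_
  rw [← pow_mul, mul_comm, pow_mul, cbrt_pow_three (by positivity), lengthRoot_pow_three]
  exact_mod_cast hs.long

namespace IsTypical

variable (h : IsTypical P astar T Z z α C Λ H σ S L) (hs : IsSpan K T σ t₀ t₁)
include h hs

lemma episode_of_mem {t : ℕ} (ht₀ : t₀ ≤ t) (ht₁ : t ≤ t₁) : (σ t).episode = t₀ := by
  have h1 := hs.one_le
  rw [← hs.episode] at ht₀ ⊢
  exact h.run.episode_eq (by have := hs.le; omega) hs.le_horizon ht₀ ht₁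

/-- Regret of an arm that is not evicted over at most `w` rounds. -/
lemma sum_gap_le {a : Fin K} {s t w : ℕ} (h0s : t₀ ≤ s) (hst : s ≤ t) (ht : t ≤ t₁) (hw : 1 ≤ w)
    (hstw : t - s ≤ w) (hne : ¬ Evicted T C L s t a) :
    ∑ r ∈ Ico s t, gap P astar α r a ≤ 12 * H ^ 2 * cbrt (K : ℝ) ^ 2 *
      (lengthRoot t₀ t₁ ^ 2 + phaseRoot Z t₀ t₁ * cbrt (w : ℝ) ^ 2) := by
  have hH := h.one_le
  have hΛ := h.nonneg
  have hHΛ := h.twelve_le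
  have h1 := hs.one_le
  have h2 := hs.le_horizon
  set y := phaseRoot Z t₀ t₁ with hy
  set x := cbrt (w : ℝ) with hx
  set κ := cbrt (K : ℝ)
  have hy1 : 1 ≤ y := one_le_phaseRoot _ _ _
  have hx1 : 1 ≤ x := one_le_cbrt (by exact_mod_cast hw)
  have hx3 : x ^ 3 = w := cbrt_pow_three (by positivity)
  have hA : 0 < y / x := by positivity
  have hAB : ∀ ℓ : ℕ, cbrt ℓ ^ 2 ≤ y / x * ℓ + 1 / (y / x) ^ 2 := fun ℓ => by
    have := sq_le_mul_cube_add (w := cbrt (ℓ : ℝ)) (cbrt_nonneg (by positivity)) hA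
    rwa [cbrt_pow_three (by positivity)] at this
  have key := sum_gap_le_of_not_evicted h.env h.phasing h.run h.good h.nonneg h.le_log h.log_le
    hs.one_le h0s hst (by omega) (N := t₁ - t₀ + 1) (by omega)
    (fun τ h3 h4 => h.episode_of_mem hs h3.le (by omega)) hne hA.le (by positivity) hAB
  refine key.trans ?_
  have e1 : y / x * ((t : ℝ) - s) ≤ y * x ^ 2 := by
    have : (t : ℝ) - s ≤ x ^ 3 := by
      rw [hx3, ← Nat.cast_sub hst]
      exact_mod_cast hstw
    calc y / x * ((t : ℝ) - s) ≤ y / x * x ^ 3 := by gcongr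
      _ = y * x ^ 2 := by field_simp
  have e2 : 1 / (y / x) ^ 2 * ((changes Z s t : ℝ) + 1) ≤ y * x ^ 2 := by
    have : (changes Z s t : ℝ) + 1 ≤ y ^ 3 := by
      rw [hy, phaseRoot_pow_three]
      exact_mod_cast Nat.succ_le_succ (changes_mono h0s ht)
    calc 1 / (y / x) ^ 2 * ((changes Z s t : ℝ) + 1) ≤ 1 / (y / x) ^ 2 * y ^ 3 := by gcongr
      _ = y * x ^ 2 := by field_simp
  have e3 : H * Λ ≤ H ^ 2 := by nlinarith
  have e4 : H ≤ H ^ 2 := by nlinarith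
  have e5 : 0 ≤ κ ^ 2 * (y * x ^ 2) := by positivity
  have e6 : 0 ≤ κ ^ 2 * lengthRoot t₀ t₁ ^ 2 := by positivity
  change H * κ ^ 2 * (y / x * ((t : ℝ) - s) + 1 / (y / x) ^ 2 * ((changes Z s t : ℝ) + 1)) +
    12 * (H * κ ^ 2) * lengthRoot t₀ t₁ ^ 2 * Λ ≤ _
  calc H * κ ^ 2 * (y / x * ((t : ℝ) - s) + 1 / (y / x) ^ 2 * ((changes Z s t : ℝ) + 1)) +
        12 * (H * κ ^ 2) * lengthRoot t₀ t₁ ^ 2 * Λ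
      ≤ H * κ ^ 2 * (y * x ^ 2 + y * x ^ 2) + 12 * (H * κ ^ 2) * lengthRoot t₀ t₁ ^ 2 * Λ := by
        gcongr
    _ = 2 * (H * (κ ^ 2 * (y * x ^ 2))) + 12 * (H * Λ * (κ ^ 2 * lengthRoot t₀ t₁ ^ 2)) := by ring
    _ ≤ 2 * (H ^ 2 * (κ ^ 2 * (y * x ^ 2))) + 12 * (H ^ 2 * (κ ^ 2 * lengthRoot t₀ t₁ ^ 2)) := by
        gcongr
    _ ≤ 12 * (H ^ 2 * (κ ^ 2 * (y * x ^ 2))) + 12 * (H ^ 2 * (κ ^ 2 * lengthRoot t₀ t₁ ^ 2)) := by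
        gcongr
        norm_num
    _ = _ := by ring

lemma isReplay_first {t : ℕ} (ht₀ : t₀ ≤ t) (ht₁ : t ≤ t₁) (hne : (σ t).cur.first ≠ t₀) :
    ∃ k ∈ Icc 1 (Nat.clog 2 T), IsReplay σ t₀ (2 ^ k) (σ t).cur.first := by
  have h1 := hs.one_le
  have h2 := hs.le_horizon
  have h3 := h.run.first_mem (t := t) (by omega) (by omega)
  rw [h.episode_of_mem hs ht₀ ht₁] at h3
  have h4 := (h.run.first_first (t := t) (by omega) (by omega)).1
  have h5 := h.episode_of_mem hs h3.1 (by omega)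
  obtain ⟨k, hk, hkT, hd⟩ := (h.run.inv (t := (σ t).cur.first) (by omega) (by omega)).replay h4
    (by omega)
  exact ⟨k, mem_Icc.2 ⟨hk, hkT⟩, by omega, h4, h5, hd⟩

/-- A remaining candidate arm of the episode has small regret over all of its rounds. -/
lemma exists_survivor : ∃ a ∈ (σ t₁).glob, ∑ r ∈ Icc t₀ t₁, gap P astar α r a ≤
    32 * H ^ 2 * cbrt (K : ℝ) ^ 2 * (phaseRoot Z t₀ t₁ * lengthRoot t₀ t₁ ^ 2) := by
  classical
  have hH := h.one_le
  have h1 := hs.one_le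
  have h2 := hs.le_horizon
  have h3 := hs.le
  have hκ : 1 ≤ cbrt (K : ℝ) := one_le_cbrt_arms
  have hI := h.run.inv (t := t₁) (by omega) h2
  obtain ⟨a, ha⟩ := hI.nonempty
  obtain ⟨t', h4, h5, h6, h7⟩ := hI.glob_kept
  rw [hs.episode] at h4 h6
  refine ⟨a, ha, ?_⟩
  set y := phaseRoot Z t₀ t₁
  set l := lengthRoot t₀ t₁ with hl
  set κ := cbrt (K : ℝ)
  have hy1 : 1 ≤ y := one_le_phaseRoot _ _ _
  have hl1 : 1 ≤ l := one_le_lengthRoot _ _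
  have hgap : ∀ r ∈ Icc t₀ t₁, 0 ≤ gap P astar α r a ∧ gap P astar α r a ≤ 1 := fun r hr => by
    have := mem_Icc.1 hr
    exact h.env.gap_mem (by omega) (by omega) a
  have e1 := h.sum_gap_le hs (a := a) (s := t₀) (t := t') (w := t₁ - t₀ + 1) le_rfl h4 h5
    (by omega) (by omega) (h6 a ha)
  change _ ≤ 12 * H ^ 2 * κ ^ 2 * (l ^ 2 + y * l ^ 2) at e1
  -- only starts of replays separate the last examination of the global candidates from now
  have e2 : (#(Ioc t' t₁) : ℝ) ≤ 7 * H ^ 2 * l := by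
    have hsub : Ioc t' t₁ ⊆ (Icc 1 (Nat.clog 2 T)).biUnion fun k =>
        {t ∈ Icc (t₀ + 1) t₁ | IsReplay σ t₀ (2 ^ k) t} := by
      intro r hr
      have hr' := mem_Ioc.1 hr
      have hf := h7 r hr'.1 hr'.2
      obtain ⟨k, hk, hrep⟩ := h.isReplay_first hs (t := r) (by omega) hr'.2 (by omega)
      rw [hf] at hrep
      exact mem_biUnion.2 ⟨k, hk, mem_filter.2 ⟨mem_Icc.2 ⟨by omega, hr'.2⟩, hrep⟩⟩
    calc (#(Ioc t' t₁) : ℝ)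
        ≤ ∑ k ∈ Icc 1 (Nat.clog 2 T), (#{t ∈ Icc (t₀ + 1) t₁ | IsReplay σ t₀ (2 ^ k) t} : ℝ) := by
          exact_mod_cast (card_le_card hsub).trans card_biUnion_le
      _ ≤ ∑ k ∈ Icc 1 (Nat.clog 2 T), (6 * l + H) := by
          refine sum_le_sum fun k _ => (h.card_replay_le h1 h3 h2).trans ?_
          have := div_le_self (zero_le_one.trans hl1) (one_le_cbrt_two_pow k)
          rw [hl, lengthRoot] at this ⊢
          linarith
      _ = Nat.clog 2 T * (6 * l + H) := by simp [mul_add]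
      _ ≤ H * (6 * l + H) := by
          have := h.clog_le
          gcongr
      _ ≤ H * (6 * (H * l) + H * l) := by
          have e3 : l ≤ H * l := le_mul_of_one_le_left (by positivity) hH
          have e4 : H ≤ H * l := le_mul_of_one_le_right (by positivity) hl1
          gcongr
      _ = 7 * H ^ 2 * l := by ring
  have e3 : ∑ r ∈ Icc t₀ t₁, gap P astar α r a =
      ∑ r ∈ Ico t₀ t', gap P astar α r a + gap P astar α t' a +
        ∑ r ∈ Ioc t' t₁, gap P astar α r a := by
    rw [← sum_Ico_succ_top h4, Icc_eq_Ico_add_one,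
      ← sum_Ico_consecutive _ (by omega : t₀ ≤ t' + 1) (by omega : t' + 1 ≤ t₁ + 1)]
    congr 2
    ext r
    simp only [mem_Ico, mem_Ioc]
    omega
  have e4 : ∑ r ∈ Ioc t' t₁, gap P astar α r a ≤ #(Ioc t' t₁) := by
    calc _ ≤ ∑ r ∈ Ioc t' t₁, (1 : ℝ) := sum_le_sum fun r hr => by
          have := mem_Ioc.1 hr
          exact (hgap r (mem_Icc.2 ⟨by omega, by omega⟩)).2
      _ = _ := by simp
  have e5 := (hgap t' (mem_Icc.2 ⟨h4, h5⟩)).2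
  have hl2 : l ≤ y * l ^ 2 := by nlinarith
  have hl3 : l ^ 2 ≤ y * l ^ 2 := by nlinarith [sq_nonneg l]
  have hH2 : 1 ≤ H ^ 2 := one_le_pow₀ hH
  have hκ2 : 1 ≤ κ ^ 2 := one_le_pow₀ hκ
  have hHκ : H ^ 2 ≤ H ^ 2 * κ ^ 2 := by nlinarith
  have e6 : H ^ 2 * l ≤ H ^ 2 * κ ^ 2 * (y * l ^ 2) := by gcongr
  have e7 : 1 ≤ H ^ 2 * κ ^ 2 * (y * l ^ 2) :=
    one_le_mul_of_one_le_of_one_le (by linarith) (by linarith)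
  have e8 : 12 * H ^ 2 * κ ^ 2 * (l ^ 2 + y * l ^ 2) ≤
      12 * H ^ 2 * κ ^ 2 * (y * l ^ 2 + y * l ^ 2) := by gcongr
  rw [e3]
  linarith

/-- While a short replay is running, its candidates do not fall far behind an arm that remains a
candidate throughout the episode. -/
lemma sum_gap_le_survivor {s t k : ℕ} {a b : Fin K} (hb : b ∈ (σ t₁).glob) (h0s : t₀ ≤ s)
    (hst : s < t) (ht : t ≤ t₁) (hf : (σ t).cur.first = s) (htk : t ≤ s + 2 ^ k)
    (ha : a ∈ (σ t).cur.cand)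
    (hk : phaseRoot Z t₀ t₁ * cbrt ((2 : ℝ) ^ k) ≤ lengthRoot t₀ t₁) :
    ∑ r ∈ Ico s t, gap P astar α r a ≤ ∑ r ∈ Ico s t, gap P astar α r b +
      H * (cbrt (K : ℝ) ^ 2 * lengthRoot t₀ t₁ * phaseRoot Z t₀ t₁ * cbrt ((2 : ℝ) ^ k)) := by
  have hH := h.one_le
  have h1 := hs.one_le
  have h2 := hs.le_horizon
  have hκ : 1 ≤ cbrt (K : ℝ) := one_le_cbrt_arms
  have hκl := hs.cbrt_arms_sq_le
  set y := phaseRoot Z t₀ t₁ with hy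
  set l := lengthRoot t₀ t₁ with hl
  set κ := cbrt (K : ℝ)
  set μ := cbrt ((2 : ℝ) ^ k) with hμ
  have hy1 : 1 ≤ y := one_le_phaseRoot _ _ _
  have hl1 : 1 ≤ l := one_le_lengthRoot _ _
  have hμ1 : 1 ≤ μ := one_le_cbrt_two_pow k
  have hμ3 : μ ^ 3 = 2 ^ k := cbrt_pow_three (by positivity)
  have hκ3 : κ ^ 3 = K := cbrt_pow_three (by positivity)
  have hlen : ((t - 1 : ℕ) : ℝ) - s + 1 ≤ μ ^ 3 := by
    rw [hμ3]
    have : t - 1 + 1 ≤ s + 2 ^ k := by omega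
    have : ((t - 1 : ℕ) : ℝ) + 1 ≤ s + 2 ^ k := by exact_mod_cast this
    linarith
  suffices hsuf : ∑ r ∈ Icc s (t - 1), (gap P astar α r a - gap P astar α r b) ≤
      H * (κ ^ 2 * l * y * μ) by
    rw [sum_sub_distrib, Icc_eq_Ico_add_one, show t - 1 + 1 = t by omega] at hsuf
    linarith
  have hgap : ∀ r ∈ Icc s (t - 1), ∀ c, 0 ≤ gap P astar α r c ∧ gap P astar α r c ≤ 1 :=
    fun r hr c => by
      have := mem_Icc.1 hr
      exact h.env.gap_mem (by omega) (by omega) c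
  set A := κ ^ 2 * l * y / μ ^ 2 with hA
  have hA0 : 0 < A := by positivity
  have hAμ : A * μ ^ 3 = κ ^ 2 * l * y * μ := by rw [hA]; field_simp
  rcases lt_or_ge 1 A with hA1 | hA1
  · calc ∑ r ∈ Icc s (t - 1), (gap P astar α r a - gap P astar α r b)
        ≤ ∑ r ∈ Icc s (t - 1), (1 : ℝ) := sum_le_sum fun r hr => by
          have := hgap r hr a
          have := hgap r hr b
          linarith
      _ = ((t - 1 : ℕ) : ℝ) - s + 1 := by
          rw [sum_const, Nat.card_Icc, nsmul_eq_mul, mul_one, Nat.cast_sub (by omega)]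
          push_cast; ring
      _ ≤ 1 * μ ^ 3 := by rwa [one_mul]
      _ ≤ A * μ ^ 3 := by gcongr
      _ ≤ H * (A * μ ^ 3) := le_mul_of_one_le_left (by positivity) hH
      _ = _ := by rw [hAμ]
  · set c := C * Real.log T + 3 * Λ with hc
    have hc0 : 0 ≤ c := by linarith [h.le_log, h.nonneg]
    have hcH : 21 * c ≤ H := by linarith [h.log_le]
    set G := 1 + μ / κ ^ 2 with hG
    have key := h.phasing.sum_le (f := fun r => gap P astar α r a - gap P astar α r b)
      (A := c * (2 * A)) (B := c * (2 * (K : ℝ) ^ 2 * G / A + (K : ℝ) ^ 2 / A ^ 2))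
      (by positivity) (u := s) (v := t - 1) (by omega) (by omega) (by omega)
      (fun u v hsu huv hvt hzv => by
        have hαv : ∀ r ∈ Icc u v, α r = α v := by
          intro r hr
          have hr' := mem_Icc.1 hr
          rw [h.phasing.winner r, h.phasing.winner v,
            h.phasing.const v r (by omega) (by omega) (by omega) (by omega)]
        have hca : ∀ r ∈ Icc u v, a ∈ (σ r).cur.cand := fun r hr => by
          have hr' := mem_Icc.1 hr
          exact h.run.mem_cand_of_mem (t := t) (by omega) (by omega) ha (by omega) (by omega)
        have hcb : ∀ r ∈ Icc u v, b ∈ (σ r).cur.cand := fun r hr => by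
          have hr' := mem_Icc.1 hr
          exact h.run.glob_subset (t := t₁) (by omega) h2 (by rw [hs.episode]; omega)
            (by omega) hb
        have hne : ¬ Evicted T C L u t a := fun hev =>
          h.run.not_evicted (t := t) (by omega) (by omega) ha (hev.mono' (by omega) le_rfl)
        have h3 := sum_sub_le_of_not_evicted h.run h.good h.nonneg (x := u) (y := v) (t := t)
          (by omega) huv (by omega) (by omega) hca hcb hne (α v)
        have h4 : ∑ r ∈ Icc u v, (gap P astar α r a - gap P astar α r b) =
            ∑ r ∈ Icc u v, (P r b (α v) - P r a (α v)) := sum_congr rfl fun r hr => by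
          rw [gap, gap, hαv r hr]; ring
        have hrate : ∀ r ∈ Icc u v, ((L r).rate)⁻¹ ≤ G := fun r hr => by
          have hr' := mem_Icc.1 hr
          rw [h.run.rate r (by omega)]
          refine (inv_learningRate_le _).trans ?_
          have h5 := (h.run.first_le_first (t := t) (r := r) (by omega) (by omega) (by omega)
            (by omega)).1
          have h6 : cbrt ((r - (σ r).cur.first : ℕ) : ℝ) ≤ μ :=
            cbrt_le_cbrt (by positivity)
              (by exact_mod_cast (by omega : r - (σ r).cur.first ≤ 2 ^ k))
          rw [hG]
          gcongr
        have h7 := evictionThreshold_le huv hA0 hA1 hrate (by positivity)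
        rw [h4]
        refine h3.trans ((mul_le_mul_of_nonneg_left h7 hc0).trans_eq ?_)
        rw [hc]; ring)
    refine key.trans ?_
    have hch : (changes Z s (t - 1) : ℝ) + 1 ≤ y ^ 3 := by
      rw [hy, phaseRoot_pow_three]
      exact_mod_cast Nat.succ_le_succ (changes_mono h0s (by omega))
    have hyμ : 0 < y * μ := by positivity
    set X := κ ^ 2 * l * y * μ with hX
    have b1 : 2 * κ ^ 4 * (y * μ) ^ 2 / l ≤ 2 * X := by
      rw [div_le_iff₀ (by positivity)]
      have : κ ^ 2 * (y * μ) ≤ l * l := by gcongr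
      calc 2 * κ ^ 4 * (y * μ) ^ 2 = 2 * (κ ^ 2 * (y * μ)) * (κ ^ 2 * (y * μ)) := by ring
        _ ≤ 2 * (l * l) * (κ ^ 2 * (y * μ)) := by gcongr
        _ = 2 * X * l := by rw [hX]; ring
    have b2 : 2 * κ ^ 2 * μ * (y * μ) ^ 2 / l ≤ 2 * X := by
      rw [div_le_iff₀ (by positivity)]
      have hμl : μ ≤ l := le_trans (by nlinarith) hk
      calc 2 * κ ^ 2 * μ * (y * μ) ^ 2 = 2 * κ ^ 2 * μ * (y * μ) * (y * μ) := by ring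
        _ ≤ 2 * κ ^ 2 * l * (y * μ) * l := by gcongr
        _ = 2 * X * l := by rw [hX]; ring
    have b3 : κ ^ 2 * μ ^ 4 * y / l ^ 2 ≤ X := by
      rw [div_le_iff₀ (by positivity)]
      have hμl : μ ≤ l := le_trans (by nlinarith) hk
      calc κ ^ 2 * μ ^ 4 * y = κ ^ 2 * y * μ * (μ * μ * μ) := by ring
        _ ≤ κ ^ 2 * y * μ * (l * l * l) := by gcongr
        _ = X * l ^ 2 := by rw [hX]; ring
    have hX0 : 0 ≤ X := by positivity
    calc c * (2 * A) * (((t - 1 : ℕ) : ℝ) - s + 1) +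
          c * (2 * (K : ℝ) ^ 2 * G / A + (K : ℝ) ^ 2 / A ^ 2) * ((changes Z s (t - 1) : ℝ) + 1)
        ≤ c * (2 * A) * μ ^ 3 +
          c * (2 * (K : ℝ) ^ 2 * G / A + (K : ℝ) ^ 2 / A ^ 2) * y ^ 3 := by gcongr
      _ = c * (2 * (A * μ ^ 3) + (2 * κ ^ 4 * (y * μ) ^ 2 / l + 2 * κ ^ 2 * μ * (y * μ) ^ 2 / l
          + κ ^ 2 * μ ^ 4 * y / l ^ 2)) := by
          rw [← hκ3, hG, hA]
          field_simp
      _ ≤ c * (2 * X + (2 * X + 2 * X + X)) := by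
          rw [hAμ]
          gcongr
      _ = 7 * c * X := by ring
      _ ≤ H * X := by
          gcongr
          linarith

end IsTypical

end EpisodeRegret

section EpisodeCost

variable {K : ℕ} [NeZero K]

/-- Cost of a round: the exploration rate, and the average regret of the candidate arms. -/
def roundCost (P : ℕ → Fin K → Fin K → ℝ) (astar α : ℕ → Fin K) (σ : ℕ → MetaState K)
    (L : ℕ → RoundLog K) (t : ℕ) : ℝ :=
  (L t).rate + (1 / (#(σ t).cur.cand : ℝ)) * ∑ a ∈ (σ t).cur.cand, gap P astar α t a

variable {P : ℕ → Fin K → Fin K → ℝ} {astar : ℕ → Fin K} {T : ℕ} {Z : Finset ℕ}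
  {z : ℕ → ℕ} {α : ℕ → Fin K} {C Λ H : ℝ} {σ S : ℕ → MetaState K} {L : ℕ → RoundLog K}
  {t₀ t₁ : ℕ}

namespace IsTypical

variable (h : IsTypical P astar T Z z α C Λ H σ S L)
include h

lemma roundCost_mem {t : ℕ} (h1 : 1 ≤ t) (hT : t ≤ T) :
    0 ≤ roundCost P astar α σ L t ∧ roundCost P astar α σ L t ≤ 2 := by
  have h2 := h.run.rate_facts h1
  have h3 : (0 : ℝ) < #(σ t).cur.cand := by exact_mod_cast card_pos.2 (h.run.cand_nonempty h1 hT)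
  have h4 : ∑ a ∈ (σ t).cur.cand, gap P astar α t a ≤ #(σ t).cur.cand := by
    calc _ ≤ ∑ a ∈ (σ t).cur.cand, (1 : ℝ) := sum_le_sum fun a _ => (h.env.gap_mem h1 hT a).2
      _ = _ := by simp
  have h5 : 0 ≤ ∑ a ∈ (σ t).cur.cand, gap P astar α t a :=
    sum_nonneg fun a _ => (h.env.gap_mem h1 hT a).1
  have h6 : (1 / (#(σ t).cur.cand : ℝ)) * ∑ a ∈ (σ t).cur.cand, gap P astar α t a ≤ 1 := by
    rw [one_div_mul_eq_div, div_le_one h3]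
    exact h4
  have h7 : 0 ≤ (1 / (#(σ t).cur.cand : ℝ)) * ∑ a ∈ (σ t).cur.cand, gap P astar α t a := by
    positivity
  unfold roundCost
  constructor <;> linarith

variable (hs : IsSpan K T σ t₀ t₁)
include hs

lemma sum_roundCost_base_le {s d : ℕ} (h0s : t₀ ≤ s) {G : ℝ} (hG0 : 0 ≤ G)
    (hG : ∀ t ∈ Icc t₀ t₁, (σ t).cur.first = s → s < t → ∀ a ∈ (σ t).cur.cand,
      ∑ r ∈ Ico s t, gap P astar α r a ≤ G)
    (hd : min ((σ s).cur.dur + 1) (t₁ - t₀ + 1) = d) :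
    ∑ t ∈ Icc t₀ t₁ with (σ t).cur.first = s, roundCost P astar α σ L t ≤
      H * (1 + G) + 3 * cbrt (K : ℝ) ^ 2 * cbrt (d : ℝ) ^ 2 := by
  have h1 := hs.one_le
  have h2 := hs.le_horizon
  unfold roundCost
  rw [sum_add_distrib, add_comm]
  refine add_le_add (h.sum_avg_gap_le hs.one_le h0s hs.le_horizon hG0 fun t ht hf a ha => ?_) ?_
  · have ht' := mem_Icc.1 ht
    have := (h.run.first_mem (t := t) (by omega) (by omega)).2
    rcases Nat.eq_or_lt_of_le (hf ▸ this) with rfl | hlt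
    · simpa using hG0
    · exact hG t ht hf hlt a ha
  · rw [← hd]
    exact h.sum_rate_le hs.one_le h0s hs.le_horizon

/-- Cost of the main instance of an episode. -/
lemma sum_roundCost_main_le :
    ∑ t ∈ Icc t₀ t₁ with (σ t).cur.first = t₀, roundCost P astar α σ L t ≤
      28 * H ^ 3 * (cbrt (K : ℝ) ^ 2 * phaseRoot Z t₀ t₁ * lengthRoot t₀ t₁ ^ 2) := by
  have hH := h.one_le
  have h1 := hs.one_le
  have h2 := hs.le_horizon
  have h3 := hs.le
  have hκ : 1 ≤ cbrt (K : ℝ) := one_le_cbrt_arms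
  have hy1 : 1 ≤ phaseRoot Z t₀ t₁ := one_le_phaseRoot _ _ _
  have hl1 : 1 ≤ lengthRoot t₀ t₁ := one_le_lengthRoot _ _
  have hmain := h.run.main_facts (t := t₁) (by omega) h2
  rw [hs.episode] at hmain
  have key := h.sum_roundCost_base_le hs (s := t₀) (d := t₁ - t₀ + 1) le_rfl
    (G := 12 * H ^ 2 * cbrt (K : ℝ) ^ 2 *
      (lengthRoot t₀ t₁ ^ 2 + phaseRoot Z t₀ t₁ * lengthRoot t₀ t₁ ^ 2)) (by positivity)
    (fun t ht hf hlt a ha => by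
      have ht' := mem_Icc.1 ht
      have := h.run.not_evicted (t := t) (by omega) (by omega) ha
      rw [hf] at this
      exact h.sum_gap_le hs le_rfl hlt.le ht'.2 (by omega) (by omega) this)
    (by rw [hmain.2.1]; omega)
  change _ ≤ _ + 3 * cbrt (K : ℝ) ^ 2 * lengthRoot t₀ t₁ ^ 2 at key
  refine key.trans ?_
  set y := phaseRoot Z t₀ t₁
  set l := lengthRoot t₀ t₁
  set κ := cbrt (K : ℝ)
  set X := κ ^ 2 * y * l ^ 2 with hX
  have e1 : κ ^ 2 * l ^ 2 ≤ X := by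
    rw [hX]
    exact mul_le_mul_of_nonneg_right (le_mul_of_one_le_right (by positivity) hy1) (by positivity)
  have e2 : 1 ≤ κ ^ 2 * l ^ 2 :=
    one_le_mul_of_one_le_of_one_le (one_le_pow₀ hκ) (one_le_pow₀ hl1)
  have hX1 : 1 ≤ X := e2.trans e1
  have e3 : H ≤ H ^ 3 := le_self_pow₀ hH (by norm_num)
  have e4 : (1 : ℝ) ≤ H ^ 3 := one_le_pow₀ hH
  calc H * (1 + 12 * H ^ 2 * κ ^ 2 * (l ^ 2 + y * l ^ 2)) + 3 * κ ^ 2 * l ^ 2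
      = H * 1 + 12 * H ^ 3 * (κ ^ 2 * l ^ 2 + X) + 3 * 1 * (κ ^ 2 * l ^ 2) := by rw [hX]; ring
    _ ≤ H ^ 3 * X + 12 * H ^ 3 * (X + X) + 3 * H ^ 3 * X := by gcongr
    _ = _ := by ring

open Classical in
lemma mul_card_replay_le {k : ℕ} :
    (#{s ∈ Icc (t₀ + 1) t₁ | IsReplay σ t₀ (2 ^ k) s} : ℝ) * cbrt ((2 : ℝ) ^ k) ≤
      6 * lengthRoot t₀ t₁ + H * cbrt ((2 : ℝ) ^ k) := by
  have h1 := h.card_replay_le (k := k) hs.one_le hs.le hs.le_horizon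
  have hμ : 0 < cbrt ((2 : ℝ) ^ k) := cbrt_pos (by positivity)
  refine (mul_le_mul_of_nonneg_right h1 hμ.le).trans_eq ?_
  rw [lengthRoot]
  field_simp

open Classical in
/-- Cost of the short replays. -/
lemma sum_roundCost_short_le {k : ℕ}
    (hk : phaseRoot Z t₀ t₁ * cbrt ((2 : ℝ) ^ k) ≤ lengthRoot t₀ t₁) :
    ∑ s ∈ Icc (t₀ + 1) t₁ with IsReplay σ t₀ (2 ^ k) s,
      ∑ t ∈ Icc t₀ t₁ with (σ t).cur.first = s, roundCost P astar α σ L t ≤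
      130 * H ^ 4 * (cbrt (K : ℝ) ^ 2 * phaseRoot Z t₀ t₁ * lengthRoot t₀ t₁ ^ 2) := by
  have hH := h.one_le
  have h1 := hs.one_le
  have h2 := hs.le_horizon
  have h3 := hs.le
  have hκ : 1 ≤ cbrt (K : ℝ) := one_le_cbrt_arms
  have hcard := h.mul_card_replay_le hs (k := k)
  obtain ⟨b, hb, hbsum⟩ := h.exists_survivor hs
  set y := phaseRoot Z t₀ t₁ with hy
  set l := lengthRoot t₀ t₁ with hl
  set κ := cbrt (K : ℝ)
  set μ := cbrt ((2 : ℝ) ^ k) with hμ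
  have hy1 : 1 ≤ y := one_le_phaseRoot _ _ _
  have hl1 : 1 ≤ l := one_le_lengthRoot _ _
  have hμ1 : 1 ≤ μ := one_le_cbrt_two_pow k
  set R := {s ∈ Icc (t₀ + 1) t₁ | IsReplay σ t₀ (2 ^ k) s} with hR
  set g : ℕ → ℝ := fun r => gap P astar α r b with hg
  have hg0 : ∀ r ∈ Icc t₀ t₁, 0 ≤ g r := fun r hr => by
    have := mem_Icc.1 hr
    exact (h.env.gap_mem (by omega) (by omega) b).1
  have hone : ∀ s ∈ R, ∑ t ∈ Icc t₀ t₁ with (σ t).cur.first = s, roundCost P astar α σ L t ≤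
      H * (1 + (∑ r ∈ Icc t₀ t₁ with s ≤ r ∧ r ≤ s + 2 ^ k, g r + H * (κ ^ 2 * l * y * μ))) +
        3 * κ ^ 2 * (2 * μ) ^ 2 := by
    intro s hsR
    obtain ⟨hs', hrep⟩ := mem_filter.1 hsR
    have hs'' := mem_Icc.1 hs'
    have hG0 : 0 ≤ ∑ r ∈ Icc t₀ t₁ with s ≤ r ∧ r ≤ s + 2 ^ k, g r :=
      sum_nonneg fun r hr => hg0 r (mem_filter.1 hr).1
    refine (h.sum_roundCost_base_le hs (by omega) (add_nonneg hG0
      (by positivity : 0 ≤ H * (κ ^ 2 * l * y * μ))) (fun t ht hf hlt a ha => ?_) rfl).trans ?_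
    · have ht' := mem_Icc.1 ht
      have h4 := h.run.le_first_add_dur (t := t) (by omega) (by omega)
      have h5 := (h.run.first_first (t := t) (by omega) (by omega)).2
      rw [hf] at h4 h5
      rw [← h5, hrep.2.2.2] at h4
      refine (h.sum_gap_le_survivor hs hb (by omega) hlt ht'.2 hf h4 ha hk).trans ?_
      refine add_le_add (sum_le_sum_of_subset_of_nonneg (fun r hr => ?_) fun r hr _ =>
        hg0 r (mem_filter.1 hr).1) le_rfl
      have hr' := mem_Ico.1 hr
      exact mem_filter.2 ⟨mem_Icc.2 ⟨by omega, by omega⟩, by omega, by omega⟩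
    · rw [hrep.2.2.2]
      have h6 : cbrt ((min (2 ^ k + 1) (t₁ - t₀ + 1) : ℕ) : ℝ) ≤ 2 * μ := by
        refine cbrt_le_of_le_pow (by positivity) (by positivity) ?_
        rw [mul_pow, hμ, cbrt_pow_three (by positivity)]
        have h7 : 1 ≤ 2 ^ k := Nat.one_le_two_pow
        have h8 : min (2 ^ k + 1) (t₁ - t₀ + 1) ≤ 2 ^ 3 * 2 ^ k := by omega
        exact_mod_cast h8
      have h9 : 0 ≤ cbrt ((min (2 ^ k + 1) (t₁ - t₀ + 1) : ℕ) : ℝ) := cbrt_nonneg (by positivity)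
      gcongr
  have hdouble : ∑ s ∈ R, ∑ r ∈ Icc t₀ t₁ with s ≤ r ∧ r ≤ s + 2 ^ k, g r ≤
      H * (32 * H ^ 2 * κ ^ 2 * (y * l ^ 2)) := by
    calc ∑ s ∈ R, ∑ r ∈ Icc t₀ t₁ with s ≤ r ∧ r ≤ s + 2 ^ k, g r
        = ∑ r ∈ Icc t₀ t₁, ∑ s ∈ R, if s ≤ r ∧ r ≤ s + 2 ^ k then g r else 0 := by
          rw [sum_comm]
          exact sum_congr rfl fun s _ => by rw [sum_filter]
      _ = ∑ r ∈ Icc t₀ t₁, (#{s ∈ R | s ≤ r ∧ r ≤ s + 2 ^ k} : ℝ) * g r :=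
          sum_congr rfl fun r _ => by rw [← sum_filter, sum_const, nsmul_eq_mul]
      _ ≤ ∑ r ∈ Icc t₀ t₁, H * g r := by
          refine sum_le_sum fun r hr => mul_le_mul_of_nonneg_right ?_ (hg0 r hr)
          refine le_trans ?_ (h.card_replay_window_le (k := k) (t := r) hs.one_le
            ((mem_Icc.1 hr).2.trans h2))
          have : #{s ∈ R | s ≤ r ∧ r ≤ s + 2 ^ k} ≤
              #{s ∈ Icc (t₀ + 1) r | IsReplay σ t₀ (2 ^ k) s ∧ r ≤ s + 2 ^ k} := by
            refine card_le_card fun s hs => ?_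
            simp only [hR, mem_filter, mem_Icc] at hs ⊢
            exact ⟨⟨hs.1.1.1, hs.2.1⟩, hs.1.2, hs.2.2⟩
          exact_mod_cast this
      _ ≤ _ := by
          rw [← mul_sum]
          gcongr
  refine (sum_le_sum hone).trans ?_
  set N : ℝ := (#R : ℝ) with hN
  have hN0 : 0 ≤ N := by positivity
  set X := κ ^ 2 * y * l ^ 2 with hX
  have hκ2 : 1 ≤ κ ^ 2 := one_le_pow₀ hκ
  have hl2 : l ≤ l ^ 2 := le_self_pow₀ hl1 (by norm_num)
  have hκy : 1 ≤ κ ^ 2 * y := one_le_mul_of_one_le_of_one_le hκ2 hy1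
  have hlX : l ≤ X := hl2.trans (le_mul_of_one_le_left (by positivity) hκy)
  have hμl : μ ≤ l := le_trans (le_mul_of_one_le_left (by positivity) hy1) hk
  have hNμ : N * μ ≤ 7 * H * l := by
    have h4 : H * μ ≤ H * l := by gcongr
    have h5 : l ≤ H * l := le_mul_of_one_le_left (by positivity) hH
    linarith
  have hN1 : N ≤ 7 * H * l := le_trans (le_mul_of_one_le_right hN0 hμ1) hNμ
  have p1 : H ^ 2 ≤ H ^ 4 := pow_le_pow_right₀ hH (by norm_num)
  have p2 : H ^ 3 ≤ H ^ 4 := pow_le_pow_right₀ hH (by norm_num)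
  have p3 : H ≤ H ^ 4 := le_self_pow₀ hH (by norm_num)
  have hX0 : 0 ≤ X := by positivity
  have hκlX : κ ^ 2 * l * l ≤ X := by
    calc κ ^ 2 * l * l = κ ^ 2 * 1 * l ^ 2 := by ring
      _ ≤ κ ^ 2 * y * l ^ 2 := by gcongr
  calc ∑ s ∈ R, (H * (1 + (∑ r ∈ Icc t₀ t₁ with s ≤ r ∧ r ≤ s + 2 ^ k, g r +
          H * (κ ^ 2 * l * y * μ))) + 3 * κ ^ 2 * (2 * μ) ^ 2)
      = N * H + H * ∑ s ∈ R, ∑ r ∈ Icc t₀ t₁ with s ≤ r ∧ r ≤ s + 2 ^ k, g r +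
          (N * μ) * (H ^ 2 * (κ ^ 2 * l * y)) + 12 * (N * μ) * (κ ^ 2 * μ) := by
        rw [sum_add_distrib, sum_const, ← mul_sum, sum_add_distrib, sum_add_distrib, sum_const,
          sum_const]
        simp only [nsmul_eq_mul, ← hN]
        ring
    _ ≤ (7 * H * X) * H + H * (H * (32 * H ^ 2 * κ ^ 2 * (y * l ^ 2))) +
          (7 * H * l) * (H ^ 2 * (κ ^ 2 * l * y)) + 12 * (7 * H * l) * (κ ^ 2 * l) := by
        have : N ≤ 7 * H * X := hN1.trans (by gcongr)
        gcongr
    _ = 7 * H ^ 2 * X + 32 * H ^ 4 * X + 7 * H ^ 3 * X + 84 * H * (κ ^ 2 * l * l) := by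
        rw [hX]; ring
    _ ≤ 7 * H ^ 4 * X + 32 * H ^ 4 * X + 7 * H ^ 4 * X + 84 * H ^ 4 * X := by gcongr
    _ = _ := by ring

open Classical in
/-- Cost of the long replays. -/
lemma sum_roundCost_long_le {k : ℕ}
    (hk : lengthRoot t₀ t₁ ≤ phaseRoot Z t₀ t₁ * cbrt ((2 : ℝ) ^ k)) :
    ∑ s ∈ Icc (t₀ + 1) t₁ with IsReplay σ t₀ (2 ^ k) s,
      ∑ t ∈ Icc t₀ t₁ with (σ t).cur.first = s, roundCost P astar α σ L t ≤
      286 * H ^ 4 * (cbrt (K : ℝ) ^ 2 * phaseRoot Z t₀ t₁ * lengthRoot t₀ t₁ ^ 2) := by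
  have hH := h.one_le
  have h1 := hs.one_le
  have h2 := hs.le_horizon
  have h3 := hs.le
  have hκ : 1 ≤ cbrt (K : ℝ) := one_le_cbrt_arms
  have hcard := h.mul_card_replay_le hs (k := k)
  set y := phaseRoot Z t₀ t₁ with hy
  set l := lengthRoot t₀ t₁ with hl
  set κ := cbrt (K : ℝ)
  set μ := cbrt ((2 : ℝ) ^ k) with hμ
  set d := min (2 ^ k + 1) (t₁ - t₀ + 1) with hd
  set x := cbrt (d : ℝ) with hx
  have hx0 : 0 ≤ x := cbrt_nonneg (by positivity)
  have hy1 : 1 ≤ y := one_le_phaseRoot _ _ _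
  have hl1 : 1 ≤ l := one_le_lengthRoot _ _
  have hμ1 : 1 ≤ μ := one_le_cbrt_two_pow k
  set R := {s ∈ Icc (t₀ + 1) t₁ | IsReplay σ t₀ (2 ^ k) s} with hR
  have hone : ∀ s ∈ R, ∑ t ∈ Icc t₀ t₁ with (σ t).cur.first = s, roundCost P astar α σ L t ≤
      H * (1 + 12 * H ^ 2 * κ ^ 2 * (l ^ 2 + y * x ^ 2)) + 3 * κ ^ 2 * x ^ 2 := by
    intro s hsR
    obtain ⟨hs', hrep⟩ := mem_filter.1 hsR
    have hs'' := mem_Icc.1 hs'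
    refine h.sum_roundCost_base_le hs (by omega) (by positivity)
      (fun t ht hf hlt a ha => ?_) (by rw [hrep.2.2.2])
    have ht' := mem_Icc.1 ht
    have h4 := h.run.le_first_add_dur (t := t) (by omega) (by omega)
    have h5 := (h.run.first_first (t := t) (by omega) (by omega)).2
    have h6 := h.run.not_evicted (t := t) (by omega) (by omega) ha
    rw [hf] at h4 h5 h6
    rw [← h5, hrep.2.2.2] at h4
    exact h.sum_gap_le hs (by omega) hlt.le ht'.2 (by omega) (by omega) h6
  refine (sum_le_sum hone).trans ?_
  rw [sum_const, nsmul_eq_mul]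
  set N : ℝ := (#R : ℝ) with hN
  have hN0 : 0 ≤ N := by positivity
  have hxl : x ≤ l := cbrt_le_cbrt (by positivity) (by exact_mod_cast min_le_right _ _)
  have hxμ : x ≤ 2 * μ := by
    refine cbrt_le_of_le_pow (by positivity) (by positivity) ?_
    rw [mul_pow, hμ, cbrt_pow_three (by positivity)]
    have h7 : 1 ≤ 2 ^ k := Nat.one_le_two_pow
    have h8 : d ≤ 2 ^ 3 * 2 ^ k := by omega
    exact_mod_cast h8
  have hN1 : N ≤ 7 * H * y := by
    refine le_of_mul_le_mul_right (hcard.trans ?_) (zero_lt_one.trans_le hμ1)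
    have h4 : H * μ ≤ H * (y * μ) := by
      gcongr
      exact le_mul_of_one_le_left (by positivity) hy1
    have h5 : y * μ ≤ H * (y * μ) := le_mul_of_one_le_left (by positivity) hH
    calc 6 * l + H * μ ≤ 6 * (H * (y * μ)) + H * (y * μ) := by linarith
      _ = _ := by ring
  have hNx : N * x ^ 2 ≤ 13 * H * l ^ 2 := by
    refine le_of_mul_le_mul_right ?_ (zero_lt_one.trans_le hμ1)
    calc N * x ^ 2 * μ = (N * μ) * x ^ 2 := by ring
      _ ≤ (6 * l + H * μ) * x ^ 2 := by gcongr
      _ = 6 * l * (x * x) + H * μ * x ^ 2 := by ring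
      _ ≤ 6 * l * (2 * μ * l) + H * μ * l ^ 2 := by gcongr
      _ = (12 * 1 + H) * l ^ 2 * μ := by ring
      _ ≤ (12 * H + H) * l ^ 2 * μ := by gcongr
      _ = _ := by ring
  set X := κ ^ 2 * y * l ^ 2 with hX
  have hκ2 : 1 ≤ κ ^ 2 := one_le_pow₀ hκ
  have hX0 : 0 ≤ X := by positivity
  have hκX : κ ^ 2 * l ^ 2 ≤ X := by
    calc κ ^ 2 * l ^ 2 = κ ^ 2 * 1 * l ^ 2 := by ring
      _ ≤ κ ^ 2 * y * l ^ 2 := by gcongr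
  have hyX : y ≤ X := by
    calc y = 1 * y * 1 := by ring
      _ ≤ κ ^ 2 * y * l ^ 2 := by
        gcongr
        exact one_le_pow₀ hl1
  have p1 : H ^ 2 ≤ H ^ 4 := pow_le_pow_right₀ hH (by norm_num)
  have p3 : H ≤ H ^ 4 := le_self_pow₀ hH (by norm_num)
  calc N * (H * (1 + 12 * H ^ 2 * κ ^ 2 * (l ^ 2 + y * x ^ 2)) + 3 * κ ^ 2 * x ^ 2)
      = N * H + 12 * H ^ 3 * κ ^ 2 * (N * l ^ 2 + y * (N * x ^ 2)) + 3 * κ ^ 2 * (N * x ^ 2) := by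
        ring
    _ ≤ (7 * H * y) * H + 12 * H ^ 3 * κ ^ 2 * ((7 * H * y) * l ^ 2 + y * (13 * H * l ^ 2)) +
          3 * κ ^ 2 * (13 * H * l ^ 2) := by gcongr
    _ = 7 * H ^ 2 * y + 240 * H ^ 4 * X + 39 * H * (κ ^ 2 * l ^ 2) := by rw [hX]; ring
    _ ≤ 7 * H ^ 4 * X + 240 * H ^ 4 * X + 39 * H ^ 4 * X := by gcongr
    _ = _ := by ring

/-- Cost of the rounds of an episode that has lasted for at least `K ^ 2` rounds. -/
lemma sum_roundCost_span_le :
    ∑ t ∈ Icc t₀ t₁, roundCost P astar α σ L t ≤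
      320 * H ^ 5 * (cbrt (K : ℝ) ^ 2 * phaseRoot Z t₀ t₁ * lengthRoot t₀ t₁ ^ 2) := by
  classical
  have hH := h.one_le
  have h1 := hs.one_le
  have h2 := hs.le_horizon
  have h3 := hs.le
  set c : ℕ → ℝ := fun s =>
    ∑ t ∈ Icc t₀ t₁ with (σ t).cur.first = s, roundCost P astar α σ L t with hc
  have hc0 : ∀ s, 0 ≤ c s := fun s => sum_nonneg fun t ht => by
    have := mem_Icc.1 (mem_filter.1 ht).1
    exact (h.roundCost_mem (by omega) (by omega)).1
  set X := cbrt (K : ℝ) ^ 2 * phaseRoot Z t₀ t₁ * lengthRoot t₀ t₁ ^ 2 with hX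
  have hX0 : 0 ≤ X := by
    have := one_le_phaseRoot Z t₀ t₁
    positivity
  have hfib : ∑ t ∈ Icc t₀ t₁, roundCost P astar α σ L t = ∑ s ∈ Icc t₀ t₁, c s := by
    refine (sum_fiberwise_of_maps_to (fun t ht => ?_) _).symm
    have ht' := mem_Icc.1 ht
    have h4 := h.run.first_mem (t := t) (by omega) (by omega)
    rw [h.episode_of_mem hs ht'.1 ht'.2] at h4
    exact mem_Icc.2 ⟨h4.1, by omega⟩
  have hsplit : ∑ s ∈ Icc t₀ t₁, c s = c t₀ + ∑ s ∈ Icc (t₀ + 1) t₁, c s := by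
    rw [← Ioc_insert_left h3, sum_insert (by simp)]
    refine congrArg _ (sum_congr ?_ fun _ _ => rfl)
    ext s
    simp only [mem_Ioc, mem_Icc]
    omega
  have hrep : ∑ s ∈ Icc (t₀ + 1) t₁, c s ≤
      ∑ k ∈ Icc 1 (Nat.clog 2 T), ∑ s ∈ Icc (t₀ + 1) t₁ with IsReplay σ t₀ (2 ^ k) s, c s := by
    simp only [sum_filter]
    rw [sum_comm]
    refine sum_le_sum fun s hs' => ?_
    have hs'' := mem_Icc.1 hs'
    by_cases hex : ∃ t ∈ Icc t₀ t₁, (σ t).cur.first = s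
    · obtain ⟨t, ht, rfl⟩ := hex
      have ht' := mem_Icc.1 ht
      obtain ⟨k, hk, hr⟩ := h.isReplay_first hs ht'.1 ht'.2 (by omega)
      refine le_trans ?_ (single_le_sum (fun k _ => ?_) hk)
      · rw [if_pos hr]
      · split_ifs
        · exact hc0 _
        · exact le_rfl
    · have : c s = 0 := by
        refine sum_eq_zero fun t ht => ?_
        exact absurd ⟨t, (mem_filter.1 ht).1, (mem_filter.1 ht).2⟩ hex
      simp [this]
  have hk : ∀ k, ∑ s ∈ Icc (t₀ + 1) t₁ with IsReplay σ t₀ (2 ^ k) s, c s ≤ 286 * H ^ 4 * X := by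
    intro k
    rcases le_total (phaseRoot Z t₀ t₁ * cbrt ((2 : ℝ) ^ k)) (lengthRoot t₀ t₁) with hk | hk
    · refine (h.sum_roundCost_short_le hs hk).trans ?_
      gcongr
      norm_num
    · exact h.sum_roundCost_long_le hs hk
  have hmain := h.sum_roundCost_main_le hs
  rw [hfib, hsplit]
  have p1 : H ^ 3 ≤ H ^ 5 := pow_le_pow_right₀ hH (by norm_num)
  calc c t₀ + ∑ s ∈ Icc (t₀ + 1) t₁, c s
      ≤ 28 * H ^ 3 * X + ∑ k ∈ Icc 1 (Nat.clog 2 T), 286 * H ^ 4 * X :=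
        add_le_add hmain (hrep.trans (sum_le_sum fun k _ => hk k))
    _ = 28 * H ^ 3 * X + Nat.clog 2 T * (286 * H ^ 4 * X) := by simp
    _ ≤ 28 * H ^ 5 * X + H * (286 * H ^ 4 * X) := by
        have := h.clog_le
        gcongr
    _ = 314 * (H ^ 5 * X) := by ring
    _ ≤ 320 * (H ^ 5 * X) := by
        gcongr
        norm_num
    _ = _ := by ring

end IsTypical

end EpisodeCost

/-! ### The regret of a typical run -/

section Total

variable {K : ℕ} [NeZero K]

variable {P : ℕ → Fin K → Fin K → ℝ} {astar aC : ℕ → Fin K} {T : ℕ} {Z : Finset ℕ}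
  {z : ℕ → ℕ} {α : ℕ → Fin K} {C Λ H : ℝ} {σ S : ℕ → MetaState K} {L : ℕ → RoundLog K}

/-- The rounds of an episode. -/
lemma IsRun.exists_episode_eq_Icc (hR : IsRun T C σ S L) {e : ℕ} (he1 : 1 ≤ e) (heT : e ≤ T)
    (he : (σ e).episode = e) :
    ∃ t₁, e ≤ t₁ ∧ t₁ ≤ T ∧ (σ t₁).episode = e ∧
      {t ∈ Icc 1 T | (σ t).episode = e} = Icc e t₁ := by
  set R := {t ∈ Icc 1 T | (σ t).episode = e} with hRdef
  have hne : R.Nonempty := ⟨e, by simp [hRdef, he1, heT, he]⟩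
  have hmax := R.max'_mem hne
  simp only [hRdef, mem_filter, mem_Icc] at hmax
  set t₁ := R.max' hne with ht₁
  clear_value t₁
  refine ⟨t₁, ht₁ ▸ R.le_max' e (by simp [hRdef, he1, heT, he]), hmax.1.2, hmax.2, ?_⟩
  ext t
  rw [mem_Icc]
  constructor
  · intro ht
    refine ⟨?_, ht₁ ▸ R.le_max' t ht⟩
    simp only [hRdef, mem_filter, mem_Icc] at ht
    rw [← ht.2]
    exact (hR.episode_mem ht.1.1 ht.1.2).2
  · rintro ⟨h1, h2⟩
    have := hR.episode_eq hmax.1.1 hmax.1.2 (r := t) (by rw [hmax.2]; exact h1) h2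
    exact mem_filter.2 ⟨mem_Icc.2 ⟨by omega, by omega⟩, this.trans hmax.2⟩

namespace IsTypical

variable (h : IsTypical P astar T Z z α C Λ H σ S L)
include h

/-- A new episode begins only if the approximate winner of the current phase has been evicted, hence
at most once in each phase. -/
lemma card_episodes_le :
    #{e ∈ Icc 1 T | (σ e).episode = e} ≤ changes Z 1 T + 1 := by
  have hinj : Set.InjOn z ({e ∈ Icc 1 T | (σ e).episode = e} : Finset ℕ) := by
    have key : ∀ e e', 1 ≤ e → e < e' → e' ≤ T → (σ e).episode = e → (σ e').episode = e' →
        z e ≠ z e' := by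
      intro e e' h1 hlt hT' he he' hz
      obtain ⟨t, rfl⟩ : ∃ t, e' = t + 1 := ⟨e' - 1, by omega⟩
      have h2 := h.run.episode_mem (t := t) (by omega) (by omega)
      have h3 : e ≤ (σ t).episode := by
        by_contra hlt'
        have := h.run.episode_eq (t := t) (r := e) (by omega) (by omega) (by omega) (by omega)
        omega
      have h4 := (h.run.evicted_of_episode_ne (t := t) (by omega) (by omega) (by omega)
        (α (t + 1))).1
      have h5 := h.phasing.le e h1 (by omega)
      exact not_evicted_winner h.env h.phasing h.run h.good h.nonneg h.le_log hT' (by omega)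
        (by omega) (by omega) h4
    intro e he e' he' hz
    simp only [coe_filter, mem_Icc, Set.mem_ofPred_eq] at he he'
    rcases lt_trichotomy e e' with hlt | heq | hlt
    · exact absurd hz (key e e' he.1.1 hlt he'.1.2 he.2 he'.2)
    · exact heq
    · exact absurd hz.symm (key e' e he'.1.1 hlt he.1.2 he'.2 he.2)
  rw [← card_image_of_injOn hinj]
  refine (card_le_card (t := insert 1 {w ∈ Z | 1 < w ∧ w ≤ T}) fun w hw => ?_).trans
    (card_insert_le _ _)
  obtain ⟨e, he, rfl⟩ := mem_image.1 hw
  simp only [mem_filter, mem_Icc] at he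
  have h1 := h.phasing.one_le e he.1.1 he.1.2
  have h2 := h.phasing.le e he.1.1 he.1.2
  have h3 := h.phasing.mem e he.1.1 he.1.2
  rcases Nat.eq_or_lt_of_le h1 with h4 | h4
  · exact mem_insert.2 (Or.inl h4.symm)
  · exact mem_insert_of_mem (mem_filter.2 ⟨h3, h4, by omega⟩)

lemma sum_roundCost_episode_le {t₀ t₁ : ℕ} (h1 : 1 ≤ t₀) (h01 : t₀ ≤ t₁) (hT : t₁ ≤ T)
    (he : (σ t₁).episode = t₀) :
    ∑ t ∈ Icc t₀ t₁, roundCost P astar α σ L t ≤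
      320 * H ^ 5 * (cbrt (K : ℝ) ^ 2 * phaseRoot Z t₀ t₁ * lengthRoot t₀ t₁ ^ 2) := by
  by_cases hlong : K ^ 2 ≤ t₁ - t₀ + 1
  · exact h.sum_roundCost_span_le ⟨h1, h01, hT, he, hlong⟩
  · have hH := h.one_le
    have hκ : 1 ≤ cbrt (K : ℝ) := one_le_cbrt_arms
    have hκ3 : cbrt (K : ℝ) ^ 3 = K := cbrt_pow_three (by positivity)
    have hy1 := one_le_phaseRoot Z t₀ t₁
    have hl1 := one_le_lengthRoot t₀ t₁
    have hl3 := lengthRoot_pow_three t₀ t₁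
    set l := lengthRoot t₀ t₁
    set κ := cbrt (K : ℝ)
    have hlκ : l ≤ κ ^ 2 := by
      refine le_of_pow_le_pow_left₀ (n := 3) (by norm_num) (by positivity) ?_
      rw [← pow_mul, mul_comm, pow_mul, hκ3, hl3]
      exact_mod_cast (not_le.1 hlong).le
    calc ∑ t ∈ Icc t₀ t₁, roundCost P astar α σ L t ≤ ∑ t ∈ Icc t₀ t₁, (2 : ℝ) :=
          sum_le_sum fun t ht => by
            have := mem_Icc.1 ht
            exact (h.roundCost_mem (by omega) (by omega)).2
      _ = 2 * l ^ 3 := by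
          rw [hl3, sum_const, Nat.card_Icc, nsmul_eq_mul, mul_comm,
            show t₁ + 1 - t₀ = t₁ - t₀ + 1 by omega]
      _ = 2 * 1 * (1 * l * 1 * l ^ 2) := by ring
      _ ≤ 320 * H ^ 5 * (1 * κ ^ 2 * phaseRoot Z t₀ t₁ * l ^ 2) := by
          gcongr
          · norm_num
          · exact one_le_pow₀ hH
      _ = _ := by ring

/-- The total cost. The lengths of the episodes add up to `T`, and the numbers of phases that they
meet to at most twice the number of phases. -/
lemma sum_roundCost_le (hT : 1 ≤ T) :
    ∑ t ∈ Icc 1 T, roundCost P astar α σ L t ≤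
      960 * H ^ 5 * (cbrt (K : ℝ) ^ 2 * phaseRoot Z 1 T * lengthRoot 1 T ^ 2) := by
  have hH := h.one_le
  have hy1 := one_le_phaseRoot Z 1 T
  have hl1 := one_le_lengthRoot 1 T
  have hy3 := phaseRoot_pow_three Z 1 T
  have hl3 := lengthRoot_pow_three 1 T
  set y := phaseRoot Z 1 T
  set l := lengthRoot 1 T
  set κ := cbrt (K : ℝ)
  set E := {e ∈ Icc 1 T | (σ e).episode = e} with hE
  have hmaps : ∀ t ∈ Icc 1 T, (σ t).episode ∈ E := fun t ht => by
    have ht' := mem_Icc.1 ht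
    have h1 := h.run.episode_mem ht'.1 ht'.2
    exact mem_filter.2 ⟨mem_Icc.2 ⟨h1.1, by omega⟩, (h.run.main_facts ht'.1 ht'.2).2.2⟩
  have hfib : ∀ f : ℕ → ℝ, ∑ t ∈ Icc 1 T, f t =
      ∑ e ∈ E, ∑ t ∈ Icc 1 T with (σ t).episode = e, f t :=
    fun f => (sum_fiberwise_of_maps_to hmaps f).symm
  set A := y / l with hA
  have hA0 : 0 < A := by positivity
  have hone : ∀ e ∈ E, ∑ t ∈ Icc 1 T with (σ t).episode = e, roundCost P astar α σ L t ≤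
      320 * H ^ 5 * κ ^ 2 * (A * ∑ t ∈ Icc 1 T with (σ t).episode = e, 1 +
        ((∑ t ∈ Icc 1 T with (σ t).episode = e, if 1 < t ∧ t ∈ Z then 1 else 0) + 1) / A ^ 2) := by
    intro e he
    obtain ⟨he', hee⟩ := mem_filter.1 he
    have he'' := mem_Icc.1 he'
    obtain ⟨t₁, h1, h2, h3, h4⟩ := h.run.exists_episode_eq_Icc he''.1 he''.2 hee
    rw [h4]
    refine (h.sum_roundCost_episode_le he''.1 h1 h2 h3).trans ?_
    have hv1 := one_le_phaseRoot Z e t₁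
    have hl1' := one_le_lengthRoot e t₁
    have hv3 := phaseRoot_pow_three Z e t₁
    have hl3' := lengthRoot_pow_three e t₁
    set v := phaseRoot Z e t₁
    set w := lengthRoot e t₁
    have hyoung := sq_le_mul_cube_add (w := w / v) (by positivity) hA0
    have e1 : v * w ^ 2 ≤ A * w ^ 3 + v ^ 3 / A ^ 2 := by
      calc v * w ^ 2 = v ^ 3 * (w / v) ^ 2 := by field_simp
        _ ≤ v ^ 3 * (A * (w / v) ^ 3 + 1 / A ^ 2) := by gcongr
        _ = _ := by field_simp
    have e2 : w ^ 3 = ∑ t ∈ Icc e t₁, (1 : ℝ) := by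
      rw [hl3', sum_const, Nat.card_Icc, nsmul_eq_mul, mul_one,
        show t₁ + 1 - e = t₁ - e + 1 by omega]
    have e3 : v ^ 3 ≤ (∑ t ∈ Icc e t₁, if 1 < t ∧ t ∈ Z then (1 : ℝ) else 0) + 1 := by
      rw [hv3, ← sum_filter, sum_const, nsmul_eq_mul, mul_one, Nat.cast_add, Nat.cast_one]
      refine add_le_add_left ?_ _
      have : changes Z e t₁ ≤ #{t ∈ Icc e t₁ | 1 < t ∧ t ∈ Z} := card_le_card fun x hx => by
        simp only [mem_filter, mem_Icc] at hx ⊢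
        exact ⟨⟨hx.2.1.le, hx.2.2⟩, by omega, hx.1⟩
      exact_mod_cast this
    calc 320 * H ^ 5 * (κ ^ 2 * v * w ^ 2) = 320 * H ^ 5 * κ ^ 2 * (v * w ^ 2) := by ring
      _ ≤ 320 * H ^ 5 * κ ^ 2 * (A * w ^ 3 + v ^ 3 / A ^ 2) := by gcongr
      _ ≤ _ := by
        rw [e2] at *
        gcongr
  have s1 : ∑ t ∈ Icc 1 T, (1 : ℝ) = l ^ 3 := by
    rw [hl3, sum_const, Nat.card_Icc, nsmul_eq_mul, mul_one, show T + 1 - 1 = T - 1 + 1 by omega]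
  have s2 : (∑ t ∈ Icc 1 T, if 1 < t ∧ t ∈ Z then (1 : ℝ) else 0) ≤ y ^ 3 := by
    rw [hy3, ← sum_filter, sum_const, nsmul_eq_mul, mul_one]
    have : #{t ∈ Icc 1 T | 1 < t ∧ t ∈ Z} ≤ changes Z 1 T := card_le_card fun x hx => by
      simp only [mem_filter, mem_Icc] at hx ⊢
      exact ⟨hx.2.2, hx.2.1, hx.1.2⟩
    exact_mod_cast this.trans (Nat.le_succ _)
  have s3 : (#E : ℝ) ≤ y ^ 3 := by
    rw [hy3]
    exact_mod_cast h.card_episodes_le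
  rw [hfib]
  calc ∑ e ∈ E, ∑ t ∈ Icc 1 T with (σ t).episode = e, roundCost P astar α σ L t
      ≤ ∑ e ∈ E, 320 * H ^ 5 * κ ^ 2 * (A * ∑ t ∈ Icc 1 T with (σ t).episode = e, 1 +
        ((∑ t ∈ Icc 1 T with (σ t).episode = e, if 1 < t ∧ t ∈ Z then 1 else 0) + 1) / A ^ 2) :=
        sum_le_sum hone
    _ = 320 * H ^ 5 * κ ^ 2 * (A * ∑ t ∈ Icc 1 T, 1 +
        ((∑ t ∈ Icc 1 T, if 1 < t ∧ t ∈ Z then 1 else 0) + #E) / A ^ 2) := by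
        rw [← mul_sum, sum_add_distrib, ← mul_sum, ← sum_div, sum_add_distrib, ← hfib, ← hfib]
        simp
    _ ≤ 320 * H ^ 5 * κ ^ 2 * (A * l ^ 3 + (y ^ 3 + y ^ 3) / A ^ 2) := by
        rw [s1]
        gcongr
    _ = _ := by
        rw [hA]
        field_simp
        ring

end IsTypical

/-- Bound on the amount by which the approximate winner of a phase falls short of the dominant
arm. -/
def winnerGap (K : ℕ) (z : ℕ → ℕ) (t : ℕ) : ℝ :=
  if z t < t then min 1 (cbrt (K : ℝ) ^ 2 * (1 / cbrt ((t : ℝ) - z t))) else 1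

omit [NeZero K] in
lemma winnerGap_mem (t : ℕ) : 0 ≤ winnerGap K z t ∧ winnerGap K z t ≤ 1 := by
  unfold winnerGap
  split_ifs with hz
  · have hlt : (z t : ℝ) < t := by exact_mod_cast hz
    have : 0 < cbrt ((t : ℝ) - z t) := cbrt_pos (by linarith)
    exact ⟨le_min zero_le_one (by positivity), min_le_left _ _⟩
  · norm_num

lemma sum_winnerGap_le (hZ : IsPhasing P astar T Z z α) (hT : 1 ≤ T) :
    ∑ t ∈ Icc 1 T, winnerGap K z t ≤
      4 * (cbrt (K : ℝ) ^ 2 * phaseRoot Z 1 T * lengthRoot 1 T ^ 2) := by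
  have hy1 := one_le_phaseRoot Z 1 T
  have hl1 := one_le_lengthRoot 1 T
  have hyl := phaseRoot_le_lengthRoot Z 1 T
  have hy3 := phaseRoot_pow_three Z 1 T
  have hl3 := lengthRoot_pow_three 1 T
  have hκ : 1 ≤ cbrt (K : ℝ) := one_le_cbrt_arms
  set y := phaseRoot Z 1 T
  set l := lengthRoot 1 T
  set κ := cbrt (K : ℝ)
  have hA : 0 < y / l := by positivity
  have key := hZ.sum_le (f := winnerGap K z) (A := 3 / 2 * κ ^ 2 * (y / l))
    (B := 1 + 3 / 2 * κ ^ 2 * (1 / (y / l) ^ 2)) (by positivity) le_rfl hT le_rfl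
    (fun u v hu huv hv hzv => by
      refine (hZ.sum_sub_le hu huv hv hzv (fun t _ => (winnerGap_mem t).2)
        fun t _ hzt => ?_).trans ?_
      · rw [winnerGap, if_pos hzt]
        exact min_le_right _ _
      · have huv' : (u : ℝ) ≤ v := by exact_mod_cast huv
        have h1 := sq_le_mul_cube_add (w := cbrt ((v : ℝ) - u)) (cbrt_nonneg (by linarith)) hA
        rw [cbrt_pow_three (by linarith)] at h1
        have h2 : cbrt ((v : ℝ) - u) ^ 2 ≤ y / l * ((v : ℝ) - u + 1) + 1 / (y / l) ^ 2 := by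
          have : y / l * ((v : ℝ) - u) ≤ y / l * ((v : ℝ) - u + 1) := by
            gcongr
            linarith
          linarith
        have h3 : κ ^ 2 * cbrt ((v : ℝ) - u) ^ 2 ≤
            κ ^ 2 * (y / l * ((v : ℝ) - u + 1) + 1 / (y / l) ^ 2) := by gcongr
        linarith)
  have e1 : (T : ℝ) - (1 : ℕ) + 1 = l ^ 3 := by
    rw [hl3, Nat.cast_add, Nat.cast_sub hT, Nat.cast_one]
  have e2 : (changes Z 1 T : ℝ) + 1 = y ^ 3 := by rw [hy3]; push_cast; ring
  rw [e1, e2] at key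
  refine key.trans ?_
  have e3 : y ^ 3 ≤ κ ^ 2 * y * l ^ 2 := by
    calc y ^ 3 = 1 * y * y ^ 2 := by ring
      _ ≤ κ ^ 2 * y * l ^ 2 := by
        gcongr
        exact one_le_pow₀ hκ
  calc 3 / 2 * κ ^ 2 * (y / l) * l ^ 3 + (1 + 3 / 2 * κ ^ 2 * (1 / (y / l) ^ 2)) * y ^ 3
      = 3 * (κ ^ 2 * y * l ^ 2) + y ^ 3 := by
        field_simp
        ring
    _ ≤ _ := by linarith

/-- Mean regret of an arm played in round `t` in state `s`. -/
def meanRegret (P : ℕ → Fin K → Fin K → ℝ) (aC : ℕ → Fin K) (t : ℕ) (s : MetaState K) : ℝ :=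
  ∑ a, (playDist s.cur.cand (learningRate K (t - s.cur.first)) a).toReal *
    (P t (aC t) a - 1 / 2)

/-- Regret against the Condorcet winner is controlled by the gap to the dominant arm in duels with
the approximate winner. -/
lemma IsTypical.meanRegret_le (h : IsTypical P astar T Z z α C Λ H σ S L) {t : ℕ} (h1 : 1 ≤ t)
    (hT : t ≤ T) : meanRegret P aC t (σ t) ≤ roundCost P astar α σ L t + winnerGap K z t := by
  have ht := mem_Icc.2 ⟨h1, hT⟩
  have hne := h.run.cand_nonempty h1 hT
  have hcard : (0 : ℝ) < #(σ t).cur.cand := by exact_mod_cast card_pos.2 hne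
  have hrate := h.run.rate_facts h1
  have hK : (0 : ℝ) < K := by exact_mod_cast Nat.pos_of_ne_zero (NeZero.ne K)
  set A := (σ t).cur.cand with hA
  set η := (L t).rate with hη
  have hη' : learningRate K (t - (σ t).cur.first) = η := (h.run.rate t h1).symm
  have hD := winnerGap_mem (K := K) (z := z) t
  set D := winnerGap K z t with hDdef
  have hρ1 : ∀ a, P t (aC t) a - 1 / 2 ≤ 1 := fun a => by
    have := (h.env.pref t ht (aC t) a).2.1
    linarith
  have hρ2 : ∀ a, P t (aC t) a - 1 / 2 ≤ D + gap P astar α t a := fun a => by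
    have e1 := h.env.dom t ht (aC t) a
    have e2 : P t (astar t) a - P t (α t) a ≤ D := by
      rw [hDdef, winnerGap]
      split_ifs with hz
      · exact le_min (h.env.sub_mem h1 hT _ _).2 (h.phasing.sub_le h1 hT hz a)
      · exact (h.env.sub_mem h1 hT _ _).2
    have e3 := (h.env.pref t ht (α t) a).2.2
    have e4 := (h.env.pref t ht (α t) (α t)).2.2
    have e5 := h.env.dom t ht (α t) (α t)
    unfold gap
    linarith
  have hgap0 : 0 ≤ ∑ a ∈ A, gap P astar α t a :=
    sum_nonneg fun a _ => (h.env.gap_mem h1 hT a).1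
  unfold meanRegret
  rw [hη', ← hA]
  calc ∑ a, (playDist A η a).toReal * (P t (aC t) a - 1 / 2)
      = ∑ a, η / K * (P t (aC t) a - 1 / 2) +
          ∑ a, (1 - η) * (if a ∈ A then 1 / (#A : ℝ) else 0) * (P t (aC t) a - 1 / 2) := by
        rw [← sum_add_distrib]
        refine sum_congr rfl fun a _ => ?_
        rw [playDist_toReal hne hrate.1.le hrate.2]
        ring
    _ = ∑ a, η / K * (P t (aC t) a - 1 / 2) +
          (1 - η) * ((1 / (#A : ℝ)) * ∑ a ∈ A, (P t (aC t) a - 1 / 2)) := by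
        congr 1
        rw [mul_sum, mul_sum, ← sum_filter_add_sum_filter_not univ (· ∈ A)]
        simp only [filter_mem_eq_inter, univ_inter]
        rw [sum_congr rfl fun a ha => by rw [if_pos ha],
          sum_eq_zero (s := {x | x ∉ A}) fun a ha => by rw [if_neg (mem_filter.1 ha).2]; ring,
          add_zero]
        exact sum_congr rfl fun a _ => by ring
    _ ≤ ∑ a : Fin K, η / K * 1 +
          (1 - η) * ((1 / (#A : ℝ)) * ∑ a ∈ A, (D + gap P astar α t a)) := by
        have h2 : 0 ≤ 1 - η := by linarith
        have h3 : 0 ≤ η / K := div_nonneg hrate.1.le hK.le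
        refine add_le_add (sum_le_sum fun a _ => mul_le_mul_of_nonneg_left (hρ1 a) h3) ?_
        gcongr with a _
        exact hρ2 a
    _ = η + (1 - η) * (D + (1 / (#A : ℝ)) * ∑ a ∈ A, gap P astar α t a) := by
        rw [sum_add_distrib, sum_const, sum_const, card_univ, Fintype.card_fin]
        simp only [nsmul_eq_mul]
        field_simp
    _ ≤ η + 1 * (D + (1 / (#A : ℝ)) * ∑ a ∈ A, gap P astar α t a) := by
        gcongr
        · have : 0 ≤ (1 / (#A : ℝ)) * ∑ a ∈ A, gap P astar α t a := by positivity
          linarith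
        · linarith
    _ = _ := by
        unfold roundCost
        ring

/-- The regret of a typical run. -/
lemma IsTypical.sum_meanRegret_le (h : IsTypical P astar T Z z α C Λ H σ S L) (hT : 1 ≤ T) :
    ∑ t ∈ Icc 1 T, meanRegret P aC t (σ t) ≤
      964 * H ^ 5 * (cbrt (K : ℝ) ^ 2 * phaseRoot Z 1 T * lengthRoot 1 T ^ 2) := by
  have h1 := h.sum_roundCost_le hT
  have h2 := sum_winnerGap_le h.phasing hT
  have h3 : 1 ≤ H ^ 5 := one_le_pow₀ h.one_le
  set X := cbrt (K : ℝ) ^ 2 * phaseRoot Z 1 T * lengthRoot 1 T ^ 2 with hX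
  have hX0 : 0 ≤ X := by
    have := one_le_phaseRoot Z 1 T
    positivity
  calc ∑ t ∈ Icc 1 T, meanRegret P aC t (σ t)
      ≤ ∑ t ∈ Icc 1 T, (roundCost P astar α σ L t + winnerGap K z t) :=
        sum_le_sum fun t ht => h.meanRegret_le (mem_Icc.1 ht).1 (mem_Icc.1 ht).2
    _ ≤ 960 * H ^ 5 * X + 4 * 1 * X := by
        rw [sum_add_distrib]
        linarith
    _ ≤ 960 * H ^ 5 * X + 4 * H ^ 5 * X := by gcongr
    _ = _ := by ring

end Total

open scoped ENNReal

/-! ### Runs of the meta algorithm -/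

section Histories

variable {K : ℕ} [NeZero K] {T : ℕ} {C : ℝ} {P : ℕ → Fin K → Fin K → ℝ}

/-- The log entry of a round. -/
def turnLog (t : ℕ) (x : MetaTurn K) : RoundLog K :=
  ⟨x.1.cur.cand, learningRate K (t - x.1.cur.first), x.2.1.1, x.2.1.2, x.2.2⟩

/-- The initial state. -/
def metaStart (K T : ℕ) [NeZero K] : MetaState K := newEpisode T 1 fun _ => ⟨univ, 1, 0, 0, false⟩

/-- The state at the end of a round. -/
def metaEnd (T : ℕ) (ω : ℕ → MetaTurn K) : ℕ → MetaState K
  | 0 => metaStart K T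
  | t + 1 => { (ω (t + 1)).1 with
      log := Function.update (ω (t + 1)).1.log (t + 1) (turnLog (t + 1) (ω (t + 1))) }

/-- Law of the history of the first `n` rounds of the meta algorithm. The entry of the fictitious
round `0` is such that its log entry is that of the initial state. -/
def metaLaw (T : ℕ) (C : ℝ) (P : ℕ → Fin K → Fin K → ℝ) (n : ℕ) : PMF (ℕ → MetaTurn K) :=
  historyLaw (metaAlgorithm K T C) P (fun _ => (metaStart K T, (0, 0), false)) n

lemma endState_metaAlgorithm (ω : ℕ → MetaTurn K) (n : ℕ) :
    endState (metaAlgorithm K T C) ω n = metaEnd T ω n := by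
  cases n <;> rfl

/-- A product of round-wise weights of conditional mean at most `1` has mean at most `1`. -/
lemma ex_prod_metaLaw_le_one (W : ℕ → MetaState K → MetaTurn K → ℝ≥0∞) (n : ℕ)
    (hW : ∀ t ∈ Icc 1 n, ∀ s, ex (metaTurnLaw T C P t s) (W t s) ≤ 1) :
    ex (metaLaw T C P n) (fun ω => ∏ t ∈ Icc 1 n, W t (metaEnd T ω (t - 1)) (ω t)) ≤ 1 := by
  have h1 := ex_prod_le_one (alg := metaAlgorithm K T C) P
    (fun _ => (metaStart K T, (0, 0), false)) W n fun k hk s =>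
      (congrArg (fun p => ex p (W (k + 1) s)) (turnLaw_metaAlgorithm T C P (k + 1) s)).le.trans
        (hW (k + 1) (mem_Icc.2 ⟨by omega, by omega⟩) s)
  have e : (fun ω : ℕ → MetaTurn K => ∏ t ∈ Icc 1 n, W t (metaEnd T ω (t - 1)) (ω t)) =
      fun ω => ∏ k ∈ range n, W (k + 1) (endState (metaAlgorithm K T C) ω k) (ω (k + 1)) := by
    funext ω
    have e1 : ∏ t ∈ Icc 1 n, W t (metaEnd T ω (t - 1)) (ω t) =
        ∏ k ∈ range n, W (k + 1) (metaEnd T ω k) (ω (k + 1)) := by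
      have e2 := prod_Ico_add' (fun t => W t (metaEnd T ω (t - 1)) (ω t)) 0 n 1
      simp only [Nat.add_sub_cancel] at e2
      rw [range_eq_Ico, e2]
      refine prod_congr ?_ fun t _ => rfl
      ext t
      simp only [mem_Icc, mem_Ico]
      omega
    exact e1.trans (prod_congr rfl fun k _ =>
      congrArg (fun s => W (k + 1) s (ω (k + 1))) (endState_metaAlgorithm ω k).symm)
  exact (congrArg (ex (metaLaw T C P n)) e).le.trans h1

lemma mem_support_drawReplay {n k : ℕ} {r : Option ℕ} (h : r ∈ (drawReplay n k).support) :
    r = none ∨ ∃ j, 1 ≤ j ∧ j ≤ k ∧ r = some (2 ^ j) := by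
  induction k generalizing r with
  | zero =>
    simp only [drawReplay, PMF.support_pure, Set.mem_singleton_iff] at h
    exact Or.inl h
  | succ k ih =>
    simp only [drawReplay, PMF.mem_support_bind_iff, PMF.mem_support_map_iff] at h
    obtain ⟨B, -, r', hr', rfl⟩ := h
    cases B with
    | true => exact Or.inr ⟨k + 1, by omega, le_rfl, by simp⟩
    | false =>
      rcases ih hr' with rfl | ⟨j, h1, h2, rfl⟩
      · exact Or.inl (by simp)
      · exact Or.inr ⟨j, h1, by omega, by simp⟩

lemma mem_support_planLaw {t : ℕ} {s σ : MetaState K} (h : σ ∈ (planLaw T C t s).support) :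
    (t ≤ s.episode ∧ σ = s) ∨ (s.episode < t ∧
      ((∃ k, 1 ≤ k ∧ k ≤ Nat.clog 2 T ∧ σ = startReplay t (2 ^ k) s) ∨ σ = resume T C t s)) := by
  unfold planLaw at h
  split_ifs at h with hle
  · simp only [PMF.support_pure, Set.mem_singleton_iff] at h
    exact Or.inl ⟨hle, h⟩
  · rw [PMF.mem_support_map_iff] at h
    obtain ⟨r, hr, rfl⟩ := h
    refine Or.inr ⟨not_le.1 hle, ?_⟩
    rcases mem_support_drawReplay hr with rfl | ⟨k, h1, h2, rfl⟩
    · exact Or.inr rfl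
    · exact Or.inl ⟨k, h1, h2, rfl⟩

lemma resume_log (T : ℕ) (C : ℝ) (t : ℕ) (s : MetaState K) : (resume T C t s).log = s.log := by
  unfold resume
  split
  · rfl
  · dsimp only
    split_ifs <;> rfl

lemma resume_episode (T : ℕ) (C : ℝ) (t : ℕ) (s : MetaState K) :
    (resume T C t s).episode = s.episode ∨ (resume T C t s).episode = t := by
  unfold resume
  split
  · exact Or.inr rfl
  · dsimp only
    split_ifs
    · exact Or.inr rfl
    · exact Or.inl rfl

/-- Histories of positive probability are runs. -/
lemma isRun_of_mem_support {ω : ℕ → MetaTurn K} (hT : 1 ≤ T)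
    (h : ω ∈ (metaLaw T C P T).support) :
    IsRun T C (fun t => (ω t).1) (metaEnd T ω) (fun t => turnLog t (ω t)) := by
  have hturn : ∀ t, t < T → (ω (t + 1)).1 ∈ (planLaw T C (t + 1) (metaEnd T ω t)).support := by
    intro t ht
    have h1 : ω (t + 1) ∈ (metaTurnLaw T C P (t + 1) (metaEnd T ω t)).support := by
      have h2 := mem_support_turnLaw h ht
      have e := turnLaw_metaAlgorithm T C P (t + 1) (endState (metaAlgorithm K T C) ω t)
      exact endState_metaAlgorithm (C := C) ω t ▸ e ▸ h2
    simp only [metaTurnLaw, PMF.mem_support_bind_iff, PMF.mem_support_map_iff] at h1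
    obtain ⟨σ, hσ, ij, -, o, -, ho⟩ := h1
    have : (ω (t + 1)).1 = σ := by rw [← ho]
    rwa [this]
  have hzero : ω 0 = (metaStart K T, (0, 0), false) := historyLaw_zero_eq h
  have hplan := fun t ht => mem_support_planLaw (hturn t ht)
  have hinit : (ω 1).1 = metaStart K T := by
    rcases hplan 0 hT with ⟨-, h1⟩ | ⟨h1, -⟩
    · exact h1
    · simp [metaEnd, metaStart, newEpisode] at h1
  have hlogeq : ∀ t, t < T → (ω (t + 1)).1.log = (metaEnd T ω t).log := by
    intro t ht
    rcases hplan t ht with ⟨-, h1⟩ | ⟨-, ⟨k, -, -, h1⟩ | h1⟩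
    · rw [h1]
    · rw [h1]; rfl
    · rw [h1, resume_log]
  have hep : ∀ t, 1 ≤ t → t ≤ T → (metaEnd T ω t).episode ≤ t := by
    intro t h1
    induction t, h1 using Nat.le_induction with
    | base =>
      intro _
      change (ω 1).1.episode ≤ 1
      rw [hinit]
      exact le_rfl
    | succ t h1 ih =>
      intro h2
      have h3 := ih (by omega)
      change (ω (t + 1)).1.episode ≤ t + 1
      rcases hplan t h2 with ⟨-, h4⟩ | ⟨-, ⟨k, -, -, h4⟩ | h4⟩
      · rw [h4]; omega
      · rw [h4]; simp only [startReplay]; omega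
      · rw [h4]
        rcases resume_episode T C (t + 1) (metaEnd T ω t) with h5 | h5 <;> omega
  refine ⟨fun t _ => rfl, fun t _ => rfl, ?_, ?_, ?_, ?_⟩
  · simp only [hinit]
    exact ⟨rfl, rfl, rfl, rfl⟩
  · intro t ht
    obtain ⟨t, rfl⟩ : ∃ t', t = t' + 1 := ⟨t - 1, by omega⟩
    exact ⟨rfl, rfl, rfl, rfl⟩
  · intro t
    induction t with
    | zero =>
      intro _ r hr
      obtain rfl : r = 0 := by omega
      simp [hzero, turnLog, metaEnd, metaStart, newEpisode, learningRate]
    | succ t ih =>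
      intro ht r hr
      change Function.update (ω (t + 1)).1.log (t + 1) (turnLog (t + 1) (ω (t + 1))) r = _
      rcases Nat.lt_or_eq_of_le hr with hr | rfl
      · rw [Function.update_of_ne (by omega), hlogeq t (by omega)]
        exact ih (by omega) r (by omega)
      · rw [Function.update_self]
  · intro t h1 ht
    rcases hplan t ht with ⟨h2, -⟩ | ⟨-, h2⟩
    · have := hep t h1 ht.le
      omega
    · exact h2

/-! ### The regret as an expectation over histories -/

lemma ex_metaTurnLaw (t : ℕ) (s : MetaState K) (f : MetaTurn K → ℝ≥0∞) :
    ex (metaTurnLaw T C P t s) f = ex (planLaw T C t s) fun σ => ex (drawLaw t σ) fun ij =>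
      ex (coin (P t ij.1 ij.2)) fun o => f (σ, ij, o) := by
  simp only [metaTurnLaw, ex_bind, ex_map]

lemma ex_drawLaw_regret {aC : ℕ → Fin K} {t : ℕ} (hC : IsCondorcetWinner (P t) (aC t))
    (σ : MetaState K) :
    ex (drawLaw t σ) (fun ij => ENNReal.ofReal
      ((P t (aC t) ij.1 + P t (aC t) ij.2 - 1) / 2)) = ENNReal.ofReal (meanRegret P aC t σ) := by
  unfold drawLaw meanRegret
  set q := playDist σ.cur.cand (learningRate K (t - σ.cur.first))
  set ρ : Fin K → ℝ := fun a => P t (aC t) a - 1 / 2 with hρ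
  have h0 : ∀ a, 0 ≤ ρ a := fun a => by
    have := hC a
    simp only [hρ]
    linarith
  have hone := sum_toReal_pmf q
  have hq : ∀ a, 0 ≤ (q a).toReal := fun a => ENNReal.toReal_nonneg
  rw [ex_bind]
  simp only [ex_map]
  have e : ∀ i j, (P t (aC t) i + P t (aC t) j - 1) / 2 = (ρ i + ρ j) / 2 := fun i j => by
    simp only [hρ]
    ring
  simp only [e]
  have hinner : ∀ i, ex q (fun j => ENNReal.ofReal ((ρ i + ρ j) / 2)) =
      ENNReal.ofReal ((ρ i + ∑ j, (q j).toReal * ρ j) / 2) := fun i => by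
    rw [ex_ofReal_fintype q fun j => by have := h0 i; have := h0 j; positivity]
    congr 1
    calc ∑ j, (q j).toReal * ((ρ i + ρ j) / 2)
        = (∑ j, (q j).toReal) * (ρ i / 2) + (∑ j, (q j).toReal * ρ j) / 2 := by
          rw [sum_mul, sum_div, ← sum_add_distrib]
          exact sum_congr rfl fun j _ => by ring
      _ = _ := by rw [hone]; ring
  simp only [hinner]
  have hs0 : 0 ≤ ∑ j, (q j).toReal * ρ j := sum_nonneg fun j _ => mul_nonneg (hq j) (h0 j)
  rw [ex_ofReal_fintype q fun i => by have := h0 i; positivity]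
  congr 1
  calc ∑ i, (q i).toReal * ((ρ i + ∑ j, (q j).toReal * ρ j) / 2)
      = (∑ i, (q i).toReal * ρ i) / 2 +
          (∑ i, (q i).toReal) * (1 / 2 * ∑ j, (q j).toReal * ρ j) := by
        rw [sum_mul, sum_div, ← sum_add_distrib]
        exact sum_congr rfl fun i _ => by ring
    _ = _ := by rw [hone]; ring

omit [NeZero K] in
lemma toReal_map_apply_sum {α β : Type*} [Fintype β] (p : PMF α) (g : α → β) {f : β → ℝ}
    (hf : ∀ b, 0 ≤ f b) :
    ENNReal.ofReal (∑ b, ((p.map g) b).toReal * f b) = ex p fun x => ENNReal.ofReal (f (g x)) := by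
  rw [← ex_ofReal_fintype _ hf, ex_map]

/-- The expected regret is the expected sum of the mean regrets of the rounds. -/
lemma ofReal_expectedCondorcetRegret {aC : ℕ → Fin K}
    (hC : ∀ t ∈ Icc 1 T, IsCondorcetWinner (P t) (aC t)) :
    ENNReal.ofReal (expectedCondorcetRegret (metaAlgorithm K T C) P aC T) =
      ex (metaLaw T C P T) fun ω => ∑ t ∈ Icc 1 T, ENNReal.ofReal (meanRegret P aC t (ω t).1) := by
  set c : ℕ → MetaTurn K → ℝ := fun t x =>
    (P t (aC t) x.2.1.1 + P t (aC t) x.2.1.2 - 1) / 2 with hc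
  have hc0 : ∀ t ∈ Icc 1 T, ∀ i j, 0 ≤ (P t (aC t) i + P t (aC t) j - 1) / 2 := fun t ht i j => by
    have h1 := hC t ht i
    have h2 := hC t ht j
    linarith
  have hmem : ∀ k < T, k + 1 ∈ Icc 1 T := fun k hk => mem_Icc.2 ⟨by omega, by omega⟩
  have hIcc : ∀ f : ℕ → ℝ≥0∞, ∑ t ∈ Icc 1 T, f t = ∑ k ∈ range T, f (k + 1) := fun f => by
    rw [range_eq_Ico, sum_Ico_add' f 0 T 1]
    refine sum_congr ?_ fun _ _ => rfl
    ext t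
    simp only [mem_Icc, mem_Ico]
    omega
  unfold expectedCondorcetRegret
  rw [toReal_map_apply_sum (DuelingAlgorithm.law (metaAlgorithm K T C) P T) Prod.snd
      (f := condorcetRegret P aC) (fun b => sum_nonneg fun t _ => hc0 (t + 1) (hmem t t.2) _ _),
    law_eq_map_historyLaw P (fun _ => (metaStart K T, (0, 0), false)), ex_map]
  have hround : ∀ k < T, ∀ s : MetaState K,
      ex (metaTurnLaw T C P (k + 1) s) (fun x => ENNReal.ofReal (c (k + 1) x)) =
        ex (metaTurnLaw T C P (k + 1) s)
          (fun x => ENNReal.ofReal (meanRegret P aC (k + 1) x.1)) := fun k hk s => by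
    rw [ex_metaTurnLaw, ex_metaTurnLaw]
    simp only [hc, ex_const]
    exact ex_congr _ fun σ _ => ex_drawLaw_regret (hC _ (hmem k hk)) σ
  have key := ex_sum_eq (alg := metaAlgorithm K T C) P
    (fun _ => (metaStart K T, (0, 0), false)) (fun t x => ENNReal.ofReal (c t x))
    (fun t x => ENNReal.ofReal (meanRegret P aC t x.1)) T fun k hk s =>
      turnLaw_metaAlgorithm T C P (k + 1) s ▸ hround k hk s
  simp only [hIcc]
  refine Eq.trans ?_ key
  refine ex_congr _ fun ω _ => ?_
  rw [condorcetRegret, ENNReal.ofReal_sum_of_nonneg fun (t : Fin T) _ => hc0 (t + 1) (hmem t t.2) _ _,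
    Finset.sum_range]

end Histories

open scoped ENNReal

/-! ### Typical runs are likely -/

section Probability

variable {K : ℕ} [NeZero K] {T : ℕ} {C : ℝ} {P : ℕ → Fin K → Fin K → ℝ}

lemma sum_le_of_prod_le {s u : Finset ℕ} (hsu : s ⊆ u) {W : ℕ → ℝ≥0∞} {f : ℕ → ℝ} {Λ : ℝ}
    (h1 : ∀ t ∈ s, W t = ENNReal.ofReal (Real.exp (f t))) (h2 : ∀ t ∈ u, t ∉ s → W t = 1)
    (h : ∏ t ∈ u, W t ≤ ENNReal.ofReal (Real.exp Λ)) : ∑ t ∈ s, f t ≤ Λ := by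
  rw [← prod_subset hsu h2, prod_congr rfl h1,
    ← ENNReal.ofReal_prod_of_nonneg fun t _ => (Real.exp_pos _).le, ← Real.exp_sum,
    ENNReal.ofReal_le_ofReal_iff (Real.exp_pos _).le, Real.exp_le_exp] at h
  exact h

open Classical in
/-- Weight for the deviation of the estimates of two arms over the rounds `s₁, …, s₂`, at scale
`n`. -/
def concWeight (P : ℕ → Fin K → Fin K → ℝ) (s₁ s₂ : ℕ) (a a' c : Fin K) (n t : ℕ)
    (x : MetaTurn K) : ℝ≥0∞ :=
  if (s₁ ≤ t ∧ t ≤ s₂) ∧ (a ∈ x.1.cur.cand ∧ a' ∈ x.1.cur.cand) ∧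
      (K : ℝ) ^ 2 / (turnLog t x).rate ≤ n then
    ENNReal.ofReal (Real.exp ((bordaEstimate (turnLog t x) a' (Pi.single c 1)
      - bordaEstimate (turnLog t x) a (Pi.single c 1) - (P t a' c - P t a c)) / n
      - (K : ℝ) ^ 2 / (2 * (turnLog t x).rate * n ^ 2)))
  else 1

open Classical in
/-- Weight for the number of replays of size `2 ^ k` in the rounds `u, …, v` of the episode that
began at round `t₀`. -/
def countWeight (t₀ k u v t : ℕ) (s : MetaState K) (x : MetaTurn K) : ℝ≥0∞ :=
  if u ≤ t ∧ t ≤ v then ENNReal.ofReal (Real.exp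
    ((if x.1 = startReplay t (2 ^ k) s ∧ s.episode = t₀ ∧ t₀ < t then 1 else 0)
      - 2 * replayProb (t - t₀) k))
  else 1

open Classical in
/-- Weight for the absence of the replays called for by the schedule `D` in the rounds strictly
between `u` and `v` of the episode that began at round `t₀`. -/
def detectWeight (D : ℕ → ℕ) (t₀ u v t : ℕ) (s : MetaState K) (x : MetaTurn K) : ℝ≥0∞ :=
  if t ∈ Ioo u v ∧ D t ≠ 0 then
    if s.episode = t₀ ∧ t₀ < t then
      if ∃ m, x.1 = startReplay t m s ∧ 2 ^ D t ≤ m then 0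
      else ENNReal.ofReal (Real.exp (replayProb (t - t₀) (D t)))
    else 1
  else 1

lemma ex_concWeight_le (hP : ∀ t ∈ Icc 1 T, IsPreferenceMatrix (P t)) (s₁ s₂ : ℕ)
    (a a' c : Fin K) (n : ℕ) {t : ℕ} (ht : t ∈ Icc 1 T) (s : MetaState K) :
    ex (metaTurnLaw T C P t s) (concWeight P s₁ s₂ a a' c n t) ≤ 1 := by
  classical
  rw [ex_metaTurnLaw]
  refine ex_le_const _ fun σ _ => ?_
  by_cases h : (s₁ ≤ t ∧ t ≤ s₂) ∧ (a ∈ σ.cur.cand ∧ a' ∈ σ.cur.cand) ∧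
      (K : ℝ) ^ 2 / learningRate K (t - σ.cur.first) ≤ n
  · have key := ex_exp_estimate_le (learningRate_pos (K := K) (t - σ.cur.first))
      (learningRate_le_one _) (hP t ht) c h.2.1.1 h.2.1.2 h.2.2
    refine le_trans (le_of_eq ?_) key
    unfold drawLaw
    refine ex_congr _ fun ij _ => ex_congr _ fun o _ => ?_
    rw [concWeight, if_pos (by simpa only [turnLog] using h)]
    rfl
  · refine ex_le_const _ fun ij _ => ex_le_const _ fun o _ => ?_
    rw [concWeight, if_neg (by simpa only [turnLog] using h)]

lemma ex_countWeight_le (t₀ k u v t : ℕ) (s : MetaState K) :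
    ex (metaTurnLaw T C P t s) (countWeight t₀ k u v t s) ≤ 1 := by
  unfold countWeight
  split_ifs
  · exact ex_count_le_one T C P t t₀ k s
  · exact (ex_const _ _).le

lemma ex_detectWeight_le {D : ℕ → ℕ} (hD : ∀ t, D t ≤ Nat.clog 2 T) (t₀ u v t : ℕ)
    (s : MetaState K) : ex (metaTurnLaw T C P t s) (detectWeight D t₀ u v t s) ≤ 1 := by
  unfold detectWeight
  split_ifs with h h'
  · have := ex_detect_le_one T C P (t := t) (t₀ := t₀) (Nat.one_le_iff_ne_zero.2 h.2) (hD t) s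
    simpa only [h', and_self, if_true] using this
  · exact (ex_const _ _).le
  · exact (ex_const _ _).le

/-- The indices of the exponential weights controlling the deviations of gap estimates. -/
def concIndex (K T : ℕ) : Finset (ℕ × ℕ × Fin K × Fin K × Fin K × ℕ) :=
  range (T + 1) ×ˢ range (T + 1) ×ˢ univ ×ˢ univ ×ˢ univ ×ˢ range (2 * T ^ 3 + 1)

/-- The indices of the weights controlling the number of replays of each length. -/
def countIndex (T : ℕ) : Finset (ℕ × ℕ × ℕ × ℕ) :=
  range (T + 1) ×ˢ range (T + 1) ×ˢ range (T + 1) ×ˢ range (T + 1)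

/-- The indices of the weights controlling the delay until a replay detects a suboptimal arm. -/
def detectIndex (K T : ℕ) : Finset (ℕ × ℕ × Fin K × ℕ) :=
  Icc 1 T ×ˢ Icc 1 T ×ˢ univ ×ˢ range (T + 1)

/-- The sum of the products over the rounds of all weights. As long as it is not large, a run is
typical. -/
def totalWeight (P : ℕ → Fin K → Fin K → ℝ) (T : ℕ) (D : ℕ → Fin K → ℕ → ℕ)
    (ω : ℕ → MetaTurn K) : ℝ≥0∞ :=
  ∑ i ∈ concIndex K T, ∏ t ∈ Icc 1 T,
    concWeight P i.1 i.2.1 i.2.2.1 i.2.2.2.1 i.2.2.2.2.1 i.2.2.2.2.2 t (ω t) +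
  ∑ i ∈ countIndex T, ∏ t ∈ Icc 1 T,
    countWeight i.1 i.2.1 i.2.2.1 i.2.2.2 t (metaEnd T ω (t - 1)) (ω t) +
  ∑ i ∈ detectIndex K T, ∏ t ∈ Icc 1 T,
    detectWeight (D i.2.1 i.2.2.1) i.1 i.2.1 i.2.2.2 t (metaEnd T ω (t - 1)) (ω t)

lemma ex_totalWeight_le (hP : ∀ t ∈ Icc 1 T, IsPreferenceMatrix (P t))
    {D : ℕ → Fin K → ℕ → ℕ} (hD : ∀ s a t, 1 ≤ s → D s a t ≤ Nat.clog 2 T) :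
    ex (metaLaw T C P T) (totalWeight P T D) ≤
      ((#(concIndex K T) + #(countIndex T) + #(detectIndex K T) : ℕ) : ℝ≥0∞) := by
  unfold totalWeight
  rw [ex_add, ex_add, ex_sum, ex_sum, ex_sum, Nat.cast_add, Nat.cast_add]
  refine add_le_add (add_le_add ?_ ?_) ?_
  · refine (sum_le_sum fun i _ => ex_prod_metaLaw_le_one (fun t _ x => concWeight P i.1 i.2.1
      i.2.2.1 i.2.2.2.1 i.2.2.2.2.1 i.2.2.2.2.2 t x) T fun t ht s =>
        ex_concWeight_le hP _ _ _ _ _ _ ht s).trans ?_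
    simp
  · refine (sum_le_sum fun i _ => ex_prod_metaLaw_le_one (fun t s x =>
      countWeight i.1 i.2.1 i.2.2.1 i.2.2.2 t s x) T fun t ht s =>
        ex_countWeight_le _ _ _ _ _ s).trans ?_
    simp
  · refine (sum_le_sum fun i hi => ex_prod_metaLaw_le_one (fun t s x =>
      detectWeight (D i.2.1 i.2.2.1) i.1 i.2.1 i.2.2.2 t s x) T fun t ht s =>
        ex_detectWeight_le (fun τ => hD _ _ _ ?_) _ _ _ _ s).trans ?_
    · simp only [detectIndex, mem_product, mem_Icc] at hi
      exact hi.2.1.1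
    · simp

section Good

variable {ω : ℕ → MetaTurn K} {D : ℕ → Fin K → ℕ → ℕ} {Λ : ℝ}

/-- Concentration of the estimates. The scale `n` at which the exponential weight is taken is the
noise level up to a constant factor, which balances the two terms of the exponent. -/
lemma sum_estimate_sub_le (hω : IsRun T C (fun t => (ω t).1) (metaEnd T ω) fun t => turnLog t (ω t))
    (hKT : K ≤ T) (hΛ : 1 ≤ Λ) (h : totalWeight P T D ω ≤ ENNReal.ofReal (Real.exp Λ))
    {s₁ s₂ : ℕ} (h1 : 1 ≤ s₁) (h2 : s₁ ≤ s₂) (h3 : s₂ ≤ T) (a a' c : Fin K)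
    (hmem : ∀ s ∈ Icc s₁ s₂, a ∈ (turnLog s (ω s)).cand ∧ a' ∈ (turnLog s (ω s)).cand) :
    ∑ s ∈ Icc s₁ s₂, (bordaEstimate (turnLog s (ω s)) a' (Pi.single c 1)
        - bordaEstimate (turnLog s (ω s)) a (Pi.single c 1) - (P s a' c - P s a c)) ≤
      3 * Λ * noiseLevel (fun t => turnLog t (ω t)) s₁ s₂ := by
  set L : ℕ → RoundLog K := fun t => turnLog t (ω t) with hL
  have hK1 : (1 : ℝ) ≤ K := by exact_mod_cast Nat.one_le_iff_ne_zero.2 (NeZero.ne K)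
  have hKT' : (K : ℝ) ≤ T := by exact_mod_cast hKT
  have hT1 : (1 : ℝ) ≤ T := hK1.trans hKT'
  have hrate : ∀ r ∈ Icc s₁ s₂, 0 < (L r).rate ∧ (L r).rate ≤ 1 ∧ ((L r).rate)⁻¹ ≤ 2 * T := by
    intro r hr
    have hr' := mem_Icc.1 hr
    have h4 := hω.rate_facts (s := r) (by omega)
    refine ⟨h4.1, h4.2, ?_⟩
    rw [hω.rate r (by omega)]
    refine (inv_learningRate_le _).trans ?_
    have h5 : cbrt ((r - (ω r).1.cur.first : ℕ) : ℝ) ≤ T := by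
      refine cbrt_le_of_le_pow (by positivity) (by positivity) ?_
      have : ((r - (ω r).1.cur.first : ℕ) : ℝ) ≤ T := by exact_mod_cast (by omega)
      exact this.trans (le_self_pow₀ hT1 (by norm_num))
    have h6 : cbrt ((r - (ω r).1.cur.first : ℕ) : ℝ) / cbrt (K : ℝ) ^ 2 ≤ T := by
      refine (div_le_self (cbrt_nonneg (by positivity)) (one_le_pow₀ one_le_cbrt_arms)).trans h5
    linarith
  set B := (K : ℝ) ^ 2 * ⨆ s : Set.Icc s₁ s₂, ((L s).rate)⁻¹ with hB
  set V := (K : ℝ) ^ 2 * ∑ s ∈ Icc s₁ s₂, ((L s).rate)⁻¹ with hV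
  have hnoise : noiseLevel L s₁ s₂ = √V + B := rfl
  have hBr : ∀ r ∈ Icc s₁ s₂, (K : ℝ) ^ 2 / (L r).rate ≤ B := fun r hr => by
    rw [div_eq_mul_inv, hB]
    have := inv_rate_le_iSup L hr
    gcongr
  have hs1 : s₁ ∈ Icc s₁ s₂ := mem_Icc.2 ⟨le_rfl, h2⟩
  have hinv1 : ∀ r ∈ Icc s₁ s₂, 1 ≤ ((L r).rate)⁻¹ := fun r hr =>
    (one_le_inv₀ (hrate r hr).1).2 (hrate r hr).2.1
  have hB1 : 1 ≤ B := by
    refine le_trans ?_ (hBr s₁ hs1)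
    rw [div_eq_mul_inv]
    exact one_le_mul_of_one_le_of_one_le (one_le_pow₀ hK1) (hinv1 s₁ hs1)
  have hV1 : 1 ≤ V := by
    refine one_le_mul_of_one_le_of_one_le (one_le_pow₀ hK1) ((hinv1 s₁ hs1).trans ?_)
    exact single_le_sum (f := fun s => ((L s).rate)⁻¹)
      (fun r hr => zero_le_one.trans (hinv1 r hr)) hs1
  have hsV1 : 1 ≤ √V := by rwa [Real.one_le_sqrt]
  have hB2 : B ≤ 2 * (T : ℝ) ^ 3 := by
    have : Nonempty (Set.Icc s₁ s₂) := ⟨⟨s₁, Set.mem_Icc.2 ⟨le_rfl, h2⟩⟩⟩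
    have : (⨆ s : Set.Icc s₁ s₂, ((L s).rate)⁻¹) ≤ 2 * T :=
      ciSup_le fun s => (hrate s (mem_Icc.2 s.2)).2.2
    calc B ≤ (T : ℝ) ^ 2 * (2 * T) := by
          rw [hB]
          gcongr
          exact zero_le_one.trans ((hinv1 s₁ hs1).trans (inv_rate_le_iSup L hs1))
      _ = _ := by ring
  have hV2 : √V ≤ 2 * (T : ℝ) ^ 3 := by
    rw [Real.sqrt_le_left (by positivity)]
    have h4 : ∑ s ∈ Icc s₁ s₂, ((L s).rate)⁻¹ ≤ T * (2 * T) := by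
      calc _ ≤ ∑ s ∈ Icc s₁ s₂, (2 * T : ℝ) := sum_le_sum fun r hr => (hrate r hr).2.2
        _ = (#(Icc s₁ s₂) : ℝ) * (2 * T) := by rw [sum_const, nsmul_eq_mul]
        _ ≤ _ := by
          gcongr
          rw [Nat.card_Icc]
          omega
    calc V ≤ (T : ℝ) ^ 2 * (T * (2 * T)) := by
          rw [hV]
          gcongr
          exact sum_nonneg fun r hr => zero_le_one.trans (hinv1 r hr)
      _ = 2 * (T : ℝ) ^ 4 * 1 := by ring
      _ ≤ 2 * (T : ℝ) ^ 4 * (2 * (T : ℝ) ^ 2) := by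
        gcongr
        have : (1 : ℝ) ≤ (T : ℝ) ^ 2 := one_le_pow₀ hT1
        linarith
      _ = _ := by ring
  set n := ⌈max B √V⌉₊ with hn
  have hn1 : max B √V ≤ n := Nat.le_ceil _
  have hnB : B ≤ n := (le_max_left _ _).trans hn1
  have hnV : √V ≤ n := (le_max_right _ _).trans hn1
  have hn0 : (0 : ℝ) < n := by linarith
  have hn2 : n ≤ 2 * T ^ 3 := by
    rw [hn, Nat.ceil_le]
    push_cast
    exact max_le hB2 hV2
  have hn3 : (n : ℝ) ≤ noiseLevel L s₁ s₂ := by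
    have h4 : (n : ℝ) < max B √V + 1 := Nat.ceil_lt_add_one (by positivity)
    rw [hnoise]
    rcases max_cases B √V with h5 | h5 <;> linarith
  have hidx : (s₁, s₂, a, a', c, n) ∈ concIndex K T := by
    simp only [concIndex, mem_product, mem_range, mem_univ, true_and]
    omega
  have hprod : ∏ t ∈ Icc 1 T, concWeight P s₁ s₂ a a' c n t (ω t) ≤
      ENNReal.ofReal (Real.exp Λ) := by
    refine le_trans ?_ h
    unfold totalWeight
    refine le_trans ?_ le_self_add
    refine le_trans ?_ le_self_add
    exact single_le_sum (f := fun i : ℕ × ℕ × Fin K × Fin K × Fin K × ℕ => ∏ t ∈ Icc 1 T,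
      concWeight P i.1 i.2.1 i.2.2.1 i.2.2.2.1 i.2.2.2.2.1 i.2.2.2.2.2 t (ω t))
      (fun _ _ => zero_le) hidx
  have key := sum_le_of_prod_le (s := Icc s₁ s₂) (Icc_subset_Icc h1 h3)
    (f := fun t => (bordaEstimate (L t) a' (Pi.single c 1)
      - bordaEstimate (L t) a (Pi.single c 1) - (P t a' c - P t a c)) / n
      - (K : ℝ) ^ 2 / (2 * (L t).rate * n ^ 2))
    (fun t ht => by
      rw [concWeight, if_pos ⟨mem_Icc.1 ht, hmem t ht, (hBr t ht).trans hnB⟩])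
    (fun t _ ht => by
      rw [concWeight, if_neg fun hc => ht (mem_Icc.2 hc.1)]) hprod
  rw [sum_sub_distrib, ← sum_div] at key
  have hVsum : ∑ t ∈ Icc s₁ s₂, (K : ℝ) ^ 2 / (2 * (L t).rate * n ^ 2) = V / (2 * n ^ 2) := by
    rw [hV, mul_sum, sum_div]
    refine sum_congr rfl fun t ht => ?_
    have := (hrate t ht).1
    field_simp
  rw [hVsum] at key
  set X := ∑ s ∈ Icc s₁ s₂, (bordaEstimate (L s) a' (Pi.single c 1)
    - bordaEstimate (L s) a (Pi.single c 1) - (P s a' c - P s a c)) with hX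
  have hVn : V / (2 * (n : ℝ) ^ 2) ≤ 1 / 2 := by
    rw [div_le_iff₀ (by positivity)]
    have : V ≤ (n : ℝ) ^ 2 := (Real.sqrt_le_left hn0.le).1 hnV
    linarith
  have hXn : X / n ≤ 3 * Λ := by linarith
  rw [div_le_iff₀ hn0] at hXn
  exact hXn.trans (by gcongr)

lemma isGood_of_totalWeight_le
    (hω : IsRun T C (fun t => (ω t).1) (metaEnd T ω) fun t => turnLog t (ω t))
    (hKT : K ≤ T) (hΛ : 1 ≤ Λ) (h : totalWeight P T D ω ≤ ENNReal.ofReal (Real.exp Λ)) :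
    IsGood P T Λ (fun t => (ω t).1) (fun t => turnLog t (ω t)) D where
  conc s₁ s₂ h1 h2 h3 a a' c hmem := sum_estimate_sub_le hω hKT hΛ h h1 h2 h3 a a' c hmem
  count t₀ k u v ht₀ hu hv := by
    classical
    by_cases hk : k ≤ Nat.clog 2 T
    · by_cases huv : u ≤ v
      · have hkT : k ≤ T := hk.trans (Nat.clog_le_of_le_pow (Nat.lt_two_pow_self).le)
        have hidx : (t₀, k, u, v) ∈ countIndex T := by
          simp only [countIndex, mem_product, mem_range]
          omega
        have hprod : ∏ t ∈ Icc 1 T, countWeight t₀ k u v t (metaEnd T ω (t - 1)) (ω t) ≤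
            ENNReal.ofReal (Real.exp Λ) := by
          refine le_trans ?_ h
          unfold totalWeight
          refine le_trans ?_ le_self_add
          refine le_trans ?_ le_add_self
          exact single_le_sum (f := fun i : ℕ × ℕ × ℕ × ℕ => ∏ t ∈ Icc 1 T,
            countWeight i.1 i.2.1 i.2.2.1 i.2.2.2 t (metaEnd T ω (t - 1)) (ω t))
            (fun _ _ => zero_le) hidx
        have key := sum_le_of_prod_le (s := Icc u v) (Icc_subset_Icc (by omega) hv)
          (fun t ht => by rw [countWeight, if_pos (mem_Icc.1 ht)])
          (fun t _ ht => by rw [countWeight, if_neg fun hc => ht (mem_Icc.2 hc)]) hprod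
        rw [sum_sub_distrib, ← mul_sum] at key
        have hle : (#{t ∈ Icc u v | IsReplay (fun t => (ω t).1) t₀ (2 ^ k) t} : ℝ) ≤
            ∑ t ∈ Icc u v, (if (ω t).1 = startReplay t (2 ^ k) (metaEnd T ω (t - 1)) ∧
              (metaEnd T ω (t - 1)).episode = t₀ ∧ t₀ < t then (1 : ℝ) else 0) := by
          rw [← sum_filter, sum_const, nsmul_eq_mul, mul_one]
          have : #{t ∈ Icc u v | IsReplay (fun t => (ω t).1) t₀ (2 ^ k) t} ≤
              #{t ∈ Icc u v | (ω t).1 = startReplay t (2 ^ k) (metaEnd T ω (t - 1)) ∧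
                (metaEnd T ω (t - 1)).episode = t₀ ∧ t₀ < t} := by
            refine card_le_card fun t ht => ?_
            obtain ⟨ht', h4, h5, h6, h7⟩ := mem_filter.1 ht
            have ht'' := mem_Icc.1 ht'
            refine mem_filter.2 ⟨ht', ?_⟩
            obtain ⟨t, rfl⟩ : ∃ t', t = t' + 1 := ⟨t - 1, by omega⟩
            have h8 := hω.eq_startReplay (t := t) (by omega) (by omega) h5
              (by dsimp only at h6 ⊢; omega)
            dsimp only at h6 h7 h8
            rw [h7, h6] at h8
            exact ⟨h8.1, h8.2, h4⟩
          exact_mod_cast this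
        linarith
      · rw [Icc_eq_empty huv]
        simp
        linarith
    · have hempty : {t ∈ Icc u v | IsReplay (fun t => (ω t).1) t₀ (2 ^ k) t} = ∅ := by
        refine filter_eq_empty_iff.2 fun t ht hrep => hk ?_
        have ht' := mem_Icc.1 ht
        obtain ⟨h4, h5, h6, h7⟩ := hrep
        obtain ⟨k', -, h8, h9⟩ := (hω.inv (t := t) (by omega) (by omega)).replay h5
          (by dsimp only at h6 ⊢; omega)
        dsimp only at h7 h9
        have : k = k' := Nat.pow_right_injective le_rfl (h7.symm.trans h9)
        omega
      rw [hempty, card_empty, Nat.cast_zero]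
      have : 0 ≤ ∑ t ∈ Icc u v, replayProb (t - t₀) k := sum_nonneg fun t _ => replayProb_nonneg _ _
      linarith
  detect t₀ s a t ht₀ hs hst htT hep hno := by
    classical
    have hidx : (t₀, s, a, t) ∈ detectIndex K T := by
      simp only [detectIndex, mem_product, mem_Icc, mem_range, mem_univ, true_and]
      omega
    have hprod : ∏ τ ∈ Icc 1 T, detectWeight (D s a) t₀ s t τ (metaEnd T ω (τ - 1)) (ω τ) ≤
        ENNReal.ofReal (Real.exp Λ) := by
      refine le_trans ?_ h
      unfold totalWeight
      refine le_trans ?_ le_add_self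
      exact single_le_sum (f := fun i : ℕ × ℕ × Fin K × ℕ => ∏ τ ∈ Icc 1 T,
        detectWeight (D i.2.1 i.2.2.1) i.1 i.2.1 i.2.2.2 τ (metaEnd T ω (τ - 1)) (ω τ))
        (fun _ _ => zero_le) hidx
    rw [← sum_filter]
    refine sum_le_of_prod_le (s := {τ ∈ Ioo s t | D s a τ ≠ 0}) (fun τ hτ => ?_)
      (fun τ hτ => ?_) (fun τ _ hτ => ?_) hprod
    · have := mem_Ioo.1 (mem_filter.1 hτ).1
      exact mem_Icc.2 ⟨by omega, by omega⟩
    · obtain ⟨hτ', hne⟩ := mem_filter.1 hτ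
      have hτ'' := mem_Ioo.1 hτ'
      obtain ⟨r, rfl⟩ : ∃ r, τ = r + 1 := ⟨τ - 1, by omega⟩
      have h4 := hep (r + 1) (by omega) (by omega)
      have h5 := hω.episode_eq (t := r + 1) (r := r) (by omega) (by omega)
        (h4.trans_le (by omega)) (by omega)
      have h6 := (hω.endState r (by omega)).1
      rw [detectWeight, if_pos ⟨hτ', hne⟩, Nat.add_sub_cancel,
        if_pos ⟨h6.trans (h5.trans h4), by omega⟩, if_neg]
      rintro ⟨m, hm, hle⟩
      have h7 := hω.of_eq_startReplay (t := r) (by omega) hm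
      have h8 := hno (r + 1) hτ' hne m ⟨by omega, h7.1, h4, h7.2.1⟩
      omega
    · rw [detectWeight, if_neg fun hc => hτ (mem_filter.2 hc)]

end Good

end Probability

open scoped ENNReal

/-! ### The expected regret -/

section Expected

variable {K : ℕ} [NeZero K] {T : ℕ} {C : ℝ} {P : ℕ → Fin K → Fin K → ℝ} {astar aC : ℕ → Fin K}

lemma meanRegret_le_one {t : ℕ} (hP : IsPreferenceMatrix (P t)) (s : MetaState K) :
    meanRegret P aC t s ≤ 1 := by
  unfold meanRegret
  calc _ ≤ ∑ a, (playDist s.cur.cand (learningRate K (t - s.cur.first)) a).toReal * 1 := by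
        refine sum_le_sum fun a _ => mul_le_mul_of_nonneg_left ?_ ENNReal.toReal_nonneg
        have := (hP (aC t) a).2.1
        linarith
    _ = 1 := by simp only [mul_one, sum_toReal_pmf]

lemma sum_ofReal_meanRegret_le (hP : ∀ t ∈ Icc 1 T, IsPreferenceMatrix (P t))
    (ω : ℕ → MetaTurn K) :
    ∑ t ∈ Icc 1 T, ENNReal.ofReal (meanRegret P aC t (ω t).1) ≤ T := by
  calc _ ≤ ∑ t ∈ Icc 1 T, (1 : ℝ≥0∞) := sum_le_sum fun t ht => by
        rw [ENNReal.ofReal_le_one]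
        exact meanRegret_le_one (hP t ht) _
    _ = T := by simp

lemma expectedRegret_le_horizon (hP : ∀ t ∈ Icc 1 T, IsPreferenceMatrix (P t))
    (hC : ∀ t ∈ Icc 1 T, IsCondorcetWinner (P t) (aC t)) :
    expectedCondorcetRegret (metaAlgorithm K T C) P aC T ≤ T := by
  rw [← ENNReal.ofReal_le_ofReal_iff (by positivity), ofReal_expectedCondorcetRegret hC,
    ENNReal.ofReal_natCast]
  exact ex_le_const _ fun ω _ => sum_ofReal_meanRegret_le hP ω

/-- A bound on the regret of typical runs carries over to the expected regret. -/
lemma expectedRegret_le_of_typical (hP : ∀ t ∈ Icc 1 T, IsPreferenceMatrix (P t))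
    (hC : ∀ t ∈ Icc 1 T, IsCondorcetWinner (P t) (aC t)) {D : ℕ → Fin K → ℕ → ℕ}
    (hD : ∀ s a t, 1 ≤ s → D s a t ≤ Nat.clog 2 T) {Λ B : ℝ} (hB : 0 ≤ B)
    (hbound : ∀ ω ∈ (metaLaw T C P T).support,
      totalWeight P T D ω ≤ ENNReal.ofReal (Real.exp Λ) →
      ∑ t ∈ Icc 1 T, meanRegret P aC t (ω t).1 ≤ B) :
    expectedCondorcetRegret (metaAlgorithm K T C) P aC T ≤
      B + T * Real.exp (-Λ) * (#(concIndex K T) + #(countIndex T) + #(detectIndex K T) : ℕ) := by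
  have h0 : ∀ t ∈ Icc 1 T, ∀ s, 0 ≤ meanRegret P aC t s := fun t ht s =>
    sum_nonneg fun a _ => mul_nonneg ENNReal.toReal_nonneg (by have := hC t ht a; linarith)
  rw [← ENNReal.ofReal_le_ofReal_iff (by positivity), ofReal_expectedCondorcetRegret hC,
    ENNReal.ofReal_add hB (by positivity), ENNReal.ofReal_mul (by positivity),
    ENNReal.ofReal_natCast]
  set w : ℝ≥0∞ := ENNReal.ofReal (T * Real.exp (-Λ)) with hw
  have hpoint : ∀ ω ∈ (metaLaw T C P T).support,
      ∑ t ∈ Icc 1 T, ENNReal.ofReal (meanRegret P aC t (ω t).1) ≤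
        ENNReal.ofReal B + w * totalWeight P T D ω := by
    intro ω hω
    rcases le_total (totalWeight P T D ω) (ENNReal.ofReal (Real.exp Λ)) with h | h
    · rw [← ENNReal.ofReal_sum_of_nonneg fun t ht => h0 t ht _]
      exact (ENNReal.ofReal_le_ofReal (hbound ω hω h)).trans le_self_add
    · refine (sum_ofReal_meanRegret_le hP ω).trans ?_
      have h1 : w * ENNReal.ofReal (Real.exp Λ) = T := by
        rw [hw, ← ENNReal.ofReal_mul (by positivity), mul_assoc, ← Real.exp_add]
        simp
      calc (T : ℝ≥0∞) = w * ENNReal.ofReal (Real.exp Λ) := h1.symm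
        _ ≤ w * totalWeight P T D ω := by gcongr
        _ ≤ _ := le_add_self
  refine (ex_mono _ hpoint).trans ?_
  rw [ex_add, ex_const, ex_mul_left]
  gcongr
  exact ex_totalWeight_le hP hD

omit [NeZero K] in
lemma card_index_le (hKT : K ≤ T) (hT : 2 ≤ T) :
    #(concIndex K T) + #(countIndex T) + #(detectIndex K T) ≤ T ^ 19 := by
  have h1 : #(concIndex K T) = (T + 1) * ((T + 1) * (K * (K * (K * (2 * T ^ 3 + 1))))) := by
    simp [concIndex]
  have h2 : #(countIndex T) = (T + 1) * ((T + 1) * ((T + 1) * (T + 1))) := by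
    simp [countIndex]
  have h3 : #(detectIndex K T) = T * (T * (K * (T + 1))) := by
    simp [detectIndex]
  have e1 : T + 1 ≤ T ^ 2 := by nlinarith
  have e2 : 2 * T ^ 3 + 1 ≤ T ^ 5 := by
    have : 1 ≤ T ^ 3 := Nat.one_le_pow _ _ (by omega)
    have h4 : 2 * 2 ≤ T * T := Nat.mul_le_mul hT hT
    calc 2 * T ^ 3 + 1 ≤ 2 * 2 * T ^ 3 := by omega
      _ ≤ T * T * T ^ 3 := Nat.mul_le_mul_right _ h4
      _ = T ^ 5 := by ring
  rw [h1, h2, h3]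
  calc _ ≤ T ^ 2 * (T ^ 2 * (T * (T * (T * T ^ 5)))) + T ^ 2 * (T ^ 2 * (T ^ 2 * T ^ 2)) +
        T * (T * (T * T ^ 2)) := by gcongr
    _ = T ^ 12 + T ^ 8 + T ^ 5 := by ring
    _ ≤ T ^ 17 + T ^ 17 + T ^ 17 := by gcongr <;> omega
    _ ≤ 2 * 2 * T ^ 17 := by omega
    _ ≤ T * T * T ^ 17 := Nat.mul_le_mul_right _ (Nat.mul_le_mul hT hT)
    _ = T ^ 19 := by ring

lemma clog_le_log (hT : 1 ≤ T) : (Nat.clog 2 T : ℝ) ≤ 1 + 2 * Real.log T := by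
  have h1 : (1 : ℝ) ≤ T := by exact_mod_cast hT
  have h2 : 0 ≤ Real.logb 2 T := Real.logb_nonneg (by norm_num) h1
  have h3 : (Nat.clog 2 T : ℝ) < Real.logb 2 T + 1 := by
    rw [← Real.natCeil_logb_natCast]
    exact_mod_cast Nat.ceil_lt_add_one (a := Real.logb ((2 : ℕ) : ℝ) T) (by exact_mod_cast h2)
  have h4 : Real.logb 2 T ≤ 2 * Real.log T := by
    rw [Real.logb, div_le_iff₀ (Real.log_pos (by norm_num))]
    have := Real.log_two_gt_d9
    have := Real.log_nonneg h1
    nlinarith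
  linarith

omit [NeZero K] in
/-- The number of phases that meet the rounds `1, …, T`. -/
lemma phaseRoot_phaseStarts_le {z : ℕ → ℕ} {α : ℕ → Fin K} (hT : 1 ≤ T)
    (hZ : IsPhasing P astar T (phaseStarts P astar T) z α) :
    phaseRoot (phaseStarts P astar T) 1 T ≤ cbrt (approxPhases P astar T) := by
  refine cbrt_le_cbrt (by positivity) ?_
  have h1 : 1 ∈ phaseStarts P astar T := by
    have h2 := hZ.mem 1 le_rfl hT
    have h3 := hZ.one_le 1 le_rfl hT
    have h4 := hZ.le 1 le_rfl hT
    rwa [show z 1 = 1 by omega] at h2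
  have h5 : changes (phaseStarts P astar T) 1 T < #(phaseStarts P astar T) := by
    refine card_lt_card (ssubset_iff_of_subset (filter_subset _ _) |>.2 ⟨1, h1, by simp⟩)
  exact_mod_cast h5.trans_le (card_phaseStarts_le T)

lemma expectedRegret_le (hK : K ≤ T) (hT : 2 ≤ T) (hC100 : 100 ≤ C)
    (hP : ∀ t ∈ Icc 1 T, IsPreferenceMatrix (P t))
    (hdom : ∀ t ∈ Icc 1 T, IsDominantArm (P t) (astar t))
    (hC : ∀ t ∈ Icc 1 T, IsCondorcetWinner (P t) (aC t)) :
    expectedCondorcetRegret (metaAlgorithm K T C) P aC T ≤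
      965 * ((21 * C + 1300) * (1 + Real.log T)) ^ 5 *
        (cbrt (K : ℝ) ^ 2 * cbrt (T : ℝ) ^ 2 * cbrt (approxPhases P astar T)) := by
  obtain ⟨z, α, hZ⟩ := exists_isPhasing P astar T
  have hT2 : (2 : ℝ) ≤ T := by exact_mod_cast hT
  have hK1 : (1 : ℝ) ≤ K := by exact_mod_cast Nat.one_le_iff_ne_zero.2 (NeZero.ne K)
  have hKT : (K : ℝ) ≤ T := by exact_mod_cast hK
  set l := Real.log T with hl
  have hl2 : 0.69 ≤ l := by
    have := Real.log_two_gt_d9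
    have := Real.log_le_log (by norm_num) hT2
    linarith
  set H := (21 * C + 1300) * (1 + l) with hH
  have hCl : 0 ≤ C * l := by positivity
  have hHexp : H = 21 * C + 1300 + 21 * (C * l) + 1300 * l := by rw [hH]; ring
  have hH1 : 1 ≤ H := by linarith
  have hpr := phaseRoot_phaseStarts_le (by omega) hZ
  have hp1 := one_le_phaseRoot (phaseStarts P astar T) 1 T
  have hlen : lengthRoot 1 T = cbrt T := by
    rw [lengthRoot, show T - 1 + 1 = T by omega]
  have hκ1 : 1 ≤ cbrt (K : ℝ) := one_le_cbrt_arms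
  have hT1 : 1 ≤ cbrt (T : ℝ) := one_le_cbrt (by linarith)
  set X := cbrt (K : ℝ) ^ 2 * cbrt (T : ℝ) ^ 2 * cbrt (approxPhases P astar T) with hX
  have hX1 : 1 ≤ X := one_le_mul_of_one_le_of_one_le
    (one_le_mul_of_one_le_of_one_le (one_le_pow₀ hκ1) (one_le_pow₀ hT1)) (hp1.trans hpr)
  -- At most `T ^ 19` indices, each failing with weight `T ^ (-20)` and then costing at most `T`,
  -- leave an additive `1`.
  have hmain := expectedRegret_le_of_typical (C := C) hP hC
    (D := needFor P astar α z T H) (fun s a t hs => replayNeed_le t hs) (Λ := 20 * l)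
    (B := 964 * H ^ 5 * X) (by positivity) (fun ω hω hw => by
      have hrun := isRun_of_mem_support (by omega) hω
      have hgood := isGood_of_totalWeight_le hrun hK (by linarith) hw
      have htyp : IsTypical P astar T (phaseStarts P astar T) z α C (20 * l) H
          (fun t => (ω t).1) (metaEnd T ω) (fun t => turnLog t (ω t)) :=
        { env := ⟨hP, hdom⟩
          phasing := hZ
          run := hrun
          good := hgood
          nonneg := by positivity
          le_log := by nlinarith
          log_le := by linarith
          twelve_le := by linarith
          clog_le := (clog_le_log (by omega)).trans (by linarith)
          log_arms_le := by
            have := Real.log_le_log (by linarith) hKT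
            linarith }
      refine (htyp.sum_meanRegret_le (aC := aC) (by omega)).trans ?_
      rw [hlen, hX]
      have h1 : cbrt (K : ℝ) ^ 2 * phaseRoot (phaseStarts P astar T) 1 T * cbrt (T : ℝ) ^ 2 ≤
          cbrt (K : ℝ) ^ 2 * cbrt (approxPhases P astar T) * cbrt (T : ℝ) ^ 2 := by gcongr
      calc _ ≤ 964 * H ^ 5 *
            (cbrt (K : ℝ) ^ 2 * cbrt (approxPhases P astar T) * cbrt (T : ℝ) ^ 2) := by gcongr
        _ = _ := by ring)
  have hexp : Real.exp (-(20 * l)) = ((T : ℝ) ^ 20)⁻¹ := by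
    rw [Real.exp_neg, mul_comm, hl, show (20 : ℝ) = ((20 : ℕ) : ℝ) by norm_num,
      Real.exp_mul, Real.exp_log (by linarith), Real.rpow_natCast]
  have hrest : (T : ℝ) * Real.exp (-(20 * l)) *
      (#(concIndex K T) + #(countIndex T) + #(detectIndex K T) : ℕ) ≤ 1 := by
    have h1 : ((#(concIndex K T) + #(countIndex T) + #(detectIndex K T) : ℕ) : ℝ) ≤
        (T : ℝ) ^ 19 := by exact_mod_cast card_index_le hK hT
    rw [hexp]
    calc _ ≤ (T : ℝ) * ((T : ℝ) ^ 20)⁻¹ * (T : ℝ) ^ 19 := by gcongr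
      _ = 1 := by field_simp
  have hone : 1 ≤ H ^ 5 * X := one_le_mul_of_one_le_of_one_le (one_le_pow₀ hH1) hX1
  linarith

/-- The bound in terms of the number of phases implies that in terms of the variation. -/
lemma cbrt_approxPhases_le (hT : 1 ≤ T) (hdom : ∀ t ∈ Icc 1 T, IsDominantArm (P t) (astar t)) :
    cbrt (K : ℝ) ^ 2 * cbrt (T : ℝ) ^ 2 * cbrt (approxPhases P astar T) ≤
      2 * ((K : ℝ) ^ (1 / 2 : ℝ) * (totalVariation P T) ^ (1 / 4 : ℝ) * (T : ℝ) ^ (3 / 4 : ℝ)) +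
        cbrt (K : ℝ) ^ 2 * cbrt (T : ℝ) ^ 2 := by
  obtain ⟨hS1, hS⟩ := approxPhases_sub_one_pow_le hT hdom
  have hS1' : (1 : ℝ) ≤ approxPhases P astar T := by exact_mod_cast hS1
  set S : ℝ := (approxPhases P astar T : ℝ)
  have hV : 0 ≤ totalVariation P T := sum_nonneg fun t _ => Real.iSup_nonneg fun _ => abs_nonneg _
  set V := totalVariation P T
  set w := cbrt (S - 1) with hw
  have hw0 : 0 ≤ w := cbrt_nonneg (by linarith)
  have hw3 : w ^ 3 = S - 1 := cbrt_pow_three (by linarith)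
  set κ := cbrt (K : ℝ)
  set l := cbrt (T : ℝ)
  have hκ3 : κ ^ 3 = K := cbrt_pow_three (by positivity)
  have hl3 : l ^ 3 = T := cbrt_pow_three (by positivity)
  set X := (K : ℝ) ^ (1 / 2 : ℝ) * V ^ (1 / 4 : ℝ) * (T : ℝ) ^ (3 / 4 : ℝ) with hX
  have hX0 : 0 ≤ X := by positivity
  have hX12 : X ^ 12 = (K : ℝ) ^ 6 * V ^ 3 * (T : ℝ) ^ 9 := by
    rw [hX, mul_pow, mul_pow, ← Real.rpow_mul_natCast (by positivity),
      ← Real.rpow_mul_natCast hV, ← Real.rpow_mul_natCast (by positivity)]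
    norm_num
  have h1 : cbrt S ≤ 1 + w := by
    refine cbrt_le_of_le_pow (by linarith) (by linarith) ?_
    have : S = 1 + w ^ 3 := by linarith
    nlinarith [sq_nonneg w]
  have h2 : κ ^ 2 * l ^ 2 * w ≤ 2 * X := by
    refine le_of_pow_le_pow_left₀ (n := 12) (by norm_num) (by positivity) ?_
    calc (κ ^ 2 * l ^ 2 * w) ^ 12 = (κ ^ 3) ^ 6 * (l ^ 3) ^ 8 * ((w ^ 3) ^ 4 * (κ ^ 3) ^ 2) := by
          ring
      _ = (K : ℝ) ^ 6 * (T : ℝ) ^ 8 * ((S - 1) ^ 4 * (K : ℝ) ^ 2) := by rw [hκ3, hl3, hw3]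
      _ ≤ (K : ℝ) ^ 6 * (T : ℝ) ^ 8 * (T * (2 * V) ^ 3) := by gcongr
      _ = 8 * X ^ 12 := by rw [hX12]; ring
      _ ≤ (2 * X) ^ 12 := by
          have : 0 ≤ X ^ 12 := by positivity
          rw [mul_pow]
          linarith
  calc κ ^ 2 * l ^ 2 * cbrt S ≤ κ ^ 2 * l ^ 2 * (1 + w) := by gcongr
    _ = κ ^ 2 * l ^ 2 * w + κ ^ 2 * l ^ 2 := by ring
    _ ≤ _ := by linarith

/-- The regret bound in terms of the number of phases. -/
lemma expectedRegret_le_phases (hT : 1 ≤ T) (hC100 : 100 ≤ C)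
    (hP : ∀ t ∈ Icc 1 T, IsPreferenceMatrix (P t))
    (hdom : ∀ t ∈ Icc 1 T, IsDominantArm (P t) (astar t))
    (hC : ∀ t ∈ Icc 1 T, IsCondorcetWinner (P t) (aC t)) :
    expectedCondorcetRegret (metaAlgorithm K T C) P aC T ≤
      965 * ((21 * C + 1300) * (1 + Real.log (K * T))) ^ 5 *
        (cbrt (K : ℝ) ^ 2 * cbrt (T : ℝ) ^ 2 * cbrt (approxPhases P astar T)) := by
  have hT1 : (1 : ℝ) ≤ T := by exact_mod_cast hT
  have hK1 : (1 : ℝ) ≤ K := by exact_mod_cast Nat.one_le_iff_ne_zero.2 (NeZero.ne K)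
  have hl : 0 ≤ Real.log T := Real.log_nonneg hT1
  have hlog : Real.log T ≤ Real.log (K * T) := Real.log_le_log (by linarith)
    (le_mul_of_one_le_left (by linarith) hK1)
  have hS : (1 : ℝ) ≤ approxPhases P astar T := by
    exact_mod_cast (approxPhases_sub_one_pow_le hT hdom).1
  have hS1 := one_le_cbrt hS
  have hκ1 : 1 ≤ cbrt (K : ℝ) := one_le_cbrt_arms
  have hl1 : 1 ≤ cbrt (T : ℝ) := one_le_cbrt hT1
  by_cases h : K ≤ T ∧ 2 ≤ T
  · refine (expectedRegret_le h.1 h.2 hC100 hP hdom hC).trans ?_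
    gcongr
  · refine (expectedRegret_le_horizon hP hC).trans ?_
    have hl3 : cbrt (T : ℝ) ^ 3 = T := cbrt_pow_three (by positivity)
    have hle : cbrt (T : ℝ) ≤ cbrt (K : ℝ) ^ 2 := by
      rcases not_and_or.1 h with h | h
      · have : cbrt (T : ℝ) ≤ cbrt (K : ℝ) :=
          cbrt_le_cbrt (by positivity) (by exact_mod_cast (not_le.1 h).le)
        exact this.trans (le_self_pow₀ hκ1 (by norm_num))
      · obtain rfl : T = 1 := by omega
        rw [Nat.cast_one, cbrt_one]
        exact one_le_pow₀ hκ1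
    have hbig : 1 ≤ 965 * ((21 * C + 1300) * (1 + Real.log (K * T))) ^ 5 := by
      have : 1 ≤ (21 * C + 1300) * (1 + Real.log (K * T)) :=
        one_le_mul_of_one_le_of_one_le (by linarith) (by linarith)
      have := one_le_pow₀ this (n := 5)
      linarith
    calc (T : ℝ) = 1 * (cbrt (T : ℝ) * cbrt (T : ℝ) ^ 2 * 1) := by
          rw [one_mul, mul_one, ← pow_succ', hl3]
      _ ≤ _ := by gcongr

end Expected

end DuelingBandit

end

theorem mainTheorem2 :
    ∃ C₀ : ℝ, 0 < C₀ ∧ ∀ C : ℝ, C₀ ≤ C → ∃ (c : ℝ) (p : ℕ), 0 < c ∧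
      ∀ (K T : ℕ) [NeZero K], 1 ≤ T →
      ∀ (P : ℕ → Fin K → Fin K → ℝ) (astar aC : ℕ → Fin K),
        (∀ t ∈ Finset.Icc 1 T, DuelingBandit.IsPreferenceMatrix (P t)) →
        (∀ t ∈ Finset.Icc 1 T, DuelingBandit.IsDominantArm (P t) (astar t)) →
        (∀ t ∈ Finset.Icc 1 T, DuelingBandit.IsCondorcetWinner (P t) (aC t)) →
        DuelingBandit.expectedCondorcetRegret (DuelingBandit.metaAlgorithm K T C) P aC T ≤
          c * (1 + Real.log ((K : ℝ) * (T : ℝ))) ^ p *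
            min
              ((K : ℝ) ^ (2 / 3 : ℝ) * (T : ℝ) ^ (2 / 3 : ℝ) *
                (DuelingBandit.approxPhases P astar T : ℝ) ^ (1 / 3 : ℝ))
              ((K : ℝ) ^ (1 / 2 : ℝ) * (DuelingBandit.totalVariation P T) ^ (1 / 4 : ℝ) *
                  (T : ℝ) ^ (3 / 4 : ℝ)
                + (K : ℝ) ^ (2 / 3 : ℝ) * (T : ℝ) ^ (2 / 3 : ℝ)) := by
  refine ⟨100, by norm_num, fun C hC => ⟨2 * (965 * (21 * C + 1300) ^ 5), 5, by positivity, ?_⟩⟩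
  intro K T _ hT P astar aC hP hdom hcond
  have h1 := DuelingBandit.expectedRegret_le_phases hT hC hP hdom hcond
  have h2 := DuelingBandit.cbrt_approxPhases_le (K := K) hT hdom
  have hT1 : (1 : ℝ) ≤ T := by exact_mod_cast hT
  have hK1 : (1 : ℝ) ≤ K := by exact_mod_cast Nat.one_le_iff_ne_zero.2 (NeZero.ne K)
  have hlog : 0 ≤ Real.log ((K : ℝ) * T) :=
    Real.log_nonneg (one_le_mul_of_one_le_of_one_le hK1 hT1)
  rw [DuelingBandit.rpow_two_thirds (by positivity), DuelingBandit.rpow_two_thirds (by positivity)]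
  change _ ≤ _ * min (_ * DuelingBandit.cbrt (DuelingBandit.approxPhases P astar T)) _
  set X := DuelingBandit.cbrt (K : ℝ) ^ 2 * DuelingBandit.cbrt (T : ℝ) ^ 2 *
    DuelingBandit.cbrt (DuelingBandit.approxPhases P astar T) with hX
  have hX0 : 0 ≤ X := mul_nonneg (by positivity) (DuelingBandit.cbrt_nonneg (by positivity))
  set Y := (K : ℝ) ^ (1 / 2 : ℝ) * (DuelingBandit.totalVariation P T) ^ (1 / 4 : ℝ) *
    (T : ℝ) ^ (3 / 4 : ℝ) + DuelingBandit.cbrt (K : ℝ) ^ 2 * DuelingBandit.cbrt (T : ℝ) ^ 2 with hY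
  have hXY : X ≤ 2 * min X Y := by
    have h3 : 0 ≤ DuelingBandit.cbrt (K : ℝ) ^ 2 * DuelingBandit.cbrt (T : ℝ) ^ 2 := by positivity
    rcases min_choice X Y with h | h <;> rw [h] <;> linarith
  calc _ ≤ 965 * ((21 * C + 1300) * (1 + Real.log (K * T))) ^ 5 * X := h1
    _ ≤ 965 * ((21 * C + 1300) * (1 + Real.log (K * T))) ^ 5 * (2 * min X Y) := by gcongr
    _ = _ := by ring
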